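/- Let $m\ge 1$ be a square-free integer, $K=\mathbb{Q}(\sqrt{-m})\subset\mathbb{C}$, $R$ its ring of integers and $\Gamma=\mathrm{PSL}_2(R)$ the Bianchi group, a discrete group acting on hyperbolic three-space $\mathcal{H}=\mathbb{C}\times\mathbb{R}_{>0}$ and, by Möbius transformations, on $\mathbb{C}\cup\{\infty\}$. Let $P=K\cup\{\infty\}$ be the set of rational boundary points. For a $\Gamma$-stable subset $S\subseteq P$ let $$\mathcal{H}(S)=\mathcal{H}\cup\bigcup_{D\in S}Y_D$$ be the (partial) Borel–Serre space: $Y_D\cong\mathbb{R}^2$ is the space of rank-one real split tori in the stabiliser $Q_D$ of $D$, each $\mathcal{H}_D=\mathcal{H}\cup Y_D$ has Serre's topology of a manifold with boundary (for $g\infty=D$, $n_z=\left(\begin{smallmatrix}1&z\\0&1\end{smallmatrix}\right)$ and $A=\{\mathrm{diag}(t,1/t):t>0\}$, the chart $\mathbb{C}\times\mathbb{R}_{\ge 0}\to\mathcal{H}_D$ sends $(z,t)$ to $g(z,1/t)$ if $t>0$ and to $(gn_z)A(gn_z)^{-1}$ if $t=0$), and the spaces $\mathcal{H}_D$, $D\in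 S$, are glued along $\mathcal{H}$. Thus $\mathcal{H}(P)$ is the "universal cover" of the Borel–Serre compactification $\Gamma\backslash\mathcal{H}(P)$ of $\Gamma\backslash\mathcal{H}$. A proper $\Gamma$-space is a metrizable $\Gamma$-space $X$ with metrizable orbit space such that $\Gamma\times X\to X\times X$, $(\gamma,x)\mapsto(\gamma x,x)$, is a proper map; it is universal if every proper $\Gamma$-space admits a $\Gamma$-map to it and any two such $\Gamma$-maps are $\Gamma$-homotopic. Then: 1. For every $\Gamma$-stable subset $S\subseteq P$, the space $\mathcal{H}(S)$ is a universal proper $\Gamma$-space; in particular $\mathcal{H}(P)$ is one, that is, a model for the classifying space $\underline{E}\Gamma$ for proper actions. 2. The orbit space $\Gamma\backslash\mathcal{H}(P)$ is compact. 3. Consequently equivariant K-homology is computed by the Kasparov groups of $\mathcal{H}(P)$: for every universal proper $\Gamma$-space $Z$, every $j\in\{0,1\}$ and every $\Gamma$-map $f:Z\to\mathcal{H}(P)$, the map induced by $f$ is an isomorphism $$R\mathrm{KK}^\Gamma_j(\mathscr{C}_0(Z),\mathbb{C}):=\varinjlim_{Y}\mathrm{KK}^\Gamma_j(\mathscr{C}_0(Y),\mathbb{C})\;\xrightarrow{\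 \cong\ }\;\mathrm{KK}^\Gamma_j(\mathscr{C}_0(\mathcal{H}(P)),\mathbb{C}),$$ where $Y$ runs through the $\Gamma$-invariant subspaces of $Z$ of the form $\Gamma\cdot C$ with $C$ compact. -/

import Mathlib

open scoped MatrixGroups ZeroAtInfty ComplexOrder OnePoint
open Filter Topology

universe u

noncomputable section

namespace BS

/-! ### Hyperbolic three-space -/

/-- Upper half space `ℂ × ℝ_{>0}`. -/
def H3 : Type := ℂ × Set.Ioi (0 : ℝ)

instance : TopologicalSpace H3 := inferInstanceAs (TopologicalSpace (ℂ × Set.Ioi (0 : ℝ)))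

namespace H3

/-- The point `(z, r)`. -/
def mk (z : ℂ) (r : ℝ) (hr : 0 < r) : H3 := (z, ⟨r, hr⟩)

/-- The horizontal coordinate. -/
def z (p : H3) : ℂ := p.1

/-- The height. -/
def r (p : H3) : ℝ := p.2.1

lemma r_pos (p : H3) : 0 < p.r := p.2.2

@[ext] lemma ext' {p q : H3} (h1 : p.z = q.z) (h2 : p.r = q.r) : p = q :=
  Prod.ext h1 (Subtype.ext h2)

/-- The denominator `|cz+d|² + |c|² r²` of the Poincaré extension. -/
def denom (g : SL(2, ℂ)) (p : H3) : ℝ :=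
  Complex.normSq (g 1 0 * p.z + g 1 1) + Complex.normSq (g 1 0) * p.r ^ 2

lemma denom_pos (g : SL(2, ℂ)) (p : H3) : 0 < denom g p := by
  have hr := p.r_pos
  have h1 := Complex.normSq_nonneg (g 1 0 * p.z + g 1 1)
  have h2 := Complex.normSq_nonneg (g 1 0)
  unfold denom
  by_cases hc : g 1 0 = 0
  · have hdet := g.det_coe
    rw [Matrix.det_fin_two] at hdet
    have hd : g 1 1 ≠ 0 := by
      intro h
      rw [hc, h] at hdet
      simp at hdet
    have := Complex.normSq_pos.2 hd
    simpa [hc] using this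
  · have := Complex.normSq_pos.2 hc
    positivity

/-- Poincaré extension of Möbius transformations to upper half space. -/
instance : SMul SL(2, ℂ) H3 where
  smul g p :=
    (((g 0 0 * p.z + g 0 1) * star (g 1 0 * p.z + g 1 1) + g 0 0 * star (g 1 0) * (p.r : ℂ) ^ 2)
        / (denom g p : ℂ),
      ⟨p.r / denom g p, div_pos p.r_pos (denom_pos g p)⟩)

lemma smul_z (g : SL(2, ℂ)) (p : H3) : (g • p).z =
    ((g 0 0 * p.z + g 0 1) * star (g 1 0 * p.z + g 1 1) + g 0 0 * star (g 1 0) * (p.r : ℂ) ^ 2)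
        / (denom g p : ℂ) := rfl

lemma smul_r (g : SL(2, ℂ)) (p : H3) : (g • p).r = p.r / denom g p := rfl

lemma denom_coe (g : SL(2, ℂ)) (p : H3) : (denom g p : ℂ) =
    (g 1 0 * p.z + g 1 1) * (star (g 1 0) * star p.z + star (g 1 1))
      + g 1 0 * star (g 1 0) * (p.r : ℂ) ^ 2 := by
  simp [denom, Complex.normSq_eq_conj_mul_self]
  ring

lemma denom_mul (g h : SL(2, ℂ)) (p : H3) :
    denom (g * h) p = denom g (h • p) * denom h p := by
  have hN : (denom h p : ℂ) ≠ 0 := by exact_mod_cast (denom_pos h p).ne'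
  have hdet : h 0 0 * h 1 1 - h 0 1 * h 1 0 = 1 := by
    have := h.det_coe; rwa [Matrix.det_fin_two] at this
  have hdet' : star (h 0 0) * star (h 1 1) - star (h 0 1) * star (h 1 0) = 1 := by
    have := congrArg star hdet; simpa using this
  have key : (denom (g * h) p : ℂ) = denom g (h • p) * denom h p := by
    rw [denom_coe g (h • p), smul_z, smul_r, denom_coe (g * h)]
    have hs : star (denom h p : ℂ) = denom h p := by simp
    simp only [star_div₀, hs, star_add, star_mul', star_star, star_pow,
      Matrix.SpecialLinearGroup.coe_mul, Matrix.mul_apply, Fin.sum_univ_two, Complex.ofReal_div]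
    have hrs : star (p.r : ℂ) = p.r := by simp
    simp only [hrs]
    field_simp
    rw [denom_coe h p]
    generalize (p.r : ℂ) = r at *
    generalize star p.z = zs at *
    generalize p.z = z at *
    generalize star (h 0 0) = a' at *
    generalize star (h 0 1) = b' at *
    generalize star (h 1 0) = c' at *
    generalize star (h 1 1) = d' at *
    generalize h 0 0 = a at *
    generalize h 0 1 = b at *
    generalize h 1 0 = c at *
    generalize h 1 1 = d at *
    generalize star (g 1 0) = C' at *
    generalize star (g 1 1) = D' at *
    generalize g 1 0 = C at *
    generalize g 1 1 = D at *
    linear_combination C * C' * r ^ 2 * (a' * d' - b' * c') * hdet + C * C' * r ^ 2 * hdet'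
  exact_mod_cast key

instance : MulAction SL(2, ℂ) H3 where
  one_smul p := by
    ext <;> simp [smul_z, smul_r, denom]
  mul_smul g h p := by
    have hN : (denom h p : ℂ) ≠ 0 := by exact_mod_cast (denom_pos h p).ne'
    have hM : (denom g (h • p) : ℂ) ≠ 0 := by exact_mod_cast (denom_pos g (h • p)).ne'
    have hN' := (denom_pos h p).ne'
    have hM' := (denom_pos g (h • p)).ne'
    have hdet : h 0 0 * h 1 1 - h 0 1 * h 1 0 = 1 := by
      have := h.det_coe; rwa [Matrix.det_fin_two] at this
    have hdet' : star (h 0 0) * star (h 1 1) - star (h 0 1) * star (h 1 0) = 1 := by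
      have := congrArg star hdet; simpa using this
    ext
    · rw [smul_z (g * h), smul_z g, denom_mul, Complex.ofReal_mul, smul_z h, smul_r h]
      have hs : star (denom h p : ℂ) = denom h p := by simp
      have hrs : star (p.r : ℂ) = p.r := by simp
      simp only [star_div₀, hs, star_add, star_mul', star_star, star_pow, hrs,
        Matrix.SpecialLinearGroup.coe_mul, Matrix.mul_apply, Fin.sum_univ_two, Complex.ofReal_div]
      generalize (denom g (h • p) : ℂ) = M at *
      field_simp
      rw [denom_coe h p]
      generalize (p.r : ℂ) = r at *
      generalize star p.z = zs at *
      generalize p.z = z at *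
      generalize star (h 0 0) = a' at *
      generalize star (h 0 1) = b' at *
      generalize star (h 1 0) = c' at *
      generalize star (h 1 1) = d' at *
      generalize h 0 0 = a at *
      generalize h 0 1 = b at *
      generalize h 1 0 = c at *
      generalize h 1 1 = d at *
      generalize star (g 1 0) = C' at *
      generalize star (g 1 1) = D' at *
      generalize g 0 0 = A at *
      generalize g 0 1 = B at *
      linear_combination A * C' * r ^ 2 * (a' * d' - b' * c') * hdet + A * C' * r ^ 2 * hdet'
    · rw [smul_r, smul_r, smul_r, denom_mul]
      field_simp

end H3

/-! ### The spherical boundary, parabolic subgroups and their split tori -/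

/-- The Riemann sphere `ℂ ∪ {∞}`. -/
abbrev Sphere : Type := OnePoint ℂ

/-- Möbius action of `SL₂(ℂ)` on the sphere. -/
def mob (g : SL(2, ℂ)) (D : Sphere) : Sphere := (g : GL (Fin 2) ℂ) • D

lemma mob_one (D : Sphere) : mob 1 D = D := by simp [mob]

lemma mob_mul (g h : SL(2, ℂ)) (D : Sphere) : mob (g * h) D = mob g (mob h D) := by
  simp [mob, mul_smul]

/-- The parabolic subgroup `Q_D`, the stabiliser of `D`. -/
def parabolic (D : Sphere) : Subgroup SL(2, ℂ) where
  carrier := {g | mob g D = D}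
  one_mem' := mob_one D
  mul_mem' {a b} ha hb := by
    change mob (a * b) D = D
    rw [mob_mul, show mob b D = D from hb, show mob a D = D from ha]
  inv_mem' {a} ha := by
    change mob a⁻¹ D = D
    conv_lhs => rw [← show mob a D = D from ha]
    rw [← mob_mul, inv_mul_cancel, mob_one]

/-- The matrix `diag(t, 1/t)`. -/
def diagMat (t : Set.Ioi (0 : ℝ)) : SL(2, ℂ) :=
  ⟨!![((t : ℝ) : ℂ), 0; 0, ((t : ℝ) : ℂ)⁻¹], by
    have : ((t : ℝ) : ℂ) ≠ 0 := by exact_mod_cast (ne_of_gt t.2)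
    simp [Matrix.det_fin_two, this]⟩

lemma coe_diagMat (t : Set.Ioi (0 : ℝ)) : (diagMat t : Matrix (Fin 2) (Fin 2) ℂ) =
    !![((t : ℝ) : ℂ), 0; 0, ((t : ℝ) : ℂ)⁻¹] := rfl

/-- The standard real split torus `{diag(t, 1/t) : t > 0}`. -/
def stdTorus : Subgroup SL(2, ℂ) where
  carrier := Set.range diagMat
  one_mem' := ⟨⟨1, by simp⟩, by ext i j; fin_cases i <;> fin_cases j <;> simp [coe_diagMat]⟩
  mul_mem' := by
    rintro _ _ ⟨s, rfl⟩ ⟨t, rfl⟩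
    refine ⟨⟨s.1 * t.1, Set.mem_Ioi.2 (mul_pos s.2 t.2)⟩, ?_⟩
    ext i j; fin_cases i <;> fin_cases j <;> simp [coe_diagMat, mul_comm]
  inv_mem' := by
    rintro _ ⟨t, rfl⟩
    refine ⟨⟨t.1⁻¹, Set.mem_Ioi.2 (inv_pos.2 t.2)⟩, ?_⟩
    ext i j
    fin_cases i <;> fin_cases j <;>
      simp [coe_diagMat, Matrix.SpecialLinearGroup.coe_inv, Matrix.adjugate_fin_two]

/-- The conjugate `g T g⁻¹`. -/
def conjSub (g : SL(2, ℂ)) (T : Subgroup SL(2, ℂ)) : Subgroup SL(2, ℂ) :=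
  T.map (MulAut.conj g).toMonoidHom

lemma conjSub_one (T : Subgroup SL(2, ℂ)) : conjSub 1 T = T := by
  ext x; simp [conjSub, Subgroup.mem_map]

lemma conjSub_mul (g h : SL(2, ℂ)) (T : Subgroup SL(2, ℂ)) :
    conjSub (g * h) T = conjSub g (conjSub h T) := by
  simp only [conjSub, Subgroup.map_map]
  congr 1
  ext x
  simp [mul_assoc]

/-- `T` is a (rank one, real) split torus of `Q_D`. -/
def IsTorusOf (D : Sphere) (T : Subgroup SL(2, ℂ)) : Prop :=
  T ≤ parabolic D ∧ ∃ g : SL(2, ℂ), T = conjSub g stdTorus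

lemma IsTorusOf.conj {D : Sphere} {T : Subgroup SL(2, ℂ)} (h : IsTorusOf D T) (g : SL(2, ℂ)) :
    IsTorusOf (mob g D) (conjSub g T) := by
  obtain ⟨h1, k, rfl⟩ := h
  refine ⟨?_, g * k, (conjSub_mul _ _ _).symm⟩
  rintro _ ⟨x, hx, rfl⟩
  have hx' : mob x D = D := h1 hx
  change mob (g * x * g⁻¹) (mob g D) = mob g D
  rw [← mob_mul, inv_mul_cancel_right, mob_mul, hx']

lemma isTorusOf_std : IsTorusOf ∞ stdTorus := by
  refine ⟨?_, 1, (conjSub_one _).symm⟩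
  rintro _ ⟨t, rfl⟩
  change mob _ _ = _
  exact OnePoint.smul_infty_eq_self_iff.2 (by change (diagMat t) 1 0 = 0; simp [diagMat])

/-- The unipotent matrix `(1 z; 0 1)`. -/
def unip (z : ℂ) : SL(2, ℂ) := ⟨!![1, z; 0, 1], by simp [Matrix.det_fin_two]⟩

lemma mob_unip (z : ℂ) : mob (unip z) ∞ = ∞ :=
  OnePoint.smul_infty_eq_self_iff.2 (by change (unip z) 1 0 = 0; simp [unip])

/-! ### Rational boundary points and the partial Borel–Serre spaces -/

section Bianchi

variable (K : IntermediateField ℚ ℂ)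

/-- The inclusion of the ring of integers of `K ⊆ ℂ` into `ℂ`. -/
def intEmb : NumberField.RingOfIntegers K →+* ℂ :=
  (algebraMap K ℂ).comp (algebraMap (NumberField.RingOfIntegers K) K)

/-- The inclusion `SL₂(𝓞_K) → SL₂(ℂ)`. -/
def toSLC : SL(2, NumberField.RingOfIntegers K) →* SL(2, ℂ) :=
  Matrix.SpecialLinearGroup.map (intEmb K)

/-- `PSL₂(𝓞_K)`, the quotient of `SL₂(𝓞_K)` by its centre. -/
abbrev PSL : Type :=
  Matrix.ProjectiveSpecialLinearGroup (Fin 2) (NumberField.RingOfIntegers K)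

/-- The rational boundary points `K ∪ {∞}`. -/
def ratPoints : Set Sphere := {D | D = ∞ ∨ ∃ k : K, D = ((k : ℂ) : Sphere)}

/-- A set of rational boundary points that is stable under the group. -/
structure CuspSet where
  carrier : Set Sphere
  subset_rat : carrier ⊆ ratPoints K
  stable : ∀ (γ : SL(2, NumberField.RingOfIntegers K)) (D : Sphere),
    D ∈ carrier → mob (toSLC K γ) D ∈ carrier

/-- The set of all rational boundary points. -/
def CuspSet.all : CuspSet K where
  carrier := ratPoints K
  subset_rat := subset_rfl
  stable := by
    have hmem : ∀ x, intEmb K x ∈ K := fun x =>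
      (algebraMap (NumberField.RingOfIntegers K) K x).2
    rintro γ D hD
    have hk : ∀ i j, (toSLC K γ : Matrix (Fin 2) (Fin 2) ℂ) i j ∈ K := fun i j => hmem _
    rcases hD with rfl | ⟨k, rfl⟩
    · unfold mob
      rw [OnePoint.smul_infty_eq_ite]
      split_ifs with h
      · exact Or.inl rfl
      · exact Or.inr ⟨⟨_, K.div_mem (hk 0 0) (hk 1 0)⟩, rfl⟩
    · unfold mob
      rw [OnePoint.smul_some_eq_ite]
      split_ifs with h
      · exact Or.inl rfl
      · exact Or.inr ⟨⟨_, K.div_mem (K.add_mem (K.mul_mem (hk 0 0) k.2) (hk 0 1))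
          (K.add_mem (K.mul_mem (hk 1 0) k.2) (hk 1 1))⟩, rfl⟩

variable {K}

/-- The disjoint union of the boundary components `Y_D`, `D ∈ S`, where `Y_D` is the space of
split tori of `Q_D`. -/
@[ext] structure BoundaryPoint (S : CuspSet K) where
  cusp : Sphere
  torus : Subgroup SL(2, ℂ)
  cusp_mem : cusp ∈ S.carrier
  isTorus : IsTorusOf cusp torus

/-- The space `H(S) = H ∪ ⋃_{D ∈ S} Y_D`, as a set. -/
def BorelSerre (S : CuspSet K) : Type := H3 ⊕ BoundaryPoint S

namespace BorelSerre

variable (S : CuspSet K)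

/-- The inclusion of hyperbolic space. -/
def incl (p : H3) : BorelSerre S := Sum.inl p

/-- The inclusion of the boundary. -/
def bdry (b : BoundaryPoint S) : BorelSerre S := Sum.inr b

/-- The chart of `H_D = H ∪ Y_D` at `D = g ∞` given by `g`: for `t > 0` it sends `(z, t)` to
`g (z, 1/t)`, the image of the base point `(0, 1)` under `g n_z a_{1/t}`, and for `t = 0` it sends
`(z, 0)` to the torus `(g n_z) A (g n_z)⁻¹`, with `n_z = (1 z; 0 1)` and `A` the diagonal torus. -/
def chart (g : SL(2, ℂ)) (hg : mob g ∞ ∈ S.carrier) (x : ℂ × Set.Ici (0 : ℝ)) : BorelSerre S :=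
  if h : 0 < (x.2 : ℝ) then
    incl S (g • H3.mk x.1 (x.2 : ℝ)⁻¹ (inv_pos.2 h))
  else
    bdry S ⟨mob g ∞, conjSub (g * unip x.1) stdTorus, hg, by
      have := isTorusOf_std.conj (g * unip x.1)
      rwa [mob_mul, mob_unip] at this⟩

/-- The topology obtained by gluing the spaces `H_D` along `H`: a set is open iff its preimages in
`H` and in all the charts are open. -/
instance : TopologicalSpace (BorelSerre S) :=
  TopologicalSpace.coinduced (incl S) inferInstance ⊔
    ⨆ g : {g : SL(2, ℂ) // mob g ∞ ∈ S.carrier},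
      TopologicalSpace.coinduced (chart S g.1 g.2) inferInstance

/-- The action of `SL₂(𝓞_K)`: the isometric action on `H`, and `γ (D, T) = (γ D, γ T γ⁻¹)` on the
boundary. -/
instance : MulAction SL(2, NumberField.RingOfIntegers K) (BorelSerre S) where
  smul γ x := match x with
    | Sum.inl p => incl S (toSLC K γ • p)
    | Sum.inr b => bdry S ⟨mob (toSLC K γ) b.cusp, conjSub (toSLC K γ) b.torus,
        S.stable γ _ b.cusp_mem, b.isTorus.conj _⟩
  one_smul x := by
    rcases x with p | b
    · change incl S (toSLC K 1 • p) = incl S p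
      rw [map_one, one_smul]
    · change bdry S _ = bdry S b
      congr 1
      ext1
      · simp [mob_one]
      · simp [conjSub_one]
  mul_smul γ δ x := by
    rcases x with p | b
    · change incl S (toSLC K (γ * δ) • p) = incl S (toSLC K γ • toSLC K δ • p)
      rw [map_mul, mul_smul]
    · change bdry S _ = bdry S _
      congr 1
      ext1
      · simp [mob_mul]
      · simp [conjSub_mul]

lemma smul_incl (γ : SL(2, NumberField.RingOfIntegers K)) (p : H3) :
    γ • incl S p = incl S (toSLC K γ • p) := rfl

lemma smul_bdry (γ : SL(2, NumberField.RingOfIntegers K)) (b : BoundaryPoint S) :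
    γ • bdry S b = bdry S ⟨mob (toSLC K γ) b.cusp, conjSub (toSLC K γ) b.torus,
        S.stable γ _ b.cusp_mem, b.isTorus.conj _⟩ := rfl

lemma center_smul {γ : SL(2, NumberField.RingOfIntegers K)}
    (hγ : γ ∈ Subgroup.center SL(2, NumberField.RingOfIntegers K)) (x : BorelSerre S) :
    γ • x = x := by
  obtain ⟨r, hr, hγr⟩ := Matrix.SpecialLinearGroup.mem_center_iff.1 hγ
  set c : ℂ := intEmb K r with hc
  have hc2 : c * c = 1 := by
    have : r * r = 1 := by simpa [sq] using hr
    rw [hc, ← map_mul, this, map_one]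
  have hc0 : c ≠ 0 := by rintro h; simp [h] at hc2
  have hcc : c = 1 ∨ c = -1 := mul_self_eq_one_iff.1 hc2
  have hm : ∀ i j, (toSLC K γ : Matrix (Fin 2) (Fin 2) ℂ) i j = if i = j then c else 0 := by
    intro i j
    change intEmb K ((γ : Matrix (Fin 2) (Fin 2) _) i j) = _
    rw [← hγr]
    by_cases h : i = j
    · simp [h, hc]
    · simp [h]
  have hcomm : ∀ g : SL(2, ℂ), toSLC K γ * g = g * toSLC K γ := by
    intro g
    ext i j
    fin_cases i <;> fin_cases j <;> simp [Matrix.mul_apply, hm, mul_comm]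
  rcases x with p | b
  · change incl S _ = incl S p
    congr 1
    ext
    · rw [H3.smul_z]
      rcases hcc with h | h <;> simp [H3.denom, hm, h]
    · rw [H3.smul_r]
      rcases hcc with h | h <;> simp [H3.denom, hm, h]
  · change bdry S _ = bdry S b
    congr 1
    ext1
    · change mob _ _ = _
      unfold mob
      rcases b.cusp with _ | z
      · exact OnePoint.smul_infty_eq_self_iff.2 (by simp [hm])
      · exact (OnePoint.smul_some_eq_ite).trans (by simp [hm, hc0]; rfl)
    · ext y
      simp only [conjSub, Subgroup.mem_map]
      constructor
      · rintro ⟨w, hw, rfl⟩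
        simpa [hcomm w] using hw
      · intro hy
        exact ⟨y, hy, by simp [hcomm y]⟩

/-- The permutation representation of `PSL₂(𝓞_K)` on `H(S)`. -/
def pslHom : PSL K →* Equiv.Perm (BorelSerre S) :=
  QuotientGroup.lift _ (MulAction.toPermHom SL(2, NumberField.RingOfIntegers K) (BorelSerre S))
    (fun _ hγ => Equiv.ext fun x => center_smul S hγ x)

/-- The action of `PSL₂(𝓞_K)` on `H(S)`. -/
instance : MulAction (PSL K) (BorelSerre S) := MulAction.compHom _ (pslHom S)

lemma mk_smul (γ : SL(2, NumberField.RingOfIntegers K)) (x : BorelSerre S) :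
    (QuotientGroup.mk γ : PSL K) • x = γ • x := rfl

end BorelSerre

end Bianchi

/-- The imaginary quadratic field `ℚ(√-m)`, as a subfield of `ℂ`. -/
def imagQuad (m : ℕ) : IntermediateField ℚ ℂ :=
  IntermediateField.adjoin ℚ {Complex.I * (Real.sqrt m : ℂ)}

/-- The Bianchi group `PSL₂(R)`, `R` the ring of integers of `ℚ(√-m)`. -/
abbrev Bianchi (m : ℕ) : Type := PSL (imagQuad m)

/-- The space `H(S)` for a stable set `S` of rational boundary points of the Bianchi group. -/
abbrev HS {m : ℕ} (S : CuspSet (imagQuad m)) : Type := BorelSerre S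

/-- The space `H(P)`, where `P` is the set of all rational boundary points. -/
abbrev HP (m : ℕ) : Type := BorelSerre (CuspSet.all (imagQuad m))

/-! ### Proper actions of discrete groups and universal proper spaces -/

section Proper

variable (Γ : Type*) [Group Γ]

/-- A proper `Γ`-space for the discrete group `Γ`: a metrizable space with metrizable orbit space
on which `Γ` acts such that `Γ × X → X × X`, `(γ, x) ↦ (γ x, x)`, is a (continuous) proper map. -/
structure IsProperSpace (X : Type*) [TopologicalSpace X] [MulAction Γ X] : Prop where
  metrizable : TopologicalSpace.MetrizableSpace X
  quotient_metrizable :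
    TopologicalSpace.MetrizableSpace (Quotient (MulAction.orbitRel Γ X))
  proper : @ProperSMul Γ X ⊥ _ _ _

/-- Equivariance of a map. -/
def IsEquivariant {X Y : Type*} [MulAction Γ X] [MulAction Γ Y] (f : X → Y) : Prop :=
  ∀ (γ : Γ) (x : X), f (γ • x) = γ • f x

/-- A universal proper `Γ`-space: a proper `Γ`-space that receives from every proper `Γ`-space a
`Γ`-map, unique up to `Γ`-homotopy. -/
structure IsUniversalProper.{t, v, w} (Γ : Type w) [Group Γ] (Z : Type v) [TopologicalSpace Z]
    [MulAction Γ Z] : Prop where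
  isProper : IsProperSpace Γ Z
  exists_map : ∀ (X : Type t) [TopologicalSpace X] [MulAction Γ X], IsProperSpace Γ X →
    ∃ f : C(X, Z), IsEquivariant Γ f
  unique_map : ∀ (X : Type t) [TopologicalSpace X] [MulAction Γ X], IsProperSpace Γ X →
    ∀ f₀ f₁ : C(X, Z), IsEquivariant Γ f₀ → IsEquivariant Γ f₁ →
      ContinuousMap.HomotopicWith f₀ f₁ (fun h => IsEquivariant Γ h)

/-- `Y` is the union of the translates of a compact subset. -/
def IsGCompact (Y : Type*) [TopologicalSpace Y] [MulAction Γ Y] : Prop :=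
  ∃ C : Set Y, IsCompact C ∧ ∀ y : Y, ∃ γ : Γ, ∃ c ∈ C, γ • c = y

variable {Γ}

lemma IsProperSpace.continuous_smul {X : Type*} [TopologicalSpace X] [MulAction Γ X]
    (h : IsProperSpace Γ X) (γ : Γ) : Continuous (fun x : X => γ • x) := by
  let _ : TopologicalSpace Γ := ⊥
  have := h.proper
  exact continuous_const_smul γ

lemma IsProperSpace.finite_return {X : Type*} [TopologicalSpace X] [MulAction Γ X]
    (h : IsProperSpace Γ X) {C L : Set X} (hC : IsCompact C) (hL : IsCompact L) :
    {γ : Γ | ∃ c ∈ C, γ • c ∈ L}.Finite := by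
  let _ : TopologicalSpace Γ := ⊥
  have : DiscreteTopology Γ := ⟨rfl⟩
  have := h.proper
  have h1 := (ProperSMul.isProperMap_smul_pair (G := Γ) (X := X)).isCompact_preimage
    (hL.prod hC)
  refine ((h1.image continuous_fst).finite_of_discrete).subset ?_
  rintro γ ⟨c, hc, hcL⟩
  exact ⟨(γ, c), ⟨hcL, hc⟩, rfl⟩

/-- An equivariant map from a `Γ`-compact space to an invariant subspace of a proper `Γ`-space is
proper. -/
lemma tendsto_cocompact_of_equivariant {Y W : Type*} [TopologicalSpace Y] [MulAction Γ Y]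
    [TopologicalSpace W] [MulAction Γ W] (hY : IsGCompact Γ Y)
    (hc : ∀ γ : Γ, Continuous (fun y : Y => γ • y))
    (hW : ∀ C L : Set W, IsCompact C → IsCompact L → {γ : Γ | ∃ c ∈ C, γ • c ∈ L}.Finite)
    (f : C(Y, W)) (hf : IsEquivariant Γ f) :
    Tendsto f (cocompact Y) (cocompact W) := by
  obtain ⟨C, hC, hcov⟩ := hY
  rw [hasBasis_cocompact.tendsto_right_iff]
  intro L hL
  have hfin := hW (f '' C) L (hC.image f.continuous) hL
  refine mem_cocompact.2 ⟨⋃ γ ∈ {γ : Γ | ∃ c ∈ f '' C, γ • c ∈ L}, (fun y : Y => γ • y) '' C,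
    hfin.isCompact_biUnion fun γ _ => hC.image (hc γ), ?_⟩
  intro y hy hyL
  apply hy
  obtain ⟨γ, c, hcC, rfl⟩ := hcov y
  simp only [Set.mem_iUnion]
  refine ⟨γ, ⟨f c, ⟨c, hcC, rfl⟩, ?_⟩, c, hcC, rfl⟩
  rw [← hf]
  exact hyL

end Proper

/-! ### Equivariant Kasparov cycles and `KK^Γ_j(C₀(Y), ℂ)` -/

section KK

/-- `T'` is the adjoint of `T` on the Hilbert `B`-module `E`. -/
def IsAdj (B : Type*) {E : Type*} [NormedAddCommGroup E] [NormedSpace ℂ E] [Inner B E]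
    (T T' : E →L[ℂ] E) : Prop :=
  ∀ x y : E, inner B (T x) y = inner B x (T' y)

/-- The compact operators of a Hilbert `B`-module: the closed linear span of the operators
`v ↦ ⟨y, v⟩ x`. -/
def compactOps (B : Type*) (E : Type*) [NormedAddCommGroup E] [NormedSpace ℂ E] [SMul B E]
    [Inner B E] : Set (E →L[ℂ] E) :=
  closure (Submodule.span ℂ {T : E →L[ℂ] E | ∃ x y : E, ∀ v, T v = inner B y v • x} :
    Submodule ℂ (E →L[ℂ] E))

/-- A `Γ`-equivariant Kasparov `(C₀(Y), B)`-cycle of parity `j`, for a discrete group `Γ` and a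
separable unital commutative C⋆-algebra `B` with trivial `Γ`-action. For `j = 0` the Hilbert module
is `ℤ/2`-graded, for `j = 1` there is no grading (the grading operator is the identity).
As `B` is separable and unital, separability of `E` means that `E` is countably generated.
Linearity of the operators over `B` follows from adjointability. -/
structure Cycle (Γ : Type*) [Group Γ] (j : ZMod 2) (Y : Type*) [TopologicalSpace Y]
    [MulAction Γ Y] (B : Type) [CommCStarAlgebra B] [PartialOrder B] where
  E : Type
  [instNACG : NormedAddCommGroup E]
  [instNS : NormedSpace ℂ E]
  [instSMul : SMul B E]
  [instCStarModule : CStarModule B E]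
  [instComplete : CompleteSpace E]
  [instSeparable : TopologicalSpace.SeparableSpace E]
  /-- the grading operator -/
  grading : E →L[ℂ] E
  /-- the representation of `C₀(Y)` -/
  φ : C₀(Y, ℂ) →ₙₐ[ℂ] (E →L[ℂ] E)
  φ_star : ∀ a, IsAdj B (φ a) (φ (star a))
  /-- the unitary representation of `Γ` -/
  U : Γ →* (E →L[ℂ] E)
  U_inner : ∀ (γ : Γ) (x y : E), inner B (U γ x) (U γ y) = inner B x y
  /-- `U_γ φ(a) = φ(γ a) U_γ`, where `(γ a)(y) = a(γ⁻¹ y)` -/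
  covariant : ∀ (γ : Γ) (a b : C₀(Y, ℂ)), (∀ y, b (γ • y) = a y) → U γ * φ a = φ b * U γ
  /-- the Fredholm operator and its adjoint -/
  F : E →L[ℂ] E
  Fadj : E →L[ℂ] E
  F_adj : IsAdj B F Fadj
  F_comm : ∀ a, F * φ a - φ a * F ∈ compactOps B E
  F_sq : ∀ a, φ a * (F * F - 1) ∈ compactOps B E
  F_selfadj : ∀ a, φ a * (F - Fadj) ∈ compactOps B E
  F_equivariant : ∀ (γ : Γ) (a : C₀(Y, ℂ)), φ a * (U γ * F * U γ⁻¹ - F) ∈ compactOps B E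
  grading_even : j = 0 → grading * grading = 1 ∧ IsAdj B grading grading ∧
    (∀ a, grading * φ a = φ a * grading) ∧ (∀ γ, grading * U γ = U γ * grading) ∧
    grading * F = -(F * grading)
  grading_odd : j = 1 → grading = 1

attribute [instance] Cycle.instNACG Cycle.instNS Cycle.instSMul Cycle.instCStarModule
  Cycle.instComplete Cycle.instSeparable

variable {Γ : Type*} [Group Γ] {j : ZMod 2} {Y : Type*} [TopologicalSpace Y] [MulAction Γ Y]
  {W : Type*} [TopologicalSpace W] [MulAction Γ W]

/-- A linear map between the underlying spaces of two cycles intertwines all the operators. -/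
def Intertwines {B B' : Type} [CommCStarAlgebra B] [PartialOrder B] [CommCStarAlgebra B']
    [PartialOrder B'] (x : Cycle Γ j Y B) (y : Cycle Γ j Y B') (q : x.E →L[ℂ] y.E) : Prop :=
  ∀ v, q (x.grading v) = y.grading (q v) ∧ (∀ a, q (x.φ a v) = y.φ a (q v)) ∧
    (∀ γ, q (x.U γ v) = y.U γ (q v)) ∧ q (x.F v) = y.F (q v)

/-- `z` is (isomorphic to) the direct sum of `x` and `y`. -/
def IsSum (z x y : Cycle Γ j Y ℂ) : Prop :=
  ∃ (i : x.E →L[ℂ] z.E) (k : y.E →L[ℂ] z.E), Intertwines x z i ∧ Intertwines y z k ∧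
    (∀ u v, inner ℂ (i u) (i v) = inner ℂ u v) ∧ (∀ u v, inner ℂ (k u) (k v) = inner ℂ u v) ∧
    (∀ u v, inner ℂ (i u) (k v) = 0) ∧ ∀ w, ∃ u v, w = i u + k v

/-- `x` is (isomorphic to) the evaluation at `t` of the cycle `h` over `C([0,1])`. -/
def IsEvalAt (t : unitInterval) (h : Cycle Γ j Y C(unitInterval, ℂ)) (x : Cycle Γ j Y ℂ) : Prop :=
  ∃ q : h.E →L[ℂ] x.E, Intertwines h x q ∧ DenseRange q ∧
    ∀ u v, inner ℂ (q u) (q v) = (inner C(unitInterval, ℂ) u v : C(unitInterval, ℂ)) t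

/-- Homotopy of cycles through a cycle over `C([0,1])`. -/
def IsHomotopic (x y : Cycle Γ j Y ℂ) : Prop :=
  ∃ h : Cycle Γ j Y C(unitInterval, ℂ), IsEvalAt 0 h x ∧ IsEvalAt 1 h y

variable (Γ j Y) in
/-- The relations that define `KK^Γ_j(C₀(Y), ℂ)`. -/
def kkRel : Set (FreeAbelianGroup (Cycle Γ j Y ℂ)) :=
  {d | ∃ z x y, IsSum z x y ∧
      d = FreeAbelianGroup.of z - (FreeAbelianGroup.of x + FreeAbelianGroup.of y)} ∪
  {d | ∃ x y, IsHomotopic x y ∧ d = FreeAbelianGroup.of x - FreeAbelianGroup.of y}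

variable (Γ j Y) in
/-- The Kasparov group `KK^Γ_j(C₀(Y), ℂ)`: homotopy classes of cycles, added by direct sum. -/
abbrev KK : Type _ := FreeAbelianGroup (Cycle Γ j Y ℂ) ⧸ AddSubgroup.closure (kkRel Γ j Y)

/-- The class of a cycle. -/
def Cycle.cls (x : Cycle Γ j Y ℂ) : KK Γ j Y := QuotientAddGroup.mk (FreeAbelianGroup.of x)

/-- The push-forward of a cycle along a proper equivariant map `p : Y → W`: the same cycle with
`C₀(W)` acting through `a ↦ a ∘ p`. -/
def Cycle.map {B : Type} [CommCStarAlgebra B] [PartialOrder B] (p : CocompactMap Y W)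
    (hp : IsEquivariant Γ p) (x : Cycle Γ j Y B) : Cycle Γ j W B where
  E := x.E
  grading := x.grading
  φ := x.φ.comp (ZeroAtInftyContinuousMap.compNonUnitalAlgHom p)
  φ_star a := x.φ_star _
  U := x.U
  U_inner := x.U_inner
  covariant γ a b hab := x.covariant γ _ _ fun y => by
    change b (p (γ • y)) = a (p y)
    rw [hp, hab]
  F := x.F
  Fadj := x.Fadj
  F_adj := x.F_adj
  F_comm a := x.F_comm _
  F_sq a := x.F_sq _
  F_selfadj a := x.F_selfadj _
  F_equivariant γ a := x.F_equivariant γ _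
  grading_even hj := by
    obtain ⟨h1, h2, h3, h4, h5⟩ := x.grading_even hj
    exact ⟨h1, h2, fun a => h3 _, h4, h5⟩
  grading_odd := x.grading_odd

lemma Intertwines.map {B B' : Type} [CommCStarAlgebra B] [PartialOrder B] [CommCStarAlgebra B']
    [PartialOrder B'] {x : Cycle Γ j Y B} {y : Cycle Γ j Y B'} {q : x.E →L[ℂ] y.E}
    (hq : Intertwines x y q) (p : CocompactMap Y W) (hp : IsEquivariant Γ p) :
    Intertwines (x.map p hp) (y.map p hp) q :=
  fun v => ⟨(hq v).1, fun _ => (hq v).2.1 _, (hq v).2.2.1, (hq v).2.2.2⟩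

/-- The push-forward `KK^Γ_j(C₀(Y), ℂ) → KK^Γ_j(C₀(W), ℂ)` along a proper equivariant map. -/
def KK.map (p : CocompactMap Y W) (hp : IsEquivariant Γ p) : KK Γ j Y →+ KK Γ j W :=
  QuotientAddGroup.map _ _ (FreeAbelianGroup.map (Cycle.map p hp)) <| by
    rw [AddSubgroup.closure_le]
    rintro d (⟨z, x, y, ⟨i, k, hi, hk, h⟩, rfl⟩ | ⟨x, y, ⟨h, ⟨q, hq, h0⟩, ⟨q', hq', h1⟩⟩, rfl⟩)
    · refine AddSubgroup.subset_closure (Or.inl ⟨z.map p hp, x.map p hp, y.map p hp,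
        ⟨i, k, hi.map p hp, hk.map p hp, h⟩, ?_⟩)
      simp [FreeAbelianGroup.map_of_apply]
    · refine AddSubgroup.subset_closure (Or.inr ⟨x.map p hp, y.map p hp,
        ⟨h.map p hp, ⟨q, hq.map p hp, h0⟩, ⟨q', hq'.map p hp, h1⟩⟩, ?_⟩)
      simp [FreeAbelianGroup.map_of_apply]

lemma KK.map_cls (p : CocompactMap Y W) (hp : IsEquivariant Γ p) (x : Cycle Γ j Y ℂ) :
    KK.map p hp x.cls = (x.map p hp).cls := by
  simp [KK.map, Cycle.cls, FreeAbelianGroup.map_of_apply]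

end KK

/-! ### Equivariant K-homology with `Γ`-compact supports -/

section RKK

variable {Γ : Type*} [Group Γ]

/-- The `Γ`-compact invariant subspaces of `Z`. -/
abbrev GCompactSub (Γ : Type*) [Group Γ] (Z : Type*) [TopologicalSpace Z] [MulAction Γ Z] :
    Type _ :=
  {Y : SubMulAction Γ Z // IsGCompact Γ Y}

/-- The restriction of an equivariant map to a `Γ`-compact subspace, as a proper map. -/
def restrictProper {Z W : Type*} [TopologicalSpace Z] [MulAction Γ Z] [TopologicalSpace W]
    [MulAction Γ W] (hZ : IsProperSpace Γ Z) (hW : IsProperSpace Γ W) (f : C(Z, W))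
    (hf : IsEquivariant Γ f) (Y : GCompactSub Γ Z) : CocompactMap Y.1 W where
  toFun y := f y
  cocompact_tendsto' :=
    tendsto_cocompact_of_equivariant Y.2
      (fun γ => Continuous.subtype_mk ((hZ.continuous_smul γ).comp continuous_subtype_val) _)
      (fun _ _ hC hL => hW.finite_return hC hL)
      ⟨fun y : Y.1 => f y, by fun_prop⟩ (fun γ y => hf γ y)

lemma restrictProper_equivariant {Z W : Type*} [TopologicalSpace Z] [MulAction Γ Z]
    [TopologicalSpace W] [MulAction Γ W] (hZ : IsProperSpace Γ Z) (hW : IsProperSpace Γ W)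
    (f : C(Z, W)) (hf : IsEquivariant Γ f) (Y : GCompactSub Γ Z) :
    IsEquivariant Γ (restrictProper hZ hW f hf Y) := fun γ y => hf γ y

variable {Z : Type*} [TopologicalSpace Z] [MulAction Γ Z]

/-- The inclusion of one `Γ`-compact subspace of a proper space in another, as a proper map. -/
def inclProper (hZ : IsProperSpace Γ Z) {Y Y' : GCompactSub Γ Z} (h : Y ≤ Y') :
    CocompactMap Y.1 Y'.1 where
  toFun y := ⟨y, h y.2⟩
  cocompact_tendsto' :=
    tendsto_cocompact_of_equivariant Y.2
      (fun γ => Continuous.subtype_mk ((hZ.continuous_smul γ).comp continuous_subtype_val) _)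
      (fun C L hC hL => (hZ.finite_return (hC.image continuous_subtype_val)
        (hL.image continuous_subtype_val)).subset (by
          rintro γ ⟨c, hc, hcL⟩
          exact ⟨c, ⟨c, hc, rfl⟩, ⟨_, hcL, rfl⟩⟩))
      ⟨fun y : Y.1 => (⟨y, h y.2⟩ : Y'.1), by fun_prop⟩ (fun γ y => rfl)

lemma inclProper_equivariant (hZ : IsProperSpace Γ Z) {Y Y' : GCompactSub Γ Z} (h : Y ≤ Y') :
    IsEquivariant Γ (inclProper hZ h) := fun _ _ => rfl

open scoped Classical in
/-- The group `RKK^Γ_j(C₀(Z), ℂ)` for a proper `Γ`-space `Z`: the direct limit of the groups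
`KK^Γ_j(C₀(Y), ℂ)` over the `Γ`-compact invariant subspaces `Y` of `Z`. -/
def RKK (j : ZMod 2) (hZ : IsProperSpace Γ Z) : Type _ :=
  AddCommGroup.DirectLimit (fun Y : GCompactSub Γ Z => KK Γ j Y.1)
    (fun _ _ h => KK.map (inclProper hZ h) (inclProper_equivariant hZ h))

open scoped Classical in
instance (j : ZMod 2) (hZ : IsProperSpace Γ Z) : AddCommGroup (RKK j hZ) :=
  inferInstanceAs (AddCommGroup (AddCommGroup.DirectLimit
    (fun Y : GCompactSub Γ Z => KK Γ j Y.1)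
    (fun _ _ h => KK.map (inclProper hZ h) (inclProper_equivariant hZ h))))

open scoped Classical in
/-- The canonical map from the group of a `Γ`-compact subspace to the direct limit. -/
def RKK.of (j : ZMod 2) (hZ : IsProperSpace Γ Z) (Y : GCompactSub Γ Z) :
    KK Γ j Y.1 →+ RKK j hZ :=
  AddCommGroup.DirectLimit.of (fun Y : GCompactSub Γ Z => KK Γ j Y.1)
    (fun _ _ h => KK.map (inclProper hZ h) (inclProper_equivariant hZ h)) Y

end RKK

end BS

end

noncomputable section

namespace BS

/-! ### Arithmetic of imaginary quadratic integers -/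

section Arithmetic

/-! A point p = (z, r) of hyperbolic space is a positive definite Hermitian form on ℂ² up to
scaling. `qf p` is the representative of determinant one, and it is unchanged when g ∈ SL₂(ℂ) acts
on both the point and the vector (`qf_smul_mulVec`). The cusp g∞ is the line spanned by the first
column of g. In the chart at g the coordinate t = 1/height of p is `qf p (col g)`
(`toInvHeight_snd`). If the column is a shortest integral vector of its line (`IsNormalized`), then
t depends only on the cusp (`IsNormalized.normSq_eq_one`). Depth in a cusp is therefore measured by
lengths of integral vectors.

Two estimates control these lengths. Hadamard's inequality, with the fact that a nonzero integer of
the field has norm at least 1, makes the horoballs t < 1 at distinct cusps disjoint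
(`IsNormalized.one_le_qf_mul_qf`). Hence the glued space is Hausdorff, and near the boundary
properness reduces to upper triangular matrices with bounded entries. Conversely, a pigeonhole
argument finds a nonzero integral vector with form at most 5(1 + m) (`exists_short_vector`), so the
sets t ≤ 5(1 + m) cover the space. Finiteness of the class group leaves finitely many cusps modulo
Γ, and unipotent elements move the horizontal coordinate into a compact box. This gives
cocompactness of the action on H(P) (`isGCompact`).

For universality, raising t to at least s/8 inside the disjoint horoballs deforms H(S) equivariantly
into hyperbolic space (`continuous_push`). There the convexity of the cone of positive definite
matrices, on which g acts linearly by A ↦ gAg*, does the rest: a cut-off function averages the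
matrices γγ* to an equivariant map, and convex combinations join any two equivariant maps.

For K-homology, universality of Z and of H(P) gives an equivariant homotopy inverse g of f. An
equivariant homotopy on a Γ-compact space changes a pushed-forward cycle by a Kasparov homotopy on
C([0,1], E) (`isHomotopic_map`). As H(P) is Γ-compact, g lands in one Γ-compact subspace of Z and so
induces a map into the direct limit, which inverts the map induced by f (`RKK.exists_equiv`). -/

lemma exists_int_of_isIntegral_ratCast {q : ℚ} (h : IsIntegral ℤ (q : ℂ)) :
    ∃ n : ℤ, (q : ℂ) = n := by
  have h' : IsIntegral ℤ q :=
    (isIntegral_algebraMap_iff (A := ℚ) (B := ℂ) (algebraMap ℚ ℂ).injective).1 h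
  obtain ⟨n, hn⟩ := IsIntegrallyClosed.isIntegral_iff.1 h'
  exact ⟨n, by rw [← hn]; simp⟩

variable {m : ℕ}

/-- The generator `√-m` of the imaginary quadratic field. -/
def sqrtNeg (m : ℕ) : ℂ := Complex.I * (Real.sqrt m : ℂ)

lemma sqrtNeg_mul_self (m : ℕ) : sqrtNeg m * sqrtNeg m = -(m : ℂ) := by
  have h : ((Real.sqrt m : ℝ) : ℂ) * ((Real.sqrt m : ℝ) : ℂ) = (m : ℂ) := by
    rw [← Complex.ofReal_mul, Real.mul_self_sqrt (Nat.cast_nonneg m)]; simp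
  unfold sqrtNeg
  linear_combination (Complex.I * Complex.I) * h + (m : ℂ) * Complex.I_mul_I

lemma conj_sqrtNeg (m : ℕ) : (starRingEnd ℂ) (sqrtNeg m) = -sqrtNeg m := by
  simp [sqrtNeg]

lemma sqrtNeg_mem (m : ℕ) : sqrtNeg m ∈ imagQuad m :=
  IntermediateField.subset_adjoin _ _ (Set.mem_singleton _)

lemma isIntegral_sqrtNeg (R : Type*) [CommRing R] [Algebra R ℂ] (m : ℕ) :
    IsIntegral R (sqrtNeg m) := by
  refine ⟨Polynomial.X ^ 2 + Polynomial.C (m : R), by monicity!, ?_⟩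
  simp [sq, sqrtNeg_mul_self]

instance : NumberField (imagQuad m) where
  to_charZero := inferInstance
  to_finiteDimensional := IntermediateField.adjoin.finiteDimensional (isIntegral_sqrtNeg ℚ m)

/-- These numbers are closed under the field operations; an inverse is the conjugate divided by the
norm a² + mb². -/
lemma exists_rat_of_mem_imagQuad {x : ℂ} (hx : x ∈ imagQuad m) :
    ∃ a b : ℚ, x = a + b * sqrtNeg m := by
  have hs := sqrtNeg_mul_self m
  refine IntermediateField.adjoin_induction ℚ (p := fun x _ => ∃ a b : ℚ, x = a + b * sqrtNeg m)
    ?_ ?_ ?_ ?_ ?_ hx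
  · rintro x rfl
    exact ⟨0, 1, by simp [sqrtNeg]⟩
  · intro q
    exact ⟨q, 0, by simp⟩
  · rintro _ _ _ _ ⟨a, b, rfl⟩ ⟨c, d, rfl⟩
    exact ⟨a + c, b + d, by push_cast; ring⟩
  · rintro _ _ ⟨a, b, rfl⟩
    by_cases h : (a : ℂ) + b * sqrtNeg m = 0
    · exact ⟨0, 0, by simp [h]⟩
    · refine ⟨a / (a ^ 2 + m * b ^ 2), -b / (a ^ 2 + m * b ^ 2), ?_⟩
      have h2 : ((a : ℂ) - b * sqrtNeg m) ≠ 0 := by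
        intro h3
        apply h
        have := congrArg (starRingEnd ℂ) h3
        simpa [conj_sqrtNeg] using this
      have h4 : ((a : ℂ) ^ 2 + m * b ^ 2) = (a + b * sqrtNeg m) * (a - b * sqrtNeg m) := by
        linear_combination (b : ℂ) ^ 2 * hs
      push_cast
      rw [h4]
      field_simp
      ring
  · rintro _ _ _ _ ⟨a, b, rfl⟩ ⟨c, d, rfl⟩
    exact ⟨a * c - m * (b * d), a * d + b * c, by
      push_cast; linear_combination (b : ℂ) * d * hs⟩

lemma countable_imagQuad (m : ℕ) : Countable (imagQuad m) := by
  have h : ∀ x : imagQuad m, ∃ q : ℚ × ℚ, (x : ℂ) = q.1 + q.2 * sqrtNeg m := fun x => by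
    obtain ⟨a, b, h⟩ := exists_rat_of_mem_imagQuad x.2
    exact ⟨(a, b), h⟩
  choose f hf using h
  refine Function.Injective.countable (f := f) fun x y hxy => Subtype.ext ?_
  rw [hf x, hf y, hxy]

/-- The ring of integers of the imaginary quadratic field. -/
abbrev QInt (m : ℕ) : Type := NumberField.RingOfIntegers (imagQuad m)

/-- The inclusion of the ring of integers of the imaginary quadratic field in `ℂ`. -/
abbrev emb (m : ℕ) : QInt m →+* ℂ := intEmb (imagQuad m)

lemma emb_injective (m : ℕ) : Function.Injective (emb m) :=
  (algebraMap (imagQuad m) ℂ).injective.comp NumberField.RingOfIntegers.coe_injective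

lemma emb_eq_zero {x : QInt m} : emb m x = 0 ↔ x = 0 :=
  map_eq_zero_iff _ (emb_injective m)

lemma emb_mem (x : QInt m) : emb m x ∈ imagQuad m :=
  (algebraMap (QInt m) (imagQuad m) x).2

lemma isIntegral_emb (x : QInt m) : IsIntegral ℤ (emb m x) :=
  (NumberField.RingOfIntegers.isIntegral x).map (emb m).toIntAlgHom

lemma exists_emb_eq {x : ℂ} (hx : x ∈ imagQuad m) (h : IsIntegral ℤ x) :
    ∃ y : QInt m, emb m y = x := by
  have h' : IsIntegral ℤ (⟨x, hx⟩ : imagQuad m) :=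
    (isIntegral_algebraMap_iff (A := imagQuad m) (B := ℂ)
      (algebraMap (imagQuad m) ℂ).injective).1 h
  exact ⟨⟨⟨x, hx⟩, h'⟩, rfl⟩

lemma exists_emb_eq_sqrtNeg (m : ℕ) : ∃ w : QInt m, emb m w = sqrtNeg m :=
  exists_emb_eq (sqrtNeg_mem m) (isIntegral_sqrtNeg ℤ m)

lemma isIntegral_conj {x : ℂ} (h : IsIntegral ℤ x) : IsIntegral ℤ ((starRingEnd ℂ) x) :=
  h.map (starRingEnd ℂ).toIntAlgHom

/-- The trace x + x̄ is both rational and integral over ℤ. -/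
lemma exists_int_trace (x : QInt m) : ∃ k : ℤ, 2 * (emb m x).re = k := by
  obtain ⟨a, b, h⟩ := exists_rat_of_mem_imagQuad (emb_mem x)
  have h1 : IsIntegral ℤ (((2 * a : ℚ)) : ℂ) := by
    have e : ((2 * a : ℚ) : ℂ) = emb m x + (starRingEnd ℂ) (emb m x) := by
      rw [h]; simp [conj_sqrtNeg]; ring
    rw [e]
    exact (isIntegral_emb x).add (isIntegral_conj (isIntegral_emb x))
  obtain ⟨k, hk⟩ := exists_int_of_isIntegral_ratCast h1
  refine ⟨k, ?_⟩
  have h2 : (2 * (a : ℝ)) = k := by exact_mod_cast hk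
  rw [h, ← h2]; simp [sqrtNeg]

/-- The trace of √-m · x is -2√m · Im x. -/
lemma exists_int_im (x : QInt m) : ∃ k : ℤ, 2 * Real.sqrt m * (emb m x).im = k := by
  obtain ⟨w, hw⟩ := exists_emb_eq_sqrtNeg m
  obtain ⟨k, hk⟩ := exists_int_trace (w * x)
  refine ⟨-k, ?_⟩
  push_cast
  rw [← hk, map_mul, hw]
  simp [sqrtNeg, mul_assoc]

lemma exists_nat_normSq (x : QInt m) : ∃ n : ℕ, Complex.normSq (emb m x) = n := by
  obtain ⟨a, b, h⟩ := exists_rat_of_mem_imagQuad (emb_mem x)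
  have h1 : IsIntegral ℤ (((a ^ 2 + m * b ^ 2 : ℚ)) : ℂ) := by
    have e : ((a ^ 2 + m * b ^ 2 : ℚ) : ℂ) = emb m x * (starRingEnd ℂ) (emb m x) := by
      rw [h]; simp [conj_sqrtNeg]; linear_combination (b : ℂ) ^ 2 * sqrtNeg_mul_self m
    rw [e]
    exact (isIntegral_emb x).mul (isIntegral_conj (isIntegral_emb x))
  obtain ⟨k, hk⟩ := exists_int_of_isIntegral_ratCast h1
  have h2 : Complex.normSq (emb m x) = k := by
    have : (Complex.normSq (emb m x) : ℂ) = (k : ℂ) := by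
      rw [← hk, Complex.normSq_eq_conj_mul_self, h]
      simp [conj_sqrtNeg]; linear_combination -(b : ℂ) ^ 2 * sqrtNeg_mul_self m
    exact_mod_cast this
  have h3 : 0 ≤ k := by
    have := Complex.normSq_nonneg (emb m x)
    rw [h2] at this; exact_mod_cast this
  refine ⟨k.toNat, ?_⟩
  rw [h2]
  have : ((k.toNat : ℤ) : ℝ) = k := by rw [Int.toNat_of_nonneg h3]
  exact_mod_cast this.symm

/-- The source of all discreteness below: norms are natural numbers. -/
lemma one_le_normSq_emb {x : QInt m} (hx : x ≠ 0) : 1 ≤ Complex.normSq (emb m x) := by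
  obtain ⟨n, hn⟩ := exists_nat_normSq x
  have h : 0 < Complex.normSq (emb m x) := Complex.normSq_pos.2 (by simpa [emb_eq_zero] using hx)
  rw [hn] at h ⊢
  exact_mod_cast h

lemma sqrt_pos_of_squarefree (hm : Squarefree m) : 0 < Real.sqrt m :=
  Real.sqrt_pos.2 (by exact_mod_cast Nat.pos_of_ne_zero hm.ne_zero)

lemma finite_normSq_emb_le (hm : Squarefree m) (B : ℝ) :
    {x : QInt m | Complex.normSq (emb m x) ≤ B}.Finite := by
  have hs := sqrt_pos_of_squarefree hm
  choose f hf using exists_int_trace (m := m)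
  choose g hg using exists_int_im (m := m)
  have hinj : Function.Injective fun x : QInt m => (f x, g x) := by
    intro x y hxy
    simp only [Prod.mk.injEq] at hxy
    apply emb_injective m
    apply Complex.ext
    · have h1 := hf x; have h2 := hf y; rw [hxy.1] at h1; linarith
    · have h1 := hg x; have h2 := hg y; rw [hxy.2, ← h2] at h1
      exact mul_left_cancel₀ (by positivity) h1
  -- The real and imaginary parts are at most 1 + |B| in modulus; the two integers that determine x
  -- multiply them by 2 and by 2√m, and N dominates both products.
  set N : ℝ := 2 * (1 + Real.sqrt m) * (1 + |B|) with hN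
  refine Set.Finite.of_finite_image (f := fun x => (f x, g x)) ?_ hinj.injOn
  refine ((Set.finite_Icc (-⌈N⌉) ⌈N⌉).prod (Set.finite_Icc (-⌈N⌉) ⌈N⌉)).subset ?_
  have key : ∀ (k : ℤ), |(k : ℝ)| ≤ N → k ∈ Set.Icc (-⌈N⌉) ⌈N⌉ := by
    intro k hk
    obtain ⟨h1, h2⟩ := abs_le.1 hk
    have h3 := Int.le_ceil N
    constructor
    · have : (-(⌈N⌉ : ℝ)) ≤ k := by linarith
      exact_mod_cast this
    · have : (k : ℝ) ≤ ⌈N⌉ := by linarith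
      exact_mod_cast this
  rintro _ ⟨x, hx, rfl⟩
  have hx' : (emb m x).re ^ 2 + (emb m x).im ^ 2 ≤ B := by
    have : Complex.normSq (emb m x) ≤ B := hx
    rw [Complex.normSq_apply] at this; nlinarith
  have hB := le_abs_self B
  have hB0 := abs_nonneg B
  have hre : |(emb m x).re| ≤ 1 + |B| :=
    abs_le_of_sq_le_sq (by nlinarith [sq_nonneg (emb m x).im]) (by linarith)
  have him : |(emb m x).im| ≤ 1 + |B| :=
    abs_le_of_sq_le_sq (by nlinarith [sq_nonneg (emb m x).re]) (by linarith)
  refine ⟨key _ ?_, key _ ?_⟩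
  · rw [← hf, abs_mul, abs_two, hN]
    nlinarith
  · rw [← hg, abs_mul, abs_mul, abs_two, abs_of_pos hs, hN]
    nlinarith [mul_le_mul_of_nonneg_left him hs.le]

end Arithmetic


/-! ### Lines in the plane over a Dedekind domain -/

section Lines

variable {R : Type*} [CommRing R] [IsDedekindDomain R]

open Matrix

lemma exists_mul_add_mul_eq {R : Type*} [CommRing R] {I J : Ideal R} {n a b : R}
    (hI : I = Ideal.span {a, b})
    (hJ : Ideal.span {n} = I * J) : ∃ x ∈ J, ∃ y ∈ J, a * x + b * y = n := by
  have h : n ∈ I * J := hJ ▸ Ideal.mem_span_singleton_self n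
  rw [hI, Ideal.span_insert, Ideal.sup_mul, Submodule.mem_sup] at h
  obtain ⟨p, hp, q, hq, h⟩ := h
  obtain ⟨x, hx, rfl⟩ := Ideal.mem_span_singleton_mul.1 hp
  obtain ⟨y, hy, rfl⟩ := Ideal.mem_span_singleton_mul.1 hq
  exact ⟨x, hx, y, hy, h⟩

/-- Vectors whose entries generate the same ideal lie in the same orbit of `SL₂(R)`. -/
lemma exists_mulVec_eq_of_span_eq {u v : Fin 2 → R} (hu : u ≠ 0)
    (h : Ideal.span {u 0, u 1} = Ideal.span {v 0, v 1}) :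
    ∃ γ : SL(2, R), γ.1 *ᵥ u = v := by
  set I := Ideal.span {u 0, u 1} with hI
  obtain ⟨n, hnI, hn⟩ : ∃ n ∈ I, n ≠ 0 := by
    by_contra! H
    apply hu
    ext i
    fin_cases i
    · exact H _ (Ideal.subset_span (by simp))
    · exact H _ (Ideal.subset_span (by simp))
  -- To contain is to divide in a Dedekind domain, so J plays the role of n · I⁻¹.
  obtain ⟨J, hJ⟩ := Ideal.dvd_iff_le.2 ((Ideal.span_singleton_le_iff_mem _).2 hnI)
  obtain ⟨x, hx, y, hy, e⟩ := exists_mul_add_mul_eq hI hJ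
  obtain ⟨x', hx', y', hy', e'⟩ := exists_mul_add_mul_eq h hJ
  have hd : ∀ {s t : R}, s ∈ I → t ∈ J → n ∣ s * t := fun hs ht =>
    Ideal.mem_span_singleton.1 (hJ ▸ Ideal.mul_mem_mul hs ht)
  have h0 : u 0 ∈ I := Ideal.subset_span (by simp)
  have h1 : u 1 ∈ I := Ideal.subset_span (by simp)
  have h0' : v 0 ∈ I := h ▸ Ideal.subset_span (by simp)
  have h1' : v 1 ∈ I := h ▸ Ideal.subset_span (by simp)
  -- Over the fraction field, u and v complete to matrices of determinant one with second columns
  -- (-y, x)/n and (-y', x')/n. The matrix sought is the second times the inverse of the first; its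
  -- entries are integral because I · J = (n).
  obtain ⟨p, hp⟩ := dvd_add (hd h0' hx) (hd h1 hy')
  obtain ⟨q, hq⟩ := dvd_sub (hd h0' hy) (hd h0 hy')
  obtain ⟨r, hr⟩ := dvd_sub (hd h1' hx) (hd h1 hx')
  obtain ⟨s, hs⟩ := dvd_add (hd h1' hy) (hd h0 hx')
  refine ⟨⟨!![p, q; r, s], ?_⟩, ?_⟩
  · rw [Matrix.det_fin_two_of]
    apply mul_left_cancel₀ (mul_ne_zero hn hn)
    linear_combination -(n * s) * hp + (n * r) * hq - (v 0 * x + u 1 * y') * hs +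
      (v 0 * y - u 0 * y') * hr + (v 0 * x' + v 1 * y') * e + n * e'
  · ext i
    apply mul_left_cancel₀ hn
    fin_cases i
    · simp only [Matrix.mulVec, dotProduct, Fin.sum_univ_two]
      change n * (p * u 0 + q * u 1) = n * v 0
      linear_combination -(u 0) * hp - u 1 * hq + v 0 * e
    · simp only [Matrix.mulVec, dotProduct, Fin.sum_univ_two]
      change n * (r * u 0 + s * u 1) = n * v 1
      linear_combination -(u 0) * hr - u 1 * hs + v 1 * e

/-- The group `SL₂(R)` has finitely many orbits of lines when the class group is finite. -/
lemma exists_finite_line_representatives [Finite (ClassGroup R)] :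
    ∃ T : Set (Fin 2 → R), T.Finite ∧ (∀ τ ∈ T, τ ≠ 0) ∧ ∀ u : Fin 2 → R, u ≠ 0 →
      ∃ τ ∈ T, ∃ (γ : SL(2, R)) (k l : R), k ≠ 0 ∧ l ≠ 0 ∧ k • (γ.1 *ᵥ u) = l • τ := by
  classical
  have hne : ∀ u : {u : Fin 2 → R // u ≠ 0},
      Ideal.span {u.1 0, u.1 1} ∈ nonZeroDivisors (Ideal R) := by
    intro u
    rw [mem_nonZeroDivisors_iff_ne_zero]
    intro h
    apply u.2
    rw [Ideal.zero_eq_bot, Ideal.span_eq_bot] at h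
    ext i
    fin_cases i
    · exact h _ (by simp)
    · exact h _ (by simp)
  -- The class of the ideal generated by the entries decides the orbit of the line: equality of
  -- classes makes the ideals equal after rescaling both vectors.
  let c : {u : Fin 2 → R // u ≠ 0} → ClassGroup R := fun u => ClassGroup.mk0 ⟨_, hne u⟩
  let rep : Set.range c → {u : Fin 2 → R // u ≠ 0} := fun x => x.2.choose
  have hrep : ∀ x : Set.range c, c (rep x) = x := fun x => x.2.choose_spec
  refine ⟨Set.range fun x => (rep x).1, Set.finite_range _, ?_, ?_⟩
  · rintro _ ⟨x, rfl⟩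
    exact (rep x).2
  · intro u hu
    set τ := rep ⟨c ⟨u, hu⟩, Set.mem_range_self _⟩ with hτ
    have h : c ⟨u, hu⟩ = c τ := (hrep ⟨c ⟨u, hu⟩, Set.mem_range_self _⟩).symm
    obtain ⟨k, l, hk, hl, hkl⟩ := ClassGroup.mk0_eq_mk0_iff.1 h
    have hspan : ∀ (k : R) (u : Fin 2 → R), Ideal.span {k} * Ideal.span {u 0, u 1} =
        Ideal.span {(k • u) 0, (k • u) 1} := by
      intro k u
      rw [Ideal.span_mul_span', Set.singleton_mul, Set.image_pair]
      rfl
    have hkl' : Ideal.span {(k • u) 0, (k • u) 1} =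
        Ideal.span {(l • τ.1) 0, (l • τ.1) 1} := by
      rw [← hspan, ← hspan]; exact hkl
    obtain ⟨γ, hγ⟩ := exists_mulVec_eq_of_span_eq (smul_ne_zero hk hu) hkl'
    exact ⟨τ, ⟨_, rfl⟩, γ, k, l, hk, hl, by rw [← hγ, Matrix.mulVec_smul]⟩

end Lines


/-! ### The Hermitian form attached to a point of hyperbolic space -/

section Forms

open Matrix

/-- The positive definite Hermitian form on column vectors attached to a point of hyperbolic
space. -/
def qf (p : H3) (u : Fin 2 → ℂ) : ℝ :=
  (Complex.normSq (u 0 - u 1 * p.z) + Complex.normSq (u 1) * p.r ^ 2) / p.r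

lemma qf_nonneg (p : H3) (u : Fin 2 → ℂ) : 0 ≤ qf p u := by
  have := p.r_pos
  have h1 := Complex.normSq_nonneg (u 0 - u 1 * p.z)
  have h2 := Complex.normSq_nonneg (u 1)
  unfold qf; positivity

lemma qf_smul (p : H3) (c : ℂ) (u : Fin 2 → ℂ) : qf p (c • u) = Complex.normSq c * qf p u := by
  have h : c * u 0 - c * u 1 * p.z = c * (u 0 - u 1 * p.z) := by ring
  simp only [qf, Pi.smul_apply, smul_eq_mul, h, Complex.normSq_mul]
  ring

/-- The first column of a matrix. -/
def col (g : SL(2, ℂ)) : Fin 2 → ℂ := fun i => g i 0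

lemma mulVec_zero' (g : SL(2, ℂ)) (u : Fin 2 → ℂ) :
    (g.1 *ᵥ u) 0 = g 0 0 * u 0 + g 0 1 * u 1 := by
  simp [Matrix.mulVec, dotProduct, Fin.sum_univ_two]

lemma mulVec_one' (g : SL(2, ℂ)) (u : Fin 2 → ℂ) :
    (g.1 *ᵥ u) 1 = g 1 0 * u 0 + g 1 1 * u 1 := by
  simp [Matrix.mulVec, dotProduct, Fin.sum_univ_two]

lemma col_mul (g h : SL(2, ℂ)) : col (g * h) = g.1 *ᵥ col h := by
  ext i
  simp [col, Matrix.mul_apply, Matrix.mulVec, dotProduct]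

lemma det_eq (g : SL(2, ℂ)) : g 0 0 * g 1 1 - g 0 1 * g 1 0 = 1 := by
  have := g.det_coe; rwa [Matrix.det_fin_two] at this

lemma col_ne_zero (g : SL(2, ℂ)) : col g ≠ 0 := by
  intro h
  have h0 : g 0 0 = 0 := congrFun h 0
  have h1 : g 1 0 = 0 := congrFun h 1
  have := det_eq g
  simp [h0, h1] at this

lemma exists_col_eq {u : Fin 2 → ℂ} (hu : u ≠ 0) : ∃ g : SL(2, ℂ), col g = u := by
  by_cases h : u 0 = 0
  · have h1 : u 1 ≠ 0 := fun h1 => hu (by ext i; fin_cases i <;> assumption)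
    refine ⟨⟨!![u 0, -(u 1)⁻¹; u 1, 0], by simp [h1]⟩, ?_⟩
    ext i; fin_cases i <;> simp [col]
  · refine ⟨⟨!![u 0, 0; u 1, (u 0)⁻¹], by simp [h]⟩, ?_⟩
    ext i; fin_cases i <;> simp [col]

lemma denom_inv (g : SL(2, ℂ)) (p : H3) : H3.denom g⁻¹ p = qf p (col g) * p.r := by
  have hr := p.r_pos.ne'
  have h : (-(g 1 0 * p.z) + g 0 0) = g 0 0 - g 1 0 * p.z := by ring
  simp [H3.denom, qf, col, Matrix.SpecialLinearGroup.coe_inv, Matrix.adjugate_fin_two, h]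
  field_simp

/-- A nonzero u is the first column of some h, and then qf p u · r is the denominator of h⁻¹ at p by
`denom_inv`. Invariance is the cocycle relation `H3.denom_mul`. -/
lemma qf_smul_mulVec (g : SL(2, ℂ)) (p : H3) (u : Fin 2 → ℂ) :
    qf (g • p) (g.1 *ᵥ u) = qf p u := by
  by_cases hu : u = 0
  · simp [hu, qf]
  obtain ⟨h, rfl⟩ := exists_col_eq hu
  have h1 := denom_inv (g * h) (g • p)
  have h2 := denom_inv h p
  rw [_root_.mul_inv_rev, H3.denom_mul, inv_smul_smul, h2, col_mul] at h1
  have h3 : p.r = (g • p).r / H3.denom g⁻¹ (g • p) := by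
    conv_lhs => rw [← inv_smul_smul g p]
    rw [H3.smul_r]
  have h4 := (H3.denom_pos g⁻¹ (g • p)).ne'
  have h5 := (g • p).r_pos.ne'
  rw [h3] at h1
  field_simp at h1
  exact h1.symm

/-- Hadamard's inequality. -/
lemma normSq_det_le (p : H3) (u v : Fin 2 → ℂ) :
    Complex.normSq (u 0 * v 1 - u 1 * v 0) ≤ qf p u * qf p v := by
  have hr := p.r_pos
  set X := u 0 - u 1 * p.z
  set X' := v 0 - v 1 * p.z
  have h : u 0 * v 1 - u 1 * v 0 = X * v 1 - u 1 * X' := by simp only [X, X']; ring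
  have key : ∀ a b c d : ℂ, ∀ r : ℝ, Complex.normSq (a * d - b * c) * (r * r) ≤
      (Complex.normSq a + Complex.normSq b * r ^ 2) *
        (Complex.normSq c + Complex.normSq d * r ^ 2) := by
    intro a b c d r
    -- Lagrange's identity for the vectors (a, br) and (c, dr): what the determinant misses is the
    -- square of the Hermitian product.
    have e : (Complex.normSq a + Complex.normSq b * r ^ 2) *
        (Complex.normSq c + Complex.normSq d * r ^ 2) -
        Complex.normSq (a * d - b * c) * (r * r) =
        Complex.normSq (star a * c + star b * d * (r : ℂ) ^ 2) := by
      simp only [Complex.normSq_apply, ← Complex.ofReal_pow, Complex.star_def, Complex.add_re,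
        Complex.add_im, Complex.sub_re, Complex.sub_im, Complex.mul_re, Complex.mul_im,
        Complex.conj_re, Complex.conj_im, Complex.ofReal_re, Complex.ofReal_im]
      ring
    have := Complex.normSq_nonneg (star a * c + star b * d * (r : ℂ) ^ 2)
    linarith
  have := key X (u 1) X' (v 1) p.r
  rw [h]
  simp only [qf]
  rw [div_mul_div_comm, le_div_iff₀ (by positivity)]
  exact this

lemma normSq_add_le (x y : ℂ) :
    Complex.normSq (x + y) ≤ 2 * Complex.normSq x + 2 * Complex.normSq y := by
  simp only [Complex.normSq_apply, Complex.add_re, Complex.add_im]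
  nlinarith [sq_nonneg (x.re - y.re), sq_nonneg (x.im - y.im)]

lemma normSq_snd_le (p : H3) (u : Fin 2 → ℂ) : Complex.normSq (u 1) * p.r ≤ qf p u := by
  have hr := p.r_pos
  have h1 := Complex.normSq_nonneg (u 0 - u 1 * p.z)
  rw [qf, le_div_iff₀ hr]
  nlinarith

lemma normSq_fst_le (p : H3) (u : Fin 2 → ℂ) :
    Complex.normSq (u 0) ≤ 2 * qf p u * p.r + 2 * Complex.normSq (u 1) * Complex.normSq p.z := by
  have hr := p.r_pos
  have h1 := normSq_add_le (u 0 - u 1 * p.z) (u 1 * p.z)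
  have h2 : qf p u * p.r = Complex.normSq (u 0 - u 1 * p.z) + Complex.normSq (u 1) * p.r ^ 2 := by
    rw [qf, div_mul_cancel₀ _ hr.ne']
  have h3 := Complex.normSq_nonneg (u 1)
  rw [sub_add_cancel, Complex.normSq_mul] at h1
  nlinarith [mul_nonneg h3 (sq_nonneg p.r)]

/-- The forms attached to nearby points are comparable. -/
lemma qf_le_four_mul {p q : H3} (hz : Complex.normSq (p.z - q.z) ≤ q.r ^ 2 / 4)
    (h1 : 9 / 10 * q.r ≤ p.r) (h2 : p.r ≤ 2 * q.r) (u : Fin 2 → ℂ) : qf q u ≤ 4 * qf p u := by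
  have hp := p.r_pos
  have hq := q.r_pos
  have e : u 0 - u 1 * q.z = (u 0 - u 1 * p.z) + u 1 * (p.z - q.z) := by ring
  have h3 := normSq_add_le (u 0 - u 1 * p.z) (u 1 * (p.z - q.z))
  rw [← e, Complex.normSq_mul] at h3
  have h4 := Complex.normSq_nonneg (u 1)
  have h5 := Complex.normSq_nonneg (u 0 - u 1 * p.z)
  rw [qf, qf, ← mul_div_assoc, div_le_div_iff₀ hq hp]
  set A := Complex.normSq (u 0 - u 1 * p.z)
  set B := Complex.normSq (u 1)
  have h6 : B * Complex.normSq (p.z - q.z) ≤ B * (q.r ^ 2 / 4) := mul_le_mul_of_nonneg_left hz h4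
  have h7 : B * q.r ^ 2 * (81 / 100) ≤ B * p.r ^ 2 := by
    rw [mul_assoc]
    apply mul_le_mul_of_nonneg_left _ h4
    nlinarith
  -- The left side is at most 2A + (3/2) B q.r², and 3/2 ≤ 2 · 81/100; this is what the constants
  -- 1/4 and 9/10 are chosen for.
  have h8 : Complex.normSq (u 0 - u 1 * q.z) + B * q.r ^ 2 ≤ 2 * (A + B * p.r ^ 2) := by
    nlinarith [mul_nonneg h4 (sq_nonneg q.r)]
  have h9 : 0 ≤ A + B * p.r ^ 2 := by positivity
  calc _ ≤ 2 * (A + B * p.r ^ 2) * p.r := mul_le_mul_of_nonneg_right h8 hp.le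
    _ ≤ 2 * (A + B * p.r ^ 2) * (2 * q.r) := mul_le_mul_of_nonneg_left h2 (by positivity)
    _ = _ := by ring

variable {m : ℕ}

/-- The image in `ℂ²` of an integral vector. -/
def embVec (u : Fin 2 → QInt m) : Fin 2 → ℂ := fun i => emb m (u i)

lemma toSLC_mulVec (γ : SL(2, QInt m)) (u : Fin 2 → QInt m) :
    (toSLC (imagQuad m) γ).1 *ᵥ embVec u = embVec (γ.1 *ᵥ u) := by
  ext i
  simp [embVec, Matrix.mulVec, dotProduct, toSLC, Fin.sum_univ_two]

lemma toSLC_apply (γ : SL(2, QInt m)) (i j : Fin 2) :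
    (toSLC (imagQuad m) γ) i j = emb m (γ i j) := rfl

lemma embVec_ne_zero {u : Fin 2 → QInt m} (hu : u ≠ 0) : embVec u ≠ 0 := by
  intro h
  apply hu
  ext1 i
  exact emb_eq_zero.1 (congrFun h i)

lemma embVec_smul (k : QInt m) (u : Fin 2 → QInt m) : embVec (k • u) = emb m k • embVec u := by
  ext i; simp [embVec]

/-- If the second entry is nonzero, its term alone contributes at least r; otherwise the first entry
contributes at least 1/r. The bound is uniform over all integral vectors. -/
lemma min_le_qf (p : H3) {u : Fin 2 → QInt m} (hu : u ≠ 0) :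
    min p.r (p.r)⁻¹ ≤ qf p (embVec u) := by
  have hr := p.r_pos
  by_cases h1 : u 1 = 0
  · have h0 : u 0 ≠ 0 := fun h0 => hu (by ext1 i; fin_cases i <;> assumption)
    have := one_le_normSq_emb h0
    refine (min_le_right _ _).trans ?_
    simp only [qf, embVec, h1, map_zero, zero_mul, sub_zero, add_zero, inv_eq_one_div]
    gcongr
  · have := one_le_normSq_emb h1
    refine (min_le_left _ _).trans (le_trans ?_ (normSq_snd_le _ _))
    simp only [embVec]
    nlinarith

/-- Linearly independent integral vectors cannot both be short. -/
lemma one_le_qf_mul_qf (p : H3) {u v : Fin 2 → QInt m} (h : u 0 * v 1 - u 1 * v 0 ≠ 0) :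
    1 ≤ qf p (embVec u) * qf p (embVec v) := by
  refine le_trans ?_ (normSq_det_le p (embVec u) (embVec v))
  have := one_le_normSq_emb h
  simpa [embVec] using this

/-- The hypothesis puts the fractional parts of x and y in the same of the N cells of length 1/N. -/
lemma sq_sub_floor_le {N : ℕ} {x y : ℝ} (h : ⌊N * Int.fract x⌋₊ = ⌊N * Int.fract y⌋₊) :
    ((x - y) - ((⌊x⌋ - ⌊y⌋ : ℤ) : ℝ)) ^ 2 * (N * N) ≤ 1 := by
  have hx0 : 0 ≤ N * Int.fract x := mul_nonneg (Nat.cast_nonneg N) (Int.fract_nonneg x)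
  have hy0 : 0 ≤ N * Int.fract y := mul_nonneg (Nat.cast_nonneg N) (Int.fract_nonneg y)
  have h1 := Nat.floor_le hx0
  have h2 := Nat.lt_floor_add_one (N * Int.fract x)
  have h3 := Nat.floor_le hy0
  have h4 := Nat.lt_floor_add_one (N * Int.fract y)
  rw [h] at h1 h2
  have e : (x - y) - ((⌊x⌋ - ⌊y⌋ : ℤ) : ℝ) = Int.fract x - Int.fract y := by
    push_cast [Int.fract]; ring
  rw [e]
  have h5 : |N * Int.fract x - N * Int.fract y| ≤ 1 := by rw [abs_le]; constructor <;> linarith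
  calc _ = (N * Int.fract x - N * Int.fract y) ^ 2 := by ring
    _ ≤ 1 := (sq_le_one_iff_abs_le_one _).2 h5

/-- The pigeonhole principle for pairs of real numbers modulo integers. -/
lemma exists_simultaneous_approx {N : ℕ} (hN : 0 < N) (X Y : Fin (N + 1) × Fin (N + 1) → ℝ) :
    ∃ k l, k ≠ l ∧ ∃ a b : ℤ, (X k - X l - a) ^ 2 * (N * N) ≤ 1 ∧
      (Y k - Y l - b) ^ 2 * (N * N) ≤ 1 := by
  have hcell : ∀ x : ℝ, ⌊N * Int.fract x⌋₊ < N := by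
    intro x
    rw [Nat.floor_lt (mul_nonneg (Nat.cast_nonneg N) (Int.fract_nonneg x))]
    have h1 := Int.fract_lt_one x
    have h2 : (0 : ℝ) < N := by exact_mod_cast hN
    nlinarith
  let F : Fin (N + 1) × Fin (N + 1) → Fin N × Fin N := fun k =>
    (⟨_, hcell (X k)⟩, ⟨_, hcell (Y k)⟩)
  -- There are (N + 1)² points and only N² cells.
  obtain ⟨k, l, hkl, hF⟩ := Fintype.exists_ne_map_eq_of_card_lt F (by
    simp only [Fintype.card_prod, Fintype.card_fin]; nlinarith)
  exact ⟨k, l, hkl, _, _, sq_sub_floor_le (congrArg (fun a => (a.1 : ℕ)) hF),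
    sq_sub_floor_le (congrArg (fun a => (a.2 : ℕ)) hF)⟩

lemma normSq_add_mul_sqrtNeg (m : ℕ) (a b : ℝ) :
    Complex.normSq ((a : ℂ) + b * sqrtNeg m) = a ^ 2 + m * b ^ 2 := by
  have hss : Real.sqrt m * Real.sqrt m = m := Real.mul_self_sqrt (Nat.cast_nonneg m)
  simp only [Complex.normSq_apply, sqrtNeg]
  simp
  linear_combination (b ^ 2) * hss

lemma exists_real_coordinates (hm : Squarefree m) (t : ℂ) :
    ∃ x y : ℝ, t = x + y * sqrtNeg m := by
  refine ⟨t.re, t.im / Real.sqrt m, ?_⟩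
  have : ((Real.sqrt m : ℝ) : ℂ) ≠ 0 := by exact_mod_cast (sqrt_pos_of_squarefree hm).ne'
  conv_lhs => rw [← Complex.re_add_im t]
  simp only [sqrtNeg, Complex.ofReal_div]
  field_simp

/-- For N = ⌈1/√r⌉ one has 1 ≤ N√r ≤ 1 + √r ≤ 2. -/
lemma exists_nat_mul_sqrt {r : ℝ} (hr : 0 < r) (hr1 : r ≤ 1) :
    ∃ N : ℕ, 0 < N ∧ 1 ≤ (N * N) * r ∧ (N * N) * r ≤ 4 := by
  have hsr : 0 < Real.sqrt r := Real.sqrt_pos.2 hr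
  have hsr1 : Real.sqrt r ≤ 1 := Real.sqrt_le_one.2 hr1
  have hsrr : Real.sqrt r * Real.sqrt r = r := Real.mul_self_sqrt hr.le
  have hN1 : 1 / Real.sqrt r ≤ (⌈1 / Real.sqrt r⌉₊ : ℝ) := Nat.le_ceil _
  have hN2 := Nat.ceil_lt_add_one (show 0 ≤ 1 / Real.sqrt r by positivity)
  refine ⟨⌈1 / Real.sqrt r⌉₊, Nat.ceil_pos.2 (by positivity), ?_, ?_⟩
  all_goals
    generalize (⌈1 / Real.sqrt r⌉₊ : ℝ) = N at *
    rw [div_le_iff₀ hsr] at hN1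
  · rw [← hsrr]
    calc (1 : ℝ) ≤ (N * Real.sqrt r) * (N * Real.sqrt r) := one_le_mul_of_one_le_of_one_le hN1 hN1
      _ = _ := by ring
  · have h : N * Real.sqrt r ≤ 2 := by
      have := mul_le_mul_of_nonneg_right hN2.le hsr.le
      rw [add_mul, div_mul_cancel₀ _ hsr.ne'] at this
      linarith
    rw [← hsrr]
    calc N * N * (Real.sqrt r * Real.sqrt r) = (N * Real.sqrt r) * (N * Real.sqrt r) := by ring
      _ ≤ 2 * 2 := mul_le_mul h h (by linarith) (by norm_num)
      _ = 4 := by norm_num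

/-- Every Hermitian form has a short integral vector. -/
lemma exists_short_vector (hm : Squarefree m) (p : H3) :
    ∃ u : Fin 2 → QInt m, u ≠ 0 ∧ qf p (embVec u) ≤ 5 * (1 + m) := by
  have hr := p.r_pos
  have hm0 : (0 : ℝ) < m := by exact_mod_cast Nat.pos_of_ne_zero hm.ne_zero
  by_cases hr1 : 1 ≤ p.r
  · refine ⟨![1, 0], fun h => one_ne_zero (congrFun h 0), ?_⟩
    have : qf p (embVec (m := m) ![1, 0]) = 1 / p.r := by simp [qf, embVec]
    rw [this]
    calc 1 / p.r ≤ 1 := by rw [div_le_one hr]; exact hr1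
      _ ≤ _ := by linarith
  push Not at hr1
  -- Dirichlet's argument with N of size r^(-1/2): among the multiples of z by c₁ + c₂√-m with 0 ≤
  -- cᵢ ≤ N, two agree modulo ℤ + ℤ√-m up to 1/N in each coordinate. Their difference gives a vector
  -- (d, c) with |d - cz|² ≤ (1 + m)/N² ≤ (1 + m)r and |c|²r² ≤ (1 + m)N²r² ≤ 4(1 + m)r, and the sum
  -- divided by r is at most 5(1 + m).
  obtain ⟨N, hN, hN1, hN2⟩ := exists_nat_mul_sqrt hr hr1.le
  obtain ⟨w, hw⟩ := exists_emb_eq_sqrtNeg m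
  choose X Y hXY using fun k : Fin (N + 1) × Fin (N + 1) =>
    exists_real_coordinates hm (((k.1 : ℕ) + (k.2 : ℕ) * sqrtNeg m : ℂ) * p.z)
  obtain ⟨k, l, hkl, d1, d2, hX, hY⟩ := exists_simultaneous_approx hN X Y
  set c1 : ℤ := (k.1 : ℕ) - (l.1 : ℕ) with hc1
  set c2 : ℤ := (k.2 : ℕ) - (l.2 : ℕ) with hc2
  have hc : ∀ x y : Fin (N + 1), (((x : ℕ) : ℝ) - (y : ℕ)) ^ 2 ≤ N * N := by
    intro x y
    have h1 : ((x : ℕ) : ℝ) ≤ N := by exact_mod_cast Nat.lt_succ_iff.1 x.2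
    have h2 : ((y : ℕ) : ℝ) ≤ N := by exact_mod_cast Nat.lt_succ_iff.1 y.2
    have h3 : (0 : ℝ) ≤ (x : ℕ) := Nat.cast_nonneg _
    have h4 : (0 : ℝ) ≤ (y : ℕ) := Nat.cast_nonneg _
    rw [← sq]
    apply sq_le_sq' <;> linarith
  have hc1' : (c1 : ℝ) ^ 2 ≤ N * N := by simpa [hc1] using hc k.1 l.1
  have hc2' : (c2 : ℝ) ^ 2 ≤ N * N := by simpa [hc2] using hc k.2 l.2
  have hE : ∀ a b : ℤ, emb m ((a : QInt m) + b * w) = (a : ℂ) + b * sqrtNeg m := by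
    intro a b; rw [map_add, map_mul, hw]; simp
  have hns : Complex.normSq ((c1 : ℂ) + c2 * sqrtNeg m) = (c1 : ℝ) ^ 2 + m * (c2 : ℝ) ^ 2 := by
    have := normSq_add_mul_sqrtNeg m c1 c2; push_cast at this; exact this
  refine ⟨![d1 + d2 * w, c1 + c2 * w], ?_, ?_⟩
  · intro h
    have h1 : (c1 : QInt m) + c2 * w = 0 := congrFun h 1
    have h2 := hE c1 c2
    rw [h1, map_zero] at h2
    rw [← h2, map_zero] at hns
    have h3 : 0 ≤ m * (c2 : ℝ) ^ 2 := by positivity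
    have h5 : (c1 : ℝ) ^ 2 = 0 := le_antisymm (by linarith) (sq_nonneg _)
    have h4 : (m : ℝ) * (c2 : ℝ) ^ 2 = 0 := by linarith
    have h6 : c1 = 0 := by exact_mod_cast (pow_eq_zero_iff two_ne_zero).1 h5
    have h7 : c2 = 0 := by
      exact_mod_cast (pow_eq_zero_iff two_ne_zero).1 ((mul_eq_zero.1 h4).resolve_left hm0.ne')
    apply hkl
    ext <;> omega
  · have e0 : embVec (m := m) ![d1 + d2 * w, c1 + c2 * w] 0 = (d1 : ℂ) + d2 * sqrtNeg m := hE _ _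
    have e1 : embVec (m := m) ![d1 + d2 * w, c1 + c2 * w] 1 = (c1 : ℂ) + c2 * sqrtNeg m := hE _ _
    rw [qf, e0, e1, div_le_iff₀ hr]
    have e2 : (d1 : ℂ) + d2 * sqrtNeg m - ((c1 : ℂ) + c2 * sqrtNeg m) * p.z =
        -(((X k - X l - d1 : ℝ) : ℂ) + ((Y k - Y l - d2 : ℝ) : ℂ) * sqrtNeg m) := by
      have h1 := hXY k
      have h2 := hXY l
      simp only [hc1, hc2]
      push_cast
      linear_combination h2 - h1
    rw [e2, Complex.normSq_neg, normSq_add_mul_sqrtNeg, hns]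
    have hb : ∀ x : ℝ, x * (N * N) ≤ 1 → 0 ≤ x → x ≤ p.r := by
      intro x hx hx0
      calc x = x * 1 := (mul_one x).symm
        _ ≤ x * ((N * N) * p.r) := mul_le_mul_of_nonneg_left hN1 hx0
        _ = (x * (N * N)) * p.r := by ring
        _ ≤ 1 * p.r := mul_le_mul_of_nonneg_right hx hr.le
        _ = p.r := one_mul _
    have hX' := hb _ hX (sq_nonneg _)
    have hY' := mul_le_mul_of_nonneg_left (hb _ hY (sq_nonneg _)) hm0.le
    have t1 : (c1 : ℝ) ^ 2 + m * (c2 : ℝ) ^ 2 ≤ (1 + m) * (N * N) := by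
      have := mul_le_mul_of_nonneg_left hc2' hm0.le
      linarith
    have t2 : ((c1 : ℝ) ^ 2 + m * (c2 : ℝ) ^ 2) * p.r ^ 2 ≤ 4 * (1 + m) * p.r := by
      calc _ ≤ (1 + m) * (N * N) * p.r ^ 2 := mul_le_mul_of_nonneg_right t1 (sq_nonneg _)
        _ = (1 + m) * p.r * ((N * N) * p.r) := by ring
        _ ≤ (1 + m) * p.r * 4 := mul_le_mul_of_nonneg_left hN2 (by positivity)
        _ = _ := by ring
    linarith

/-- A bounded set of matrices contains finitely many elements of `SL₂(R)`. -/
lemma finite_SL_of_bounded (hm : Squarefree m) (B : ℝ) :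
    {γ : SL(2, QInt m) | ∀ i j, Complex.normSq (toSLC (imagQuad m) γ i j) ≤ B}.Finite := by
  have h := Set.Finite.pi' fun _ : Fin 2 => Set.Finite.pi' fun _ : Fin 2 =>
    finite_normSq_emb_le hm B
  exact Set.Finite.of_finite_image (f := fun γ : SL(2, QInt m) => (γ.1 : Fin 2 → Fin 2 → QInt m))
    (h.subset (by rintro _ ⟨γ, hγ, rfl⟩; exact hγ)) Subtype.val_injective.injOn

lemma finite_SL_of_isCompact (hm : Squarefree m) {C : Set (Matrix (Fin 2) (Fin 2) ℂ)}
    (hC : IsCompact C) : {γ : SL(2, QInt m) | (toSLC (imagQuad m) γ).1 ∈ C}.Finite := by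
  have h : ∀ i j, ∃ B, ∀ M ∈ C, Complex.normSq (M i j) ≤ B := by
    intro i j
    obtain ⟨B, hB⟩ := (hC.image_of_continuousOn
      (f := fun M => Complex.normSq (M i j)) (by fun_prop)).bddAbove
    exact ⟨B, fun M hM => hB ⟨M, hM, rfl⟩⟩
  choose B hB using h
  refine (finite_SL_of_bounded hm (∑ i, ∑ j, |B i j|)).subset fun γ hγ i j => ?_
  calc _ ≤ B i j := hB i j _ hγ
    _ ≤ |B i j| := le_abs_self _
    _ ≤ ∑ j, |B i j| := Finset.single_le_sum (f := fun j => |B i j|)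
        (fun _ _ => abs_nonneg _) (Finset.mem_univ j)
    _ ≤ _ := Finset.single_le_sum (f := fun i => ∑ j, |B i j|)
        (fun _ _ => Finset.sum_nonneg fun _ _ => abs_nonneg _) (Finset.mem_univ i)

end Forms


/-! ### The charts of the partial Borel–Serre spaces -/

section Charts

open Matrix

namespace H3

lemma continuous_z : Continuous H3.z := continuous_fst

lemma continuous_r : Continuous H3.r := continuous_subtype_val.comp continuous_snd

lemma continuous_mk {X : Type*} [TopologicalSpace X] {f : X → ℂ} {g : X → ℝ} (hg : ∀ x, 0 < g x)
    (hf : Continuous f) (hgc : Continuous g) : Continuous fun x => H3.mk (f x) (g x) (hg x) :=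
  Continuous.prodMk hf (Continuous.subtype_mk hgc _)

lemma continuous_of_z_r {X : Type*} [TopologicalSpace X] {f : X → H3}
    (hz : Continuous fun x => (f x).z) (hr : Continuous fun x => (f x).r) : Continuous f :=
  continuous_mk (fun x => (f x).r_pos) hz hr

@[simp] lemma mk_z (z : ℂ) (r : ℝ) (hr : 0 < r) : (H3.mk z r hr).z = z := rfl

@[simp] lemma mk_r (z : ℂ) (r : ℝ) (hr : 0 < r) : (H3.mk z r hr).r = r := rfl

instance : ContinuousConstSMul SL(2, ℂ) H3 where
  continuous_const_smul g := by
    have hz := continuous_z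
    have hr := continuous_r
    have hd : Continuous fun p => denom g p := by
      unfold denom
      exact (Complex.continuous_normSq.comp ((continuous_const.mul hz).add continuous_const)).add
        (continuous_const.mul (hr.pow 2))
    refine continuous_of_z_r ?_ ?_
    · simp only [smul_z]
      refine Continuous.div ?_ (Complex.continuous_ofReal.comp hd)
        (fun p => by exact_mod_cast (denom_pos g p).ne')
      have hr' : Continuous fun p : H3 => (p.r : ℂ) := Complex.continuous_ofReal.comp hr
      fun_prop
    · simp only [smul_r]
      exact hr.div hd fun p => (denom_pos g p).ne'

instance : T2Space H3 := inferInstanceAs (T2Space (ℂ × Set.Ioi (0 : ℝ)))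

instance : SecondCountableTopology H3 :=
  inferInstanceAs (SecondCountableTopology (ℂ × Set.Ioi (0 : ℝ)))

instance : LocallyCompactSpace H3 :=
  have : LocallyCompactSpace (Set.Ioi (0 : ℝ)) := isOpen_Ioi.locallyCompactSpace
  inferInstanceAs (LocallyCompactSpace (ℂ × Set.Ioi (0 : ℝ)))

end H3

/-- The point of hyperbolic space with given horizontal coordinate and inverse height, where the
height is one if the inverse height vanishes. -/
def ofInvHeight (x : ℂ × Set.Ici (0 : ℝ)) : H3 :=
  H3.mk x.1 (if 0 < (x.2 : ℝ) then (x.2 : ℝ)⁻¹ else 1) (by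
    split_ifs with h
    · exact inv_pos.2 h
    · exact one_pos)

/-- The coordinates of a point of hyperbolic space in the chart at infinity. -/
def toInvHeight (p : H3) : ℂ × Set.Ici (0 : ℝ) := (p.z, ⟨p.r⁻¹, inv_nonneg.2 p.r_pos.le⟩)

lemma continuous_toInvHeight : Continuous toInvHeight :=
  Continuous.prodMk H3.continuous_z
    (Continuous.subtype_mk (H3.continuous_r.inv₀ fun p => p.r_pos.ne') _)

lemma toInvHeight_snd_pos (p : H3) : 0 < ((toInvHeight p).2 : ℝ) := inv_pos.2 p.r_pos

lemma ofInvHeight_toInvHeight (p : H3) : ofInvHeight (toInvHeight p) = p := by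
  have := p.r_pos
  ext
  · rfl
  · simp [ofInvHeight, toInvHeight, this]

lemma toInvHeight_ofInvHeight {x : ℂ × Set.Ici (0 : ℝ)} (hx : 0 < (x.2 : ℝ)) :
    toInvHeight (ofInvHeight x) = x := by
  ext
  · rfl
  · simp [ofInvHeight, toInvHeight, hx]

lemma isOpen_snd_pos : IsOpen {x : ℂ × Set.Ici (0 : ℝ) | 0 < (x.2 : ℝ)} :=
  isOpen_lt continuous_const (continuous_subtype_val.comp continuous_snd)

lemma continuousOn_ofInvHeight :
    ContinuousOn ofInvHeight {x : ℂ × Set.Ici (0 : ℝ) | 0 < (x.2 : ℝ)} := by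
  rw [continuousOn_iff_continuous_domRestrict]
  have h : Continuous fun x : {x : ℂ × Set.Ici (0 : ℝ) | 0 < (x.2 : ℝ)} => (x.1.2 : ℝ)⁻¹ :=
    Continuous.inv₀ (by fun_prop) fun x => x.2.ne'
  refine H3.continuous_of_z_r (by simp only [Set.domRestrict_apply, ofInvHeight, H3.mk_z]; fun_prop) ?_
  convert h using 2 with x
  exact if_pos x.2

lemma qf_ofInvHeight {x : ℂ × Set.Ici (0 : ℝ)} (hx : 0 < (x.2 : ℝ)) (g : SL(2, ℂ)) :
    qf (g • ofInvHeight x) (col g) = x.2 := by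
  have h : col g = g.1 *ᵥ col 1 := by rw [← col_mul, mul_one]
  rw [h, qf_smul_mulVec]
  simp [qf, col, ofInvHeight, hx]

/-- The link between charts and forms: by invariance both sides can be computed at the cusp ∞, where
the form of (1, 0) is 1/r. -/
lemma toInvHeight_snd (g : SL(2, ℂ)) (p : H3) :
    ((toInvHeight (g⁻¹ • p)).2 : ℝ) = qf p (col g) := by
  conv_rhs => rw [← smul_inv_smul g p, ← ofInvHeight_toInvHeight (g⁻¹ • p)]
  rw [qf_ofInvHeight (toInvHeight_snd_pos _)]

/-- The action of an upper triangular matrix in the chart at infinity. -/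
def upperAct (b : SL(2, ℂ)) (x : ℂ × Set.Ici (0 : ℝ)) : ℂ × Set.Ici (0 : ℝ) :=
  (b 0 0 ^ 2 * x.1 + b 0 0 * b 0 1,
    ⟨x.2 / Complex.normSq (b 0 0), div_nonneg x.2.2 (Complex.normSq_nonneg _)⟩)

lemma continuous_upperAct (b : SL(2, ℂ)) : Continuous (upperAct b) := by
  unfold upperAct
  refine Continuous.prodMk (by fun_prop) (Continuous.subtype_mk ?_ _)
  simp only [div_eq_mul_inv]
  fun_prop

lemma upper_mul_eq_one {b : SL(2, ℂ)} (hb : b 1 0 = 0) : b 0 0 * b 1 1 = 1 := by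
  have := det_eq b
  rwa [hb, mul_zero, sub_zero] at this

lemma smul_ofInvHeight {b : SL(2, ℂ)} (hb : b 1 0 = 0) {x : ℂ × Set.Ici (0 : ℝ)}
    (hx : 0 < (x.2 : ℝ)) : b • ofInvHeight x = ofInvHeight (upperAct b x) := by
  have h1 := upper_mul_eq_one hb
  have h0 : b 0 0 ≠ 0 := left_ne_zero_of_mul_eq_one h1
  have h11 : b 1 1 = (b 0 0)⁻¹ := eq_inv_of_mul_eq_one_right h1
  have hn : 0 < Complex.normSq (b 0 0) := Complex.normSq_pos.2 h0
  have hx' : 0 < (x.2 : ℝ) / Complex.normSq (b 0 0) := div_pos hx hn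
  ext
  · rw [H3.smul_z]
    simp only [H3.denom, hb, h11, ofInvHeight, upperAct, H3.mk_z]
    simp only [Complex.normSq_inv, zero_mul, zero_add, map_zero, star_zero, mul_zero, add_zero]
    have e : ((Complex.normSq (b 0 0))⁻¹ : ℝ) = ((b 0 0)⁻¹ * star (b 0 0)⁻¹ : ℂ) := by
      push_cast
      rw [Complex.normSq_eq_conj_mul_self]
      simp [mul_comm]
    rw [e]
    have h2 : star (b 0 0)⁻¹ ≠ 0 := star_ne_zero.2 (inv_ne_zero h0)
    rw [mul_div_mul_right _ _ h2]
    field_simp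
  · rw [H3.smul_r]
    have h2 : (ofInvHeight (upperAct b x)).r = (x.2 / Complex.normSq (b 0 0))⁻¹ := if_pos hx'
    have h3 : (ofInvHeight x).r = (x.2 : ℝ)⁻¹ := if_pos hx
    rw [h2]
    simp only [H3.denom, hb, h11, h3]
    simp
    field_simp

lemma mob_infty_eq_iff {g g' : SL(2, ℂ)} : mob g ∞ = mob g' ∞ ↔ (g⁻¹ * g') 1 0 = 0 := by
  have h : mob g ∞ = mob g' ∞ ↔ mob (g⁻¹ * g') ∞ = ∞ := by
    constructor
    · intro h; rw [mob_mul, ← h, ← mob_mul, inv_mul_cancel, mob_one]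
    · intro h
      rw [← mul_inv_cancel_left g g', mob_mul g, h]
  rw [h]
  exact OnePoint.smul_infty_eq_self_iff

lemma inv_mul_one_zero (g g' : SL(2, ℂ)) :
    (g⁻¹ * g') 1 0 = col g 0 * col g' 1 - col g 1 * col g' 0 := by
  simp [col, Matrix.mul_apply, Fin.sum_univ_two, Matrix.SpecialLinearGroup.coe_inv,
    Matrix.adjugate_fin_two]
  ring

lemma mob_infty (g : SL(2, ℂ)) :
    mob g ∞ = if g 1 0 = 0 then ∞ else ((g 0 0 / g 1 0 : ℂ) : Sphere) :=
  OnePoint.smul_infty_eq_ite _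

lemma coe_unip (z : ℂ) : (unip z : Matrix (Fin 2) (Fin 2) ℂ) = !![1, z; 0, 1] := rfl

lemma unip_zero : unip 0 = 1 := by ext i j; fin_cases i <;> fin_cases j <;> simp [unip]

/-- The matrix `diag(a, 1/a)` for a complex number `a`. -/
def cdiag (a : ℂ) (ha : a ≠ 0) : SL(2, ℂ) := ⟨!![a, 0; 0, a⁻¹], by simp [ha]⟩

lemma coe_cdiag (a : ℂ) (ha : a ≠ 0) :
    (cdiag a ha : Matrix (Fin 2) (Fin 2) ℂ) = !![a, 0; 0, a⁻¹] := rfl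

/-- The nontrivial element of the Weyl group. -/
def weyl : SL(2, ℂ) := ⟨!![0, -1; 1, 0], by simp⟩

lemma coe_weyl : (weyl : Matrix (Fin 2) (Fin 2) ℂ) = !![0, -1; 1, 0] := rfl

/-- b · n_z is a unipotent matrix times a diagonal one, and the diagonal factor centralises the
standard torus. -/
lemma conjSub_upper {b : SL(2, ℂ)} (hb : b 1 0 = 0) (z : ℂ) :
    conjSub (b * unip z) stdTorus = conjSub (unip (b 0 0 ^ 2 * z + b 0 0 * b 0 1)) stdTorus := by
  have h1 := upper_mul_eq_one hb
  have h0 : b 0 0 ≠ 0 := left_ne_zero_of_mul_eq_one h1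
  have h11 : b 1 1 = (b 0 0)⁻¹ := eq_inv_of_mul_eq_one_right h1
  set d : SL(2, ℂ) := cdiag (b 0 0) h0 with hd
  have e : b * unip z = unip (b 0 0 ^ 2 * z + b 0 0 * b 0 1) * d := by
    ext i j
    fin_cases i <;> fin_cases j <;>
      simp [coe_unip, hd, coe_cdiag, Matrix.mul_apply, Fin.sum_univ_two, hb, h11]
    field_simp
  have hcomm : ∀ t, d * diagMat t * d⁻¹ = diagMat t := by
    intro t
    rw [mul_inv_eq_iff_eq_mul]
    ext i j
    fin_cases i <;> fin_cases j <;>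
      simp [coe_diagMat, hd, coe_cdiag, Matrix.mul_apply, Fin.sum_univ_two, mul_comm]
  have hstd : conjSub d stdTorus = stdTorus := by
    ext x
    constructor
    · rintro ⟨_, ⟨t, rfl⟩, rfl⟩
      exact ⟨t, (hcomm t).symm⟩
    · rintro ⟨t, rfl⟩
      exact ⟨diagMat t, ⟨t, rfl⟩, hcomm t⟩
  rw [e, conjSub_mul, hstd]

/-- A torus which fixes infinity is conjugate to the standard torus by a unipotent element. -/
lemma IsTorusOf.exists_unip {T : Subgroup SL(2, ℂ)} (h : IsTorusOf ∞ T) :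
    ∃ z, T = conjSub (unip z) stdTorus := by
  obtain ⟨h1, k, rfl⟩ := h
  -- The lower left entry of k diag(2, 1/2) k⁻¹ is (2 - 1/2) times this product, and it vanishes
  -- because the torus fixes infinity.
  have key : k 1 0 * k 1 1 = 0 := by
    have h2 : mob (k * diagMat ⟨2, by simp⟩ * k⁻¹) ∞ = ∞ := h1 ⟨_, ⟨_, rfl⟩, rfl⟩
    have h3 : (k * diagMat ⟨2, by simp⟩ * k⁻¹) 1 0 = 0 := OnePoint.smul_infty_eq_self_iff.1 h2
    simp [Matrix.mul_apply, Fin.sum_univ_two, coe_diagMat, Matrix.SpecialLinearGroup.coe_inv,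
      Matrix.adjugate_fin_two] at h3
    linear_combination (2 / 3 : ℂ) * h3
  rcases mul_eq_zero.1 key with hc | hd
  · have := conjSub_upper hc 0
    rw [unip_zero, mul_one] at this
    exact ⟨_, this⟩
  -- Here k carries the other fixed point of the standard torus to ∞. The Weyl element normalises
  -- the torus, so k may be replaced by the upper triangular k · weyl.
  · have hcomm : ∀ t : Set.Ioi (0 : ℝ), weyl * diagMat t * weyl⁻¹ =
        diagMat ⟨t.1⁻¹, Set.mem_Ioi.2 (inv_pos.2 t.2)⟩ := by
      intro t
      rw [mul_inv_eq_iff_eq_mul]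
      ext i j
      fin_cases i <;> fin_cases j <;>
        simp [coe_diagMat, coe_weyl, Matrix.mul_apply, Fin.sum_univ_two]
    have hstd : conjSub weyl stdTorus = stdTorus := by
      ext x
      constructor
      · rintro ⟨_, ⟨t, rfl⟩, rfl⟩
        exact ⟨_, (hcomm t).symm⟩
      · rintro ⟨t, rfl⟩
        refine ⟨diagMat ⟨t.1⁻¹, Set.mem_Ioi.2 (inv_pos.2 t.2)⟩, ⟨_, rfl⟩, ?_⟩
        refine (hcomm _).trans ?_
        simp
    have hc : (k * weyl) 1 0 = 0 := by simp [coe_weyl, Matrix.mul_apply, Fin.sum_univ_two, hd]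
    have := conjSub_upper hc 0
    rw [unip_zero, mul_one, conjSub_mul, hstd] at this
    exact ⟨_, this⟩

/-- The conjugate of diag(2, 1/2) by n_z has upper right entry -(3/2)z, and its diagonal identifies
the corresponding element of the other torus. -/
lemma conjSub_unip_injective {z w : ℂ}
    (h : conjSub (unip z) stdTorus = conjSub (unip w) stdTorus) : z = w := by
  have h1 : unip z * diagMat ⟨2, by simp⟩ * (unip z)⁻¹ ∈ conjSub (unip w) stdTorus :=
    h ▸ ⟨_, ⟨_, rfl⟩, rfl⟩
  obtain ⟨_, ⟨t, rfl⟩, ht⟩ := h1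
  have ht' : unip w * diagMat t * (unip w)⁻¹ = unip z * diagMat ⟨2, by simp⟩ * (unip z)⁻¹ := ht
  have e0 := congrArg (fun g : SL(2, ℂ) => g 0 0) ht'
  have e1 := congrArg (fun g : SL(2, ℂ) => g 0 1) ht'
  simp [Matrix.mul_apply, Fin.sum_univ_two, coe_diagMat, Matrix.SpecialLinearGroup.coe_inv,
    Matrix.adjugate_fin_two, coe_unip] at e0 e1
  rw [e0] at e1
  linear_combination (2 / 3 : ℂ) * e1

lemma conjSub_injective (g : SL(2, ℂ)) : Function.Injective (conjSub g) := by
  intro S T h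
  have := congrArg (conjSub g⁻¹) h
  simpa [← conjSub_mul, conjSub_one] using this

/-! ### Transition maps and the glued topology -/

namespace BorelSerre

variable {K : IntermediateField ℚ ℂ} (S : CuspSet K)

lemma chart_of_pos {g : SL(2, ℂ)} (hg : mob g ∞ ∈ S.carrier) {x : ℂ × Set.Ici (0 : ℝ)}
    (hx : 0 < (x.2 : ℝ)) : chart S g hg x = incl S (g • ofInvHeight x) := by
  rw [chart, dif_pos hx]
  congr 2
  ext
  · rfl
  · simp [ofInvHeight, hx]

lemma chart_of_eq_zero {g : SL(2, ℂ)} (hg : mob g ∞ ∈ S.carrier) {x : ℂ × Set.Ici (0 : ℝ)}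
    (hx : (x.2 : ℝ) = 0) : chart S g hg x =
      bdry S ⟨mob g ∞, conjSub (g * unip x.1) stdTorus, hg, by
        have := isTorusOf_std.conj (g * unip x.1)
        rwa [mob_mul, mob_unip] at this⟩ := by
  rw [chart, dif_neg (by rw [hx]; exact lt_irrefl 0)]

lemma snd_pos_or_eq_zero (x : ℂ × Set.Ici (0 : ℝ)) : 0 < (x.2 : ℝ) ∨ (x.2 : ℝ) = 0 := by
  have h : 0 ≤ (x.2 : ℝ) := x.2.2
  exact h.lt_or_eq.imp_right Eq.symm

lemma incl_injective : Function.Injective (incl S) := Sum.inl_injective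

lemma incl_ne_bdry (p : H3) (b : BoundaryPoint S) : incl S p ≠ bdry S b := Sum.inl_ne_inr

lemma chart_eq_incl_iff {g : SL(2, ℂ)} (hg : mob g ∞ ∈ S.carrier) {x : ℂ × Set.Ici (0 : ℝ)}
    {p : H3} : chart S g hg x = incl S p ↔ x = toInvHeight (g⁻¹ • p) := by
  constructor
  · intro h
    rcases snd_pos_or_eq_zero x with hx | hx
    · rw [chart_of_pos S hg hx] at h
      rw [← incl_injective S h, inv_smul_smul, toInvHeight_ofInvHeight hx]
    · rw [chart_of_eq_zero S hg hx] at h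
      exact absurd h.symm (incl_ne_bdry S _ _)
  · rintro rfl
    rw [chart_of_pos S hg (toInvHeight_snd_pos _), ofInvHeight_toInvHeight, smul_inv_smul]

lemma chart_mul {g b : SL(2, ℂ)} (hg : mob g ∞ ∈ S.carrier) (hb : b 1 0 = 0)
    (hgb : mob (g * b) ∞ ∈ S.carrier) (x : ℂ × Set.Ici (0 : ℝ)) :
    chart S (g * b) hgb x = chart S g hg (upperAct b x) := by
  have h0 : b 0 0 ≠ 0 := left_ne_zero_of_mul_eq_one (upper_mul_eq_one hb)
  have hn : 0 < Complex.normSq (b 0 0) := Complex.normSq_pos.2 h0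
  rcases snd_pos_or_eq_zero x with hx | hx
  · rw [chart_of_pos S hgb hx, chart_of_pos S hg (x := upperAct b x) (div_pos hx hn), mul_smul,
      smul_ofInvHeight hb hx]
  · rw [chart_of_eq_zero S hgb hx, chart_of_eq_zero S hg (x := upperAct b x) (by
      simp [upperAct, hx])]
    congr 1
    ext1
    · change mob (g * b) ∞ = mob g ∞
      rw [mob_mul, show mob b ∞ = ∞ from OnePoint.smul_infty_eq_self_iff.2 hb]
    · change conjSub (g * b * unip x.1) stdTorus = _
      rw [mul_assoc, conjSub_mul, conjSub_upper hb, ← conjSub_mul]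
      rfl

lemma chart_injective {g : SL(2, ℂ)} (hg : mob g ∞ ∈ S.carrier) :
    Function.Injective (chart S g hg) := by
  intro x y h
  rcases snd_pos_or_eq_zero x with hx | hx
  · rw [chart_of_pos S hg hx] at h
    rw [(chart_eq_incl_iff S hg).1 h.symm, inv_smul_smul, toInvHeight_ofInvHeight hx]
  · rcases snd_pos_or_eq_zero y with hy | hy
    · rw [chart_of_pos S hg hy] at h
      rw [(chart_eq_incl_iff S hg).1 h, inv_smul_smul, toInvHeight_ofInvHeight hy]
    · rw [chart_of_eq_zero S hg hx, chart_of_eq_zero S hg hy] at h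
      have h1 := congrArg BoundaryPoint.torus (Sum.inr_injective h)
      change conjSub (g * unip x.1) stdTorus = conjSub (g * unip y.1) stdTorus at h1
      rw [conjSub_mul, conjSub_mul] at h1
      have h2 := conjSub_unip_injective (conjSub_injective g h1)
      exact Prod.ext h2 (Subtype.ext (hx.trans hy.symm))

lemma exists_chart_eq_bdry {g : SL(2, ℂ)} (hg : mob g ∞ ∈ S.carrier) (b : BoundaryPoint S)
    (hb : mob g ∞ = b.cusp) :
    ∃ z : ℂ, chart S g hg (z, ⟨0, le_refl (0 : ℝ)⟩) = bdry S b := by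
  have h := b.isTorus.conj g⁻¹
  rw [← hb, ← mob_mul, inv_mul_cancel, mob_one] at h
  obtain ⟨z, hz⟩ := h.exists_unip
  refine ⟨z, ?_⟩
  rw [chart_of_eq_zero S hg rfl]
  congr 1
  ext1
  · exact hb
  · change conjSub (g * unip z) stdTorus = b.torus
    rw [conjSub_mul, ← hz, ← conjSub_mul, mul_inv_cancel, conjSub_one]

lemma mob_eq_of_chart_eq_bdry {g : SL(2, ℂ)} (hg : mob g ∞ ∈ S.carrier)
    {x : ℂ × Set.Ici (0 : ℝ)} {b : BoundaryPoint S} (h : chart S g hg x = bdry S b) :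
    mob g ∞ = b.cusp ∧ (x.2 : ℝ) = 0 := by
  rcases snd_pos_or_eq_zero x with hx | hx
  · rw [chart_of_pos S hg hx] at h
    exact absurd h (incl_ne_bdry S _ _)
  · rw [chart_of_eq_zero S hg hx] at h
    exact ⟨congrArg BoundaryPoint.cusp (Sum.inr_injective h), hx⟩

lemma isOpen_iff {s : Set (BorelSerre S)} : IsOpen s ↔ IsOpen (incl S ⁻¹' s) ∧
    ∀ (g : SL(2, ℂ)) (hg : mob g ∞ ∈ S.carrier), IsOpen (chart S g hg ⁻¹' s) := by
  refine Iff.trans (isOpen_sup (t₁ := TopologicalSpace.coinduced (incl S) inferInstance)) ?_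
  rw [ isOpen_coinduced, isOpen_iSup_iff]
  simp only [isOpen_coinduced, Subtype.forall]

lemma continuous_incl : Continuous (incl S) := ⟨fun _ hs => ((isOpen_iff S).1 hs).1⟩

lemma continuous_chart {g : SL(2, ℂ)} (hg : mob g ∞ ∈ S.carrier) : Continuous (chart S g hg) :=
  ⟨fun _ hs => ((isOpen_iff S).1 hs).2 g hg⟩

lemma continuous_dom {Y : Type*} [TopologicalSpace Y] {f : BorelSerre S → Y}
    (h1 : Continuous (f ∘ incl S))
    (h2 : ∀ (g : SL(2, ℂ)) (hg : mob g ∞ ∈ S.carrier), Continuous (f ∘ chart S g hg)) :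
    Continuous f :=
  ⟨fun _ hs => (isOpen_iff S).2 ⟨hs.preimage h1, fun g hg => hs.preimage (h2 g hg)⟩⟩

lemma isOpen_preimage_chart_incl {g : SL(2, ℂ)} (hg : mob g ∞ ∈ S.carrier) {V : Set H3}
    (hV : IsOpen V) : IsOpen (chart S g hg ⁻¹' (incl S '' V)) := by
  have : chart S g hg ⁻¹' (incl S '' V) =
      {x | 0 < (x.2 : ℝ)} ∩ ofInvHeight ⁻¹' ((fun p => g • p) ⁻¹' V) := by
    ext x
    simp only [Set.mem_preimage, Set.mem_image, Set.mem_inter_iff, Set.mem_ofPred_eq]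
    constructor
    · rintro ⟨p, hp, h⟩
      rw [(chart_eq_incl_iff S hg).1 h.symm, ofInvHeight_toInvHeight, smul_inv_smul]
      exact ⟨toInvHeight_snd_pos _, hp⟩
    · rintro ⟨hx, h⟩
      exact ⟨_, h, (chart_of_pos S hg hx).symm⟩
  rw [this]
  exact continuousOn_ofInvHeight.isOpen_inter_preimage isOpen_snd_pos
    (hV.preimage (continuous_const_smul g))

lemma isOpenEmbedding_incl : IsOpenEmbedding (incl S) :=
  .of_continuous_injective_isOpenMap (continuous_incl S) (incl_injective S) fun V hV =>
    (isOpen_iff S).2 ⟨by rwa [Set.preimage_image_eq _ (incl_injective S)],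
      fun _ hg => isOpen_preimage_chart_incl S hg hV⟩

lemma preimage_incl_chart {g : SL(2, ℂ)} (hg : mob g ∞ ∈ S.carrier)
    (U : Set (ℂ × Set.Ici (0 : ℝ))) :
    incl S ⁻¹' (chart S g hg '' U) = (fun p => toInvHeight (g⁻¹ • p)) ⁻¹' U := by
  ext p
  simp only [Set.mem_preimage, Set.mem_image]
  constructor
  · rintro ⟨x, hx, h⟩
    rwa [← (chart_eq_incl_iff S hg).1 h]
  · intro h
    exact ⟨_, h, (chart_eq_incl_iff S hg).2 rfl⟩

/-- Openness is tested in every other chart. Charts at the same cusp differ by the homeomorphism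
`upperAct`; charts at different cusps overlap only inside hyperbolic space, where openness is
already known. -/
lemma isOpenEmbedding_chart {g : SL(2, ℂ)} (hg : mob g ∞ ∈ S.carrier) :
    IsOpenEmbedding (chart S g hg) := by
  refine .of_continuous_injective_isOpenMap (continuous_chart S hg) (chart_injective S hg)
    fun U hU => (isOpen_iff S).2 ⟨?_, fun g' hg' => ?_⟩
  · rw [preimage_incl_chart]
    exact hU.preimage (continuous_toInvHeight.comp (continuous_const_smul _))
  · by_cases h : mob g ∞ = mob g' ∞
    · have hb := mob_infty_eq_iff.1 h
      have e : chart S g' hg' = chart S g hg ∘ upperAct (g⁻¹ * g') := by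
        funext x
        rw [Function.comp_apply, ← chart_mul S hg hb (by rwa [mul_inv_cancel_left])]
        simp only [mul_inv_cancel_left]
      rw [e, Set.preimage_comp, Set.preimage_image_eq _ (chart_injective S hg)]
      exact hU.preimage (continuous_upperAct _)
    · have hV : IsOpen (incl S ⁻¹' (chart S g hg '' U)) := by
        rw [preimage_incl_chart]
        exact hU.preimage (continuous_toInvHeight.comp (continuous_const_smul _))
      convert isOpen_preimage_chart_incl S hg' hV using 1
      ext x
      simp only [Set.mem_preimage, Set.image_preimage_eq_inter_range, Set.mem_inter_iff]
      refine ⟨fun hx => ⟨hx, ?_⟩, fun hx => hx.1⟩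
      rcases snd_pos_or_eq_zero x with hx0 | hx0
      · rw [chart_of_pos S hg' hx0]
        exact Set.mem_range_self _
      · exfalso
        obtain ⟨y, -, hy⟩ := hx
        rw [chart_of_eq_zero S hg' hx0] at hy
        exact h (mob_eq_of_chart_eq_bdry S hg hy).1

lemma smul_chart (γ : SL(2, NumberField.RingOfIntegers K)) {g : SL(2, ℂ)}
    (hg : mob g ∞ ∈ S.carrier) (hγg : mob (toSLC K γ * g) ∞ ∈ S.carrier)
    (x : ℂ × Set.Ici (0 : ℝ)) : γ • chart S g hg x = chart S (toSLC K γ * g) hγg x := by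
  rcases snd_pos_or_eq_zero x with hx | hx
  · rw [chart_of_pos S hg hx, chart_of_pos S hγg hx, smul_incl, mul_smul]
  · rw [chart_of_eq_zero S hg hx, chart_of_eq_zero S hγg hx, smul_bdry]
    congr 1
    ext1
    · exact (mob_mul _ _ _).symm
    · change conjSub _ (conjSub _ _) = conjSub _ _
      rw [← conjSub_mul, mul_assoc]

lemma mob_mul_mem (γ : SL(2, NumberField.RingOfIntegers K)) {g : SL(2, ℂ)}
    (hg : mob g ∞ ∈ S.carrier) : mob (toSLC K γ * g) ∞ ∈ S.carrier := by
  rw [mob_mul]; exact S.stable γ _ hg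

instance : ContinuousConstSMul SL(2, NumberField.RingOfIntegers K) (BorelSerre S) where
  continuous_const_smul γ := by
    refine continuous_dom S ?_ fun g hg => ?_
    · exact (continuous_incl S).comp (continuous_const_smul (toSLC K γ))
    · have : (fun x => γ • x) ∘ chart S g hg = chart S _ (mob_mul_mem S γ hg) :=
        funext fun x => smul_chart S γ hg _ x
      rw [this]
      exact continuous_chart S _

end BorelSerre

end Charts


/-! ### Normalized charts and horoballs -/

section Normalized

open Matrix

variable {m : ℕ}

/-- The first column of `g` is integral and none of its integral multiples is shorter. -/
def IsNormalized (m : ℕ) (g : SL(2, ℂ)) : Prop :=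
  ∃ u : Fin 2 → QInt m, col g = embVec u ∧
    ∀ (c : ℂ) (v : Fin 2 → QInt m), v ≠ 0 → embVec v = c • col g → 1 ≤ Complex.normSq c

lemma mob_eq_of_col_eq_smul {g g' : SL(2, ℂ)} {c : ℂ} (h : col g' = c • col g) :
    mob g ∞ = mob g' ∞ := by
  rw [mob_infty_eq_iff, inv_mul_one_zero, h]
  simp
  ring

lemma col_eq_smul_of_mob_eq {g g' : SL(2, ℂ)} (h : mob g ∞ = mob g' ∞) :
    col g' = (g⁻¹ * g') 0 0 • col g := by
  have h0 : col (g⁻¹ * g') 1 = 0 := mob_infty_eq_iff.1 h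
  have e : col g' = g.1 *ᵥ col (g⁻¹ * g') := by rw [← col_mul, mul_inv_cancel_left]
  rw [e]
  ext i
  fin_cases i
  · change (g.1 *ᵥ col (g⁻¹ * g')) 0 = _
    rw [mulVec_zero', h0]
    change g 0 0 * (g⁻¹ * g') 0 0 + g 0 1 * 0 = (g⁻¹ * g') 0 0 * g 0 0
    ring
  · change (g.1 *ᵥ col (g⁻¹ * g')) 1 = _
    rw [mulVec_one', h0]
    change g 1 0 * (g⁻¹ * g') 0 0 + g 1 1 * 0 = (g⁻¹ * g') 0 0 * g 1 0
    ring

/-- Every line that contains an integral vector is spanned by the first column of a normalized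
matrix. -/
lemma exists_isNormalized {u : Fin 2 → QInt m} (hu : u ≠ 0) :
    ∃ (g : SL(2, ℂ)) (c : ℂ), IsNormalized m g ∧ embVec u = c • col g := by
  choose N hN using exists_nat_normSq (m := m)
  -- The norms are natural numbers, so the squared Euclidean length attains a minimum among the
  -- nonzero integral vectors of the line.
  let A : Set ℕ := {n | ∃ v : Fin 2 → QInt m, v ≠ 0 ∧ (∃ c : ℂ, embVec v = c • embVec u) ∧
    n = N (v 0) + N (v 1)}
  have hA : A.Nonempty := ⟨_, u, hu, ⟨1, (one_smul _ _).symm⟩, rfl⟩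
  obtain ⟨v, hv, ⟨c, hc⟩, hn⟩ := Nat.sInf_mem hA
  obtain ⟨g, hg⟩ := exists_col_eq (embVec_ne_zero hv)
  have hc0 : c ≠ 0 := by
    rintro rfl
    rw [zero_smul] at hc
    exact embVec_ne_zero hv hc
  refine ⟨g, c⁻¹, ⟨v, hg, fun d w hw hdw => ?_⟩, ?_⟩
  · have hmin : N (v 0) + N (v 1) ≤ N (w 0) + N (w 1) := by
      rw [← hn]
      exact Nat.sInf_le ⟨w, hw, ⟨d * c, by rw [hdw, hg, hc, smul_smul]⟩, rfl⟩
    have hmin' : (N (v 0) + N (v 1) : ℝ) ≤ N (w 0) + N (w 1) := by exact_mod_cast hmin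
    have e : ∀ i, (N (w i) : ℝ) = Complex.normSq d * N (v i) := by
      intro i
      have := congrFun hdw i
      rw [hg] at this
      rw [← hN, ← hN, ← Complex.normSq_mul]
      exact congrArg _ this
    rw [e, e, ← mul_add] at hmin'
    have hpos : (0 : ℝ) < N (v 0) + N (v 1) := by
      have h0 : (0 : ℝ) ≤ N (v 0) := Nat.cast_nonneg _
      have h1 : (0 : ℝ) ≤ N (v 1) := Nat.cast_nonneg _
      rcases (add_nonneg h0 h1).lt_or_eq with h | h
      · exact h
      · exfalso
        apply hv
        ext1 i
        have hz : (N (v i) : ℝ) = 0 := by fin_cases i <;> simp only [Fin.mk_zero, Fin.mk_one,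
          Fin.isValue] <;> linarith
        rw [← hN, Complex.normSq_eq_zero] at hz
        exact emb_eq_zero.1 hz
    by_contra! hlt
    nlinarith
  · rw [hg, hc, smul_smul, inv_mul_cancel₀ hc0, one_smul]

lemma exists_embVec_of_mem_ratPoints {D : Sphere} (hD : D ∈ ratPoints (imagQuad m)) :
    ∃ u : Fin 2 → QInt m, u ≠ 0 ∧ ∀ (g : SL(2, ℂ)) (c : ℂ), embVec u = c • col g →
      mob g ∞ = D := by
  rcases hD with rfl | ⟨k, rfl⟩
  · refine ⟨![1, 0], fun h => one_ne_zero (congrFun h 0), fun g c h => ?_⟩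
    have h0 : (1 : ℂ) = c * g 0 0 := by
      have := congrFun h 0
      simpa [embVec, col] using this
    have h1 : (0 : ℂ) = c * g 1 0 := by
      have := congrFun h 1
      simpa [embVec, col] using this
    have hc : c ≠ 0 := left_ne_zero_of_mul_eq_one h0.symm
    rw [mob_infty, if_pos ((mul_eq_zero.1 h1.symm).resolve_left hc)]
  · obtain ⟨a, b, hb, hk⟩ := IsFractionRing.div_surjective (QInt m) k
    have hb0 : b ≠ 0 := nonZeroDivisors.ne_zero hb
    have hb1 : emb m b ≠ 0 := by rwa [Ne, emb_eq_zero]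
    have hk' : (k : ℂ) = emb m a / emb m b := by rw [← hk]; rfl
    refine ⟨![a, b], fun h => hb0 (congrFun h 1), fun g c h => ?_⟩
    have h0 : emb m a = c * g 0 0 := congrFun h 0
    have h1 : emb m b = c * g 1 0 := congrFun h 1
    have hc : c ≠ 0 := by rintro rfl; rw [zero_mul] at h1; exact hb1 h1
    have hg : g 1 0 ≠ 0 := by intro h; rw [h, mul_zero] at h1; exact hb1 h1
    rw [mob_infty, if_neg hg, hk', h0, h1, mul_div_mul_left _ _ hc]

lemma exists_isNormalized_mob_eq {D : Sphere} (hD : D ∈ ratPoints (imagQuad m)) :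
    ∃ g : SL(2, ℂ), IsNormalized m g ∧ mob g ∞ = D := by
  obtain ⟨u, hu, h⟩ := exists_embVec_of_mem_ratPoints hD
  obtain ⟨g, c, hg, hc⟩ := exists_isNormalized hu
  exact ⟨g, hg, h g c hc⟩

lemma IsNormalized.smul {g : SL(2, ℂ)} (hg : IsNormalized m g) (γ : SL(2, QInt m)) :
    IsNormalized m (toSLC (imagQuad m) γ * g) := by
  obtain ⟨u, hu, h⟩ := hg
  refine ⟨γ.1 *ᵥ u, by rw [col_mul, hu, toSLC_mulVec], fun c v hv hcv => ?_⟩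
  refine h c (γ⁻¹.1 *ᵥ v) ?_ ?_
  · intro h0
    apply hv
    have : (γ * γ⁻¹).1 *ᵥ v = 0 := by
      rw [Matrix.SpecialLinearGroup.coe_mul, ← Matrix.mulVec_mulVec, h0, Matrix.mulVec_zero]
    simpa using this
  · rw [← toSLC_mulVec, hcv, map_inv, Matrix.mulVec_smul, ← col_mul, inv_mul_cancel_left]

/-- Each first column is an integral multiple of the other, so minimality bounds the modulus of the
factor from both sides. The horoballs therefore belong to the cusp and not to the matrix. -/
lemma IsNormalized.normSq_eq_one {g g' : SL(2, ℂ)} (hg : IsNormalized m g)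
    (hg' : IsNormalized m g') (h : mob g ∞ = mob g' ∞) :
    Complex.normSq ((g⁻¹ * g') 0 0) = 1 := by
  have hc := col_eq_smul_of_mob_eq h
  have h0 : (g⁻¹ * g') 0 0 ≠ 0 :=
    left_ne_zero_of_mul_eq_one (upper_mul_eq_one (mob_infty_eq_iff.1 h))
  obtain ⟨u, hu, h1⟩ := hg
  obtain ⟨u', hu', h1'⟩ := hg'
  have hne : ∀ {g : SL(2, ℂ)} {u : Fin 2 → QInt m}, col g = embVec u → u ≠ 0 := by
    rintro g u hu rfl
    apply col_ne_zero g
    rw [hu]; ext i; simp [embVec]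
  apply le_antisymm
  · have := h1' ((g⁻¹ * g') 0 0)⁻¹ u (hne hu) (by
      rw [hc, smul_smul, inv_mul_cancel₀ h0, one_smul, hu])
    rw [Complex.normSq_inv] at this
    exact (one_le_inv₀ (Complex.normSq_pos.2 h0)).1 this
  · exact h1 _ u' (hne hu') (by rw [← hu', hc])

/-- Distinct cusps mean linearly independent integral columns, whose determinant is a nonzero
integer of the field. This inequality is the disjointness of horoballs. -/
lemma IsNormalized.one_le_qf_mul_qf {g g' : SL(2, ℂ)} (hg : IsNormalized m g)
    (hg' : IsNormalized m g') (h : mob g ∞ ≠ mob g' ∞) (p : H3) :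
    1 ≤ qf p (col g) * qf p (col g') := by
  obtain ⟨u, hu, -⟩ := hg
  obtain ⟨u', hu', -⟩ := hg'
  rw [hu, hu']
  apply BS.one_le_qf_mul_qf
  intro h0
  apply h
  rw [mob_infty_eq_iff, inv_mul_one_zero, hu, hu']
  simpa [embVec] using congrArg (emb m) h0

lemma IsNormalized.min_le_qf {g : SL(2, ℂ)} (hg : IsNormalized m g) (p : H3) :
    min p.r (p.r)⁻¹ ≤ qf p (col g) := by
  obtain ⟨u, hu, -⟩ := hg
  rw [hu]
  apply BS.min_le_qf
  rintro rfl
  apply col_ne_zero g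
  rw [hu]; ext i; simp [embVec]

/-- Horoballs do not come close to a given point of hyperbolic space. -/
lemma exists_nhds_le_qf (m : ℕ) (p : H3) : ∃ V : Set H3, IsOpen V ∧ p ∈ V ∧ ∃ ε > 0, ∀ q ∈ V,
    ∀ g, IsNormalized m g → ε ≤ qf q (col g) := by
  have hc : Continuous fun q : H3 => min q.r (q.r)⁻¹ :=
    H3.continuous_r.min (H3.continuous_r.inv₀ fun q => q.r_pos.ne')
  have hp : 0 < min p.r (p.r)⁻¹ := lt_min p.r_pos (inv_pos.2 p.r_pos)
  refine ⟨{q | min p.r (p.r)⁻¹ / 2 < min q.r (q.r)⁻¹}, isOpen_lt continuous_const hc,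
    half_lt_self hp, _, half_pos hp, fun q hq g hg => ?_⟩
  exact (le_of_lt hq).trans (hg.min_le_qf q)

/-! ### Horoballs, separation and countability -/

namespace BorelSerre

variable (S : CuspSet (imagQuad m))

lemma snd_eq_qf {g : SL(2, ℂ)} (hg : mob g ∞ ∈ S.carrier) {x : ℂ × Set.Ici (0 : ℝ)} {p : H3}
    (h : chart S g hg x = incl S p) : (x.2 : ℝ) = qf p (col g) := by
  rw [(chart_eq_incl_iff S hg).1 h, toInvHeight_snd]

/-- Horoballs at different cusps are disjoint. -/
lemma mob_eq_of_chart_eq {g g' : SL(2, ℂ)} (hgn : IsNormalized m g) (hgn' : IsNormalized m g')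
    (hg : mob g ∞ ∈ S.carrier) (hg' : mob g' ∞ ∈ S.carrier) {x x' : ℂ × Set.Ici (0 : ℝ)}
    (h : chart S g hg x = chart S g' hg' x') (hx : (x.2 : ℝ) < 1) (hx' : (x'.2 : ℝ) < 1) :
    mob g ∞ = mob g' ∞ := by
  by_contra hne
  -- At an interior point the two inverse heights are values of the form whose product is at least
  -- 1; a boundary point determines its cusp.
  rcases snd_pos_or_eq_zero x' with h0 | h0
  · rw [chart_of_pos S hg' h0] at h
    have h1 := snd_eq_qf S hg h
    have h2 := snd_eq_qf S hg' (chart_of_pos S hg' h0)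
    have h3 := hgn.one_le_qf_mul_qf hgn' hne (g' • ofInvHeight x')
    rw [← h1, ← h2] at h3
    have h4 : (0 : ℝ) ≤ x.2 := x.2.2
    nlinarith
  · rw [chart_of_eq_zero S hg' h0] at h
    exact hne (mob_eq_of_chart_eq_bdry S hg h).1

lemma eq_upperAct_of_chart_eq {g g' : SL(2, ℂ)}
    (hg : mob g ∞ ∈ S.carrier) (hg' : mob g' ∞ ∈ S.carrier) {x x' : ℂ × Set.Ici (0 : ℝ)}
    (h : chart S g hg x = chart S g' hg' x') (hm : mob g ∞ = mob g' ∞) :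
    x = upperAct (g⁻¹ * g') x' := by
  apply chart_injective S hg
  rw [h, ← chart_mul S hg (mob_infty_eq_iff.1 hm) (by rwa [mul_inv_cancel_left])]
  simp only [mul_inv_cancel_left]

lemma snd_upperAct_of_isNormalized {g g' : SL(2, ℂ)} (hgn : IsNormalized m g)
    (hgn' : IsNormalized m g') (hm : mob g ∞ = mob g' ∞) (x : ℂ × Set.Ici (0 : ℝ)) :
    (upperAct (g⁻¹ * g') x).2 = x.2 := by
  ext
  change (x.2 : ℝ) / Complex.normSq ((g⁻¹ * g') 0 0) = x.2
  rw [hgn.normSq_eq_one hgn' hm, div_one]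

lemma exists_normalized_chart (b : BoundaryPoint S) : ∃ (g : SL(2, ℂ)) (hg : mob g ∞ ∈ S.carrier)
    (z : ℂ), IsNormalized m g ∧ mob g ∞ = b.cusp ∧
      chart S g hg (z, ⟨0, le_refl (0 : ℝ)⟩) = bdry S b := by
  obtain ⟨g, hgn, hg⟩ := exists_isNormalized_mob_eq (S.subset_rat b.cusp_mem)
  have hmem : mob g ∞ ∈ S.carrier := by rw [hg]; exact b.cusp_mem
  obtain ⟨z, hz⟩ := exists_chart_eq_bdry S hmem b hg
  exact ⟨g, hmem, z, hgn, hg, hz⟩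

/-- The part of the chart at `g` below a given inverse height. -/
def horo (g : SL(2, ℂ)) (hg : mob g ∞ ∈ S.carrier) (ε : ℝ) : Set (BorelSerre S) :=
  chart S g hg '' {x | (x.2 : ℝ) < ε}

lemma isOpen_horo (g : SL(2, ℂ)) (hg : mob g ∞ ∈ S.carrier) (ε : ℝ) : IsOpen (horo S g hg ε) :=
  (isOpenEmbedding_chart S hg).isOpenMap _
    (isOpen_lt (continuous_subtype_val.comp continuous_snd) continuous_const)

lemma bdry_mem_horo {g : SL(2, ℂ)} {hg : mob g ∞ ∈ S.carrier} {z : ℂ} {b : BoundaryPoint S}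
    (h : chart S g hg (z, ⟨0, le_refl (0 : ℝ)⟩) = bdry S b) {ε : ℝ} (hε : 0 < ε) :
    bdry S b ∈ horo S g hg ε :=
  ⟨_, by exact hε, h⟩

/-- Near p all normalized columns have form at least ε, while each translate of the horoball t < ε
at the cusp of b is again such a horoball. This gives Hausdorff separation, and also properness at
mixed pairs of points. -/
lemma exists_separation_incl_bdry (p : H3) (b : BoundaryPoint S) :
    ∃ U V : Set (BorelSerre S), IsOpen U ∧ IsOpen V ∧ incl S p ∈ U ∧ bdry S b ∈ V ∧
      ∀ γ : SL(2, QInt m), ∀ x ∈ V, γ • x ∉ U := by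
  obtain ⟨V, hV, hp, ε, hε, h⟩ := exists_nhds_le_qf m p
  obtain ⟨g, hg, z, hgn, -, hz⟩ := exists_normalized_chart S b
  refine ⟨incl S '' V, horo S g hg ε, (isOpenEmbedding_incl S).isOpenMap _ hV,
    isOpen_horo S g hg ε, ⟨p, hp, rfl⟩, bdry_mem_horo S hz hε, ?_⟩
  rintro γ _ ⟨x, hx, rfl⟩ ⟨q, hq, hqx⟩
  rw [smul_chart S γ hg (mob_mul_mem S γ hg)] at hqx
  have h1 := snd_eq_qf S _ hqx.symm
  have h2 := h q hq _ (hgn.smul γ)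
  have h3 : (x.2 : ℝ) < ε := hx
  linarith

instance : T2Space (BorelSerre S) where
  t2 := by
    have key : ∀ p b, ∃ U V : Set (BorelSerre S), IsOpen U ∧ IsOpen V ∧ incl S p ∈ U ∧
        bdry S b ∈ V ∧ Disjoint U V := by
      intro p b
      obtain ⟨U, V, hU, hV, hpU, hbV, h⟩ := exists_separation_incl_bdry S p b
      refine ⟨U, V, hU, hV, hpU, hbV, Set.disjoint_left.2 fun x hxU hxV => ?_⟩
      have := h 1 x hxV
      rw [one_smul] at this
      exact this hxU
    rintro (p | b) (q | c) hne
    · have hpq : p ≠ q := fun h => hne (by rw [h])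
      obtain ⟨U, V, hU, hV, hp, hq, hd⟩ := t2_separation hpq
      have ho := (isOpenEmbedding_incl S).isOpenMap
      exact ⟨_, _, ho _ hU, ho _ hV, ⟨p, hp, rfl⟩, ⟨q, hq, rfl⟩,
        (Set.disjoint_image_iff (incl_injective S)).2 hd⟩
    · exact key p c
    · obtain ⟨U, V, hU, hV, hp, hq, hd⟩ := key q b
      exact ⟨V, U, hV, hU, hq, hp, hd.symm⟩
    · obtain ⟨g, hg, z, hgn, hgb, hz⟩ := exists_normalized_chart S b
      obtain ⟨g', hg', z', hgn', hgc, hz'⟩ := exists_normalized_chart S c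
      by_cases hbc : b.cusp = c.cusp
      · obtain ⟨w, hw⟩ := exists_chart_eq_bdry S hg c (hgb.trans hbc)
        have hzw : ((z, ⟨0, le_refl (0 : ℝ)⟩) : ℂ × Set.Ici (0 : ℝ)) ≠
            (w, ⟨0, le_refl (0 : ℝ)⟩) := by
          intro h
          rw [h] at hz
          exact hne (hz.symm.trans hw)
        obtain ⟨U, V, hU, hV, hp, hq, hd⟩ := t2_separation hzw
        have ho := (isOpenEmbedding_chart S hg).isOpenMap
        exact ⟨_, _, ho _ hU, ho _ hV, ⟨_, hp, hz⟩, ⟨_, hq, hw⟩,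
          (Set.disjoint_image_iff (chart_injective S hg)).2 hd⟩
      -- Boundary points over different cusps are separated by the disjoint horoballs t < 1.
      · refine ⟨_, _, isOpen_horo S g hg 1, isOpen_horo S g' hg' 1, bdry_mem_horo S hz one_pos,
          bdry_mem_horo S hz' one_pos, Set.disjoint_left.2 ?_⟩
        rintro _ ⟨x, hx, rfl⟩ ⟨x', hx', h⟩
        have := mob_eq_of_chart_eq S hgn hgn' hg hg' h.symm hx hx'
        rw [hgb, hgc] at this
        exact hbc this

lemma eq_incl_or_eq_bdry (x : BorelSerre S) : (∃ p, x = incl S p) ∨ ∃ b, x = bdry S b := by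
  rcases x with p | b
  · exact Or.inl ⟨p, rfl⟩
  · exact Or.inr ⟨b, rfl⟩

instance : LocallyCompactSpace (BorelSerre S) := by
  have : WeaklyLocallyCompactSpace (BorelSerre S) := by
    have : LocallyCompactSpace (Set.Ici (0 : ℝ)) :=
      isClosed_Ici.isClosedEmbedding_subtypeVal.locallyCompactSpace
    refine ⟨fun x => ?_⟩
    rcases eq_incl_or_eq_bdry S x with ⟨p, rfl⟩ | ⟨b, rfl⟩
    · obtain ⟨C, hC, hp⟩ := exists_compact_mem_nhds p
      refine ⟨_, hC.image (continuous_incl S), ?_⟩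
      exact (isOpenEmbedding_incl S).isOpenMap.image_mem_nhds hp
    · obtain ⟨g, hg, z, -, -, hz⟩ := exists_normalized_chart S b
      obtain ⟨C, hC, hp⟩ :=
        exists_compact_mem_nhds ((z, ⟨0, le_refl (0 : ℝ)⟩) : ℂ × Set.Ici (0 : ℝ))
      refine ⟨_, hC.image (continuous_chart S hg), ?_⟩
      rw [← hz]
      exact (isOpenEmbedding_chart S hg).isOpenMap.image_mem_nhds hp
  infer_instance

lemma countable_carrier : Countable S.carrier := by
  have := countable_imagQuad m
  apply Set.Countable.to_subtype
  refine Set.Countable.mono (s₂ := {∞} ∪ Set.range fun k : imagQuad m => ((k : ℂ) : Sphere)) ?_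
    ((Set.countable_singleton _).union (Set.countable_range _))
  intro D hD
  rcases S.subset_rat hD with h | ⟨k, hk⟩
  · exact Or.inl h
  · exact Or.inr ⟨k, hk.symm⟩

/-- The field is countable, so hyperbolic space and one chart for each cusp form a countable open
cover. -/
instance : SecondCountableTopology (BorelSerre S) := by
  have := countable_carrier S
  choose g hgn hg using fun D : S.carrier => exists_isNormalized_mob_eq (S.subset_rat D.2)
  have hmem : ∀ D, mob (g D) ∞ ∈ S.carrier := fun D => by rw [hg]; exact D.2
  let U : Option S.carrier → Set (BorelSerre S) := fun o => match o with
    | none => Set.range (incl S)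
    | some D => Set.range (chart S (g D) (hmem D))
  have hU : ∀ o, IsOpen (U o) := by
    rintro (_ | D)
    · exact (isOpenEmbedding_incl S).isOpen_range
    · exact (isOpenEmbedding_chart S (hmem D)).isOpen_range
  have hsc : ∀ o, SecondCountableTopology (U o) := by
    rintro (_ | D)
    · exact (isOpenEmbedding_incl S).toIsEmbedding.toHomeomorph.symm.secondCountableTopology
    · exact (isOpenEmbedding_chart S (hmem D)).toIsEmbedding.toHomeomorph.symm.secondCountableTopology
  refine TopologicalSpace.secondCountableTopology_of_countable_cover hU
    (Set.eq_univ_of_forall fun x => Set.mem_iUnion.2 ?_)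
  rcases eq_incl_or_eq_bdry S x with ⟨p, rfl⟩ | ⟨b, rfl⟩
  · exact ⟨none, p, rfl⟩
  · obtain ⟨z, hz⟩ := exists_chart_eq_bdry S (hmem ⟨_, b.cusp_mem⟩) b (hg ⟨_, b.cusp_mem⟩)
    exact ⟨some ⟨_, b.cusp_mem⟩, _, hz⟩

end BorelSerre

end Normalized


/-! ### Properness of the action -/

section ProperAction

open Matrix

/-- A criterion for proper `Γ`-spaces. -/
lemma isProperSpace_of_locally_finite {Γ X : Type*} [Group Γ] [TopologicalSpace X] [MulAction Γ X]
    [T2Space X] [SecondCountableTopology X] [LocallyCompactSpace X] [ContinuousConstSMul Γ X]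
    (h : ∀ x y : X, ∃ U V : Set X, IsOpen U ∧ IsOpen V ∧ x ∈ U ∧ y ∈ V ∧
      {γ : Γ | ∃ a ∈ U, γ • a ∈ V}.Finite) : IsProperSpace Γ X := by
  let _ : TopologicalSpace Γ := ⊥
  have : DiscreteTopology Γ := ⟨rfl⟩
  have hpd : ProperlyDiscontinuousSMul Γ X := by
    -- The compact set C × L is covered by finitely many of the boxes U × V, each with finitely many
    -- returns.
    refine ⟨fun {C L} hC hL => ?_⟩
    choose U V hU hV hx hy hf using h
    obtain ⟨T, hT⟩ := (hC.prod hL).elim_finite_subcover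
      (fun p : X × X => U p.1 p.2 ×ˢ V p.1 p.2) (fun p => (hU _ _).prod (hV _ _))
      (fun p _ => Set.mem_iUnion.2 ⟨p, hx _ _, hy _ _⟩)
    refine (T.finite_toSet.biUnion fun p _ => hf p.1 p.2).subset ?_
    intro γ hγ
    obtain ⟨_, ⟨a, ha, rfl⟩, hb⟩ := hγ
    have h1 := hT (Set.mk_mem_prod ha hb)
    simp only [Set.mem_iUnion] at h1 ⊢
    obtain ⟨p, hp, hp1, hp2⟩ := h1
    exact ⟨p, hp, a, hp1, hp2⟩
  have hprop : ProperSMul Γ X := properlyDiscontinuousSMul_iff_properSMul.1 hpd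
  -- Properness makes the orbit space Hausdorff; it inherits second countability and local
  -- compactness, so Urysohn's theorem metrizes it.
  have : T2Space (Quotient (MulAction.orbitRel Γ X)) :=
    t2Space_quotient_mulAction_of_properSMul
  have : SecondCountableTopology (Quotient (MulAction.orbitRel Γ X)) :=
    ContinuousConstSMul.secondCountableTopology
  have : LocallyCompactSpace (Quotient (MulAction.orbitRel Γ X)) :=
    MulAction.isOpenQuotientMap_quotientMk.locallyCompactSpace
  exact ⟨TopologicalSpace.metrizableSpace_of_t3_secondCountable X,
    TopologicalSpace.metrizableSpace_of_t3_secondCountable _, hprop⟩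

variable {m : ℕ}

lemma continuous_qf (u : Fin 2 → ℂ) : Continuous fun p : H3 => qf p u := by
  have hz := H3.continuous_z
  have hr := H3.continuous_r
  unfold qf
  refine Continuous.div ?_ hr fun p => p.r_pos.ne'
  exact (Complex.continuous_normSq.comp (continuous_const.sub (continuous_const.mul hz))).add
    (continuous_const.mul (hr.pow 2))

lemma normSq_apply_le (p : H3) (u : Fin 2 → ℂ) (i : Fin 2) : Complex.normSq (u i) ≤
    qf p u * (p.r⁻¹ + 2 * p.r + 2 * Complex.normSq p.z * p.r⁻¹) := by
  have hr := p.r_pos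
  have h1 := normSq_snd_le p u
  have h0 := normSq_fst_le p u
  have hq := qf_nonneg p u
  have hz := Complex.normSq_nonneg p.z
  have h1' : Complex.normSq (u 1) ≤ qf p u * p.r⁻¹ := by
    rwa [← div_eq_mul_inv, le_div_iff₀ hr]
  have h2 : 0 ≤ qf p u * p.r⁻¹ := by positivity
  have h3 := mul_le_mul_of_nonneg_right h1' hz
  have h4 : 0 ≤ qf p u * p.r := by positivity
  have h5 : 0 ≤ qf p u * p.r⁻¹ * Complex.normSq p.z := by positivity
  fin_cases i
  · change Complex.normSq (u 0) ≤ _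
    linarith
  · change Complex.normSq (u 1) ≤ _
    linarith

/-- `SL₂(R)` acts properly discontinuously on hyperbolic space. -/
lemma finite_return_H3 (hm : Squarefree m) {C L : Set H3} (hC : IsCompact C) (hL : IsCompact L) :
    {γ : SL(2, QInt m) | ∃ p ∈ C, toSLC (imagQuad m) γ • p ∈ L}.Finite := by
  obtain ⟨B0, hB0⟩ := (hC.image (continuous_qf (Pi.single 0 1))).bddAbove
  obtain ⟨B1, hB1⟩ := (hC.image (continuous_qf (Pi.single 1 1))).bddAbove
  have hG : Continuous fun p : H3 => p.r⁻¹ + 2 * p.r + 2 * Complex.normSq p.z * p.r⁻¹ := by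
    have hr := H3.continuous_r
    have hi : Continuous fun p : H3 => p.r⁻¹ := hr.inv₀ fun p => p.r_pos.ne'
    have hz := Complex.continuous_normSq.comp H3.continuous_z
    exact (hi.add (continuous_const.mul hr)).add ((continuous_const.mul hz).mul hi)
  obtain ⟨G, hG⟩ := (hL.image hG).bddAbove
  refine (finite_SL_of_bounded hm ((|B0| + |B1|) * G)).subset ?_
  rintro γ ⟨p, hp, hpL⟩ i j
  set g := toSLC (imagQuad m) γ
  -- Column j of g is the image of the basis vector e_j. Its form at g • p equals that of e_j at p,
  -- which is bounded on C, and at points of L the form controls the entries.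
  have h1 : g i j = (g.1 *ᵥ Pi.single j 1) i := by simp
  have h2 := normSq_apply_le (g • p) (g.1 *ᵥ Pi.single j 1) i
  rw [qf_smul_mulVec, ← h1] at h2
  have h3 : qf p (Pi.single j 1) ≤ |B0| + |B1| := by
    have e0 : qf p (Pi.single 0 1) ≤ B0 := hB0 ⟨p, hp, rfl⟩
    have e1 : qf p (Pi.single 1 1) ≤ B1 := hB1 ⟨p, hp, rfl⟩
    have := le_abs_self B0
    have := le_abs_self B1
    have := abs_nonneg B0
    have := abs_nonneg B1
    fin_cases j
    · change qf p (Pi.single 0 1) ≤ _; linarith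
    · change qf p (Pi.single 1 1) ≤ _; linarith
  have h4 : (g • p).r⁻¹ + 2 * (g • p).r + 2 * Complex.normSq (g • p).z * (g • p).r⁻¹ ≤ G :=
    hG ⟨_, hpL, rfl⟩
  have h5 : 0 ≤ (g • p).r⁻¹ + 2 * (g • p).r + 2 * Complex.normSq (g • p).z * (g • p).r⁻¹ := by
    have := (g • p).r_pos
    have := Complex.normSq_nonneg (g • p).z
    positivity
  exact h2.trans (mul_le_mul h3 h4 h5 ((qf_nonneg _ _).trans h3))

namespace BorelSerre

variable (S : CuspSet (imagQuad m))

/-- By disjointness, a returning γ carries the horoball at b to the one at c, so γ = g' β g⁻¹ with β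
upper triangular. Normalization gives β diagonal entries of modulus one, and the bounded horizontal
coordinates bound its upper right entry; discreteness of SL₂(R) concludes. -/
lemma exists_finite_return_bdry (hm : Squarefree m) (b c : BoundaryPoint S) :
    ∃ U V : Set (BorelSerre S), IsOpen U ∧ IsOpen V ∧ bdry S b ∈ U ∧ bdry S c ∈ V ∧
      {γ : SL(2, QInt m) | ∃ a ∈ U, γ • a ∈ V}.Finite := by
  obtain ⟨g, hg, z, hgn, hgb, hz⟩ := exists_normalized_chart S b
  obtain ⟨g', hg', z', hgn', hgc, hz'⟩ := exists_normalized_chart S c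
  let N : ℂ → Set (ℂ × Set.Ici (0 : ℝ)) := fun z => {x | ‖x.1‖ < ‖z‖ + 1 ∧ (x.2 : ℝ) < 1}
  have hN : ∀ z, IsOpen (N z) := fun z =>
    (isOpen_lt (continuous_norm.comp continuous_fst) continuous_const).inter
      (isOpen_lt (continuous_subtype_val.comp continuous_snd) continuous_const)
  have hNz : ∀ z, ((z, ⟨0, le_refl (0 : ℝ)⟩) : ℂ × Set.Ici (0 : ℝ)) ∈ N z := fun z =>
    ⟨lt_add_one _, one_pos⟩
  refine ⟨chart S g hg '' N z, chart S g' hg' '' N z', (isOpenEmbedding_chart S hg).isOpenMap _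
    (hN z), (isOpenEmbedding_chart S hg').isOpenMap _ (hN z'), ⟨_, hNz z, hz⟩, ⟨_, hNz z', hz'⟩, ?_⟩
  set B : ℝ := ‖z‖ + ‖z'‖ + 2
  have hcpt : IsCompact ((fun M : Matrix (Fin 2) (Fin 2) ℂ => g'.1 * M * g⁻¹.1) ''
      Set.univ.pi fun _ : Fin 2 => Set.univ.pi fun _ : Fin 2 => Metric.closedBall (0 : ℂ) B) :=
    (isCompact_univ_pi fun _ => isCompact_univ_pi fun _ => isCompact_closedBall _ _).image
      ((continuous_const.matrix_mul continuous_id).matrix_mul continuous_const)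
  refine (finite_SL_of_isCompact hm hcpt).subset ?_
  rintro γ ⟨_, ⟨x, hx, rfl⟩, ⟨x', hx', h⟩⟩
  rw [smul_chart S γ hg (mob_mul_mem S γ hg)] at h
  set k := toSLC (imagQuad m) γ * g with hk
  have hkn : IsNormalized m k := hgn.smul γ
  have hmob := mob_eq_of_chart_eq S hgn' hkn hg' _ h hx'.2 hx.2
  have hup := eq_upperAct_of_chart_eq S hg' _ h hmob
  have hone := hgn'.normSq_eq_one hkn hmob
  have hb0 := mob_infty_eq_iff.1 hmob
  have hb1 := upper_mul_eq_one hb0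
  have hkb : toSLC (imagQuad m) γ = g' * (g'⁻¹ * k) * g⁻¹ := by
    rw [mul_inv_cancel_left, hk, mul_inv_cancel_right]
  set b := g'⁻¹ * k
  have n00 : ‖b 0 0‖ = 1 := by
    rw [Complex.normSq_eq_norm_sq] at hone
    exact (pow_eq_one_iff_of_nonneg (norm_nonneg _) two_ne_zero).1 hone
  have n11 : ‖b 1 1‖ = 1 := by
    have := congrArg norm hb1
    rwa [norm_mul, n00, one_mul, norm_one] at this
  have n01 : ‖b 0 1‖ ≤ B := by
    have e : b 0 0 * b 0 1 = x'.1 - b 0 0 ^ 2 * x.1 := by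
      have e' := congrArg Prod.fst hup
      change x'.1 = b 0 0 ^ 2 * x.1 + b 0 0 * b 0 1 at e'
      rw [e']; ring
    have e2 := congrArg norm e
    rw [norm_mul, n00, one_mul] at e2
    rw [e2]
    refine (norm_sub_le _ _).trans ?_
    rw [norm_mul, norm_pow, n00, one_pow, one_mul]
    have h1 : ‖x'.1‖ < ‖z'‖ + 1 := hx'.1
    have h2 : ‖x.1‖ < ‖z‖ + 1 := hx.1
    simp only [B]
    linarith
  have hB : 1 ≤ B := by
    have := norm_nonneg z
    have := norm_nonneg z'
    simp only [B]; linarith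
  refine ⟨b.1, ?_, by rw [hkb]; rfl⟩
  refine fun i _ j _ => mem_closedBall_zero_iff.2 ?_
  fin_cases i <;> fin_cases j
  · exact n00.trans_le hB
  · exact n01
  · change ‖b 1 0‖ ≤ B
    rw [hb0, norm_zero]; linarith
  · exact n11.trans_le hB

lemma exists_finite_return_SL (hm : Squarefree m) (x y : BorelSerre S) :
    ∃ U V : Set (BorelSerre S), IsOpen U ∧ IsOpen V ∧ x ∈ U ∧ y ∈ V ∧
      {γ : SL(2, QInt m) | ∃ a ∈ U, γ • a ∈ V}.Finite := by
  rcases eq_incl_or_eq_bdry S x with ⟨p, rfl⟩ | ⟨b, rfl⟩ <;>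
    rcases eq_incl_or_eq_bdry S y with ⟨q, rfl⟩ | ⟨c, rfl⟩
  · obtain ⟨C, hC, hp⟩ := exists_compact_mem_nhds p
    obtain ⟨L, hL, hq⟩ := exists_compact_mem_nhds q
    have ho := (isOpenEmbedding_incl S).isOpenMap
    refine ⟨_, _, ho _ isOpen_interior, ho _ isOpen_interior,
      ⟨p, mem_interior_iff_mem_nhds.2 hp, rfl⟩, ⟨q, mem_interior_iff_mem_nhds.2 hq, rfl⟩,
      (finite_return_H3 hm hC hL).subset ?_⟩
    rintro γ ⟨_, ⟨a, ha, rfl⟩, ⟨a', ha', h⟩⟩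
    refine ⟨a, interior_subset ha, ?_⟩
    rw [smul_incl] at h
    rw [← incl_injective S h]
    exact interior_subset ha'
  · obtain ⟨U, V, hU, hV, hp, hc, h⟩ := exists_separation_incl_bdry S p c
    refine ⟨U, V, hU, hV, hp, hc, Set.finite_empty.subset ?_⟩
    rintro γ ⟨a, ha, ha'⟩
    apply h γ⁻¹ _ ha'
    rwa [inv_smul_smul]
  · obtain ⟨U, V, hU, hV, hp, hc, h⟩ := exists_separation_incl_bdry S q b
    refine ⟨V, U, hV, hU, hc, hp, Set.finite_empty.subset ?_⟩
    rintro γ ⟨a, ha, ha'⟩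
    exact h γ a ha ha'
  · exact exists_finite_return_bdry S hm b c

instance : ContinuousConstSMul (PSL (imagQuad m)) (BorelSerre S) where
  continuous_const_smul γ := by
    induction γ using QuotientGroup.induction_on with
    | H γ => exact continuous_const_smul γ

lemma exists_finite_return (hm : Squarefree m) (x y : BorelSerre S) :
    ∃ U V : Set (BorelSerre S), IsOpen U ∧ IsOpen V ∧ x ∈ U ∧ y ∈ V ∧
      {γ : Bianchi m | ∃ a ∈ U, γ • a ∈ V}.Finite := by
  obtain ⟨U, V, hU, hV, hx, hy, hf⟩ := exists_finite_return_SL S hm x y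
  refine ⟨U, V, hU, hV, hx, hy, (hf.image (QuotientGroup.mk : _ → Bianchi m)).subset ?_⟩
  rintro γ ⟨a, ha, ha'⟩
  induction γ using QuotientGroup.induction_on with
  | H γ => exact ⟨γ, ⟨a, ha, ha'⟩, rfl⟩

lemma isProperSpace (hm : Squarefree m) : IsProperSpace (Bianchi m) (BorelSerre S) :=
  isProperSpace_of_locally_finite (exists_finite_return S hm)

/-- The lift of a partial Borel–Serre space to a larger universe is a proper space. -/
lemma isProperSpace_ulift (hm : Squarefree m) :
    IsProperSpace (Bianchi m) (ULift.{u} (BorelSerre S)) := by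
  have : LocallyCompactSpace (ULift.{u} (BorelSerre S)) :=
    Homeomorph.ulift.isClosedEmbedding.locallyCompactSpace
  have : SecondCountableTopology (ULift.{u} (BorelSerre S)) :=
    Homeomorph.ulift.secondCountableTopology
  have : ContinuousConstSMul (Bianchi m) (ULift.{u} (BorelSerre S)) :=
    ⟨fun γ => continuous_uliftUp.comp ((continuous_const_smul γ).comp continuous_uliftDown)⟩
  refine isProperSpace_of_locally_finite fun x y => ?_
  obtain ⟨U, V, hU, hV, hx, hy, hf⟩ := exists_finite_return S hm x.down y.down
  exact ⟨ULift.down ⁻¹' U, ULift.down ⁻¹' V, hU.preimage continuous_uliftDown,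
    hV.preimage continuous_uliftDown, hx, hy,
    hf.subset fun γ ⟨a, ha, ha'⟩ => ⟨a.down, ha, ha'⟩⟩

end BorelSerre

end ProperAction


/-! ### Reduction theory -/

section Reduction

open Matrix

variable {m : ℕ}

/-- The unipotent element of `SL₂(R)` that fixes an integral vector. -/
lemma exists_toSLC_mul_eq_mul_unip {g : SL(2, ℂ)} {u : Fin 2 → QInt m} (hu : col g = embVec u)
    (s : QInt m) : ∃ δ : SL(2, QInt m), toSLC (imagQuad m) δ * g = g * unip (emb m s) := by
  -- This is g n_s g⁻¹ written out; only the first column of g enters, so the matrix is integral.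
  set δ : SL(2, QInt m) := ⟨!![1 - s * u 0 * u 1, s * u 0 ^ 2; -(s * u 1 ^ 2), 1 + s * u 0 * u 1],
    by rw [Matrix.det_fin_two_of]; ring⟩ with hδ
  have h0 : emb m (u 0) = g 0 0 := (congrFun hu 0).symm
  have h1 : emb m (u 1) = g 1 0 := (congrFun hu 1).symm
  have d00 : toSLC (imagQuad m) δ 0 0 = 1 - emb m s * g 0 0 * g 1 0 := by
    rw [toSLC_apply, show δ 0 0 = 1 - s * u 0 * u 1 from rfl]; simp [h0, h1]
  have d01 : toSLC (imagQuad m) δ 0 1 = emb m s * g 0 0 ^ 2 := by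
    rw [toSLC_apply, show δ 0 1 = s * u 0 ^ 2 from rfl]; simp [h0]
  have d10 : toSLC (imagQuad m) δ 1 0 = -(emb m s * g 1 0 ^ 2) := by
    rw [toSLC_apply, show δ 1 0 = -(s * u 1 ^ 2) from rfl]; simp [h1]
  have d11 : toSLC (imagQuad m) δ 1 1 = 1 + emb m s * g 0 0 * g 1 0 := by
    rw [toSLC_apply, show δ 1 1 = 1 + s * u 0 * u 1 from rfl]; simp [h0, h1]
  have hd := det_eq g
  refine ⟨δ, ?_⟩
  ext i j
  fin_cases i <;> fin_cases j <;>
    simp [Matrix.mul_apply, Fin.sum_univ_two, coe_unip, d00, d01, d10, d11]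
  · ring
  · linear_combination (emb m s * g 0 0) * hd
  · ring
  · linear_combination (emb m s * g 1 0) * hd

/-- A compact fundamental domain for the lattice spanned by `1` and `√-m`. -/
def latticeBox (m : ℕ) : Set ℂ :=
  (fun x : ℝ × ℝ => (x.1 : ℂ) + x.2 * sqrtNeg m) '' Set.Icc 0 1 ×ˢ Set.Icc 0 1

lemma isCompact_latticeBox (m : ℕ) : IsCompact (latticeBox m) :=
  (isCompact_Icc.prod isCompact_Icc).image (by fun_prop)

lemma exists_add_mem_latticeBox (hm : Squarefree m) (z : ℂ) :
    ∃ s : QInt m, z + emb m s ∈ latticeBox m := by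
  obtain ⟨x, y, rfl⟩ := exists_real_coordinates hm z
  obtain ⟨w, hw⟩ := exists_emb_eq_sqrtNeg m
  refine ⟨-(⌊x⌋ : QInt m) - ⌊y⌋ * w, (Int.fract x, Int.fract y),
    ⟨⟨Int.fract_nonneg x, (Int.fract_lt_one x).le⟩,
      ⟨Int.fract_nonneg y, (Int.fract_lt_one y).le⟩⟩, ?_⟩
  simp only [map_sub, map_neg, map_mul, map_intCast, hw, Int.fract]
  push_cast
  ring

namespace BorelSerre

/-- The part of a chart over the lattice box below a given inverse height. -/
def siegel (g : SL(2, ℂ)) (hg : mob g ∞ ∈ (CuspSet.all (imagQuad m)).carrier) (B : ℝ) :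
    Set (HP m) :=
  chart _ g hg '' {x | x.1 ∈ latticeBox m ∧ (x.2 : ℝ) ≤ B}

lemma isCompact_siegel (g : SL(2, ℂ)) (hg : mob g ∞ ∈ (CuspSet.all (imagQuad m)).carrier)
    (B : ℝ) : IsCompact (siegel g hg B) := by
  refine IsCompact.image ?_ (continuous_chart _ hg)
  have h : IsCompact {t : Set.Ici (0 : ℝ) | (t : ℝ) ≤ B} := by
    rw [Topology.IsInducing.subtypeVal.isCompact_iff]
    convert isCompact_Icc (a := (0 : ℝ)) (b := B) using 1
    ext t
    constructor
    · rintro ⟨t, ht, rfl⟩; exact ⟨t.2, ht⟩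
    · rintro ⟨h0, h1⟩; exact ⟨⟨t, h0⟩, h1, rfl⟩
  exact (isCompact_latticeBox m).prod h

/-- Every point lies in a horoball of bounded inverse height. -/
lemma exists_isNormalized_chart_eq (hm : Squarefree m) (x : HP m) :
    ∃ (g : SL(2, ℂ)) (hg : mob g ∞ ∈ (CuspSet.all (imagQuad m)).carrier)
      (w : ℂ × Set.Ici (0 : ℝ)), IsNormalized m g ∧ (w.2 : ℝ) ≤ 5 * (1 + m) ∧
        chart _ g hg w = x := by
  rcases eq_incl_or_eq_bdry _ x with ⟨p, rfl⟩ | ⟨b, rfl⟩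
  · obtain ⟨u, hu, hq⟩ := exists_short_vector hm p
    obtain ⟨g, c, hgn, hc⟩ := exists_isNormalized hu
    have hg : mob g ∞ ∈ (CuspSet.all (imagQuad m)).carrier := by
      obtain ⟨v, hv, -⟩ := hgn
      change mob g ∞ ∈ ratPoints (imagQuad m)
      rw [mob_infty]
      split_ifs with h
      · exact Or.inl rfl
      · refine Or.inr ⟨⟨_, (imagQuad m).div_mem (emb_mem (v 0)) (emb_mem (v 1))⟩, ?_⟩
        have h0 : g 0 0 = emb m (v 0) := congrFun hv 0
        have h1 : g 1 0 = emb m (v 1) := congrFun hv 1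
        rw [h0, h1]
    refine ⟨g, hg, toInvHeight (g⁻¹ • p), hgn, ?_, (chart_eq_incl_iff _ hg).2 rfl⟩
    rw [toInvHeight_snd]
    obtain ⟨v, hv, hmin⟩ := hgn
    -- The short vector u is c times the normalized column and |c| ≥ 1, so the column is at least as
    -- short as u.
    have h1 := hmin c u hu hc
    rw [hc, qf_smul] at hq
    have h2 := qf_nonneg p (col g)
    nlinarith
  · obtain ⟨g, hg, z, hgn, -, hz⟩ := exists_normalized_chart _ b
    exact ⟨g, hg, _, hgn, by positivity, hz⟩

/-- The Bianchi group acts cocompactly on the Borel–Serre space. -/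
lemma isGCompact (hm : Squarefree m) : IsGCompact (Bianchi m) (HP m) := by
  obtain ⟨T, hT, hT0, hrep⟩ := exists_finite_line_representatives (R := QInt m)
  choose! g c hgn hc using fun (τ : Fin 2 → QInt m) (hτ : τ ≠ 0) => exists_isNormalized hτ
  let A : (Fin 2 → QInt m) → Set (HP m) := fun τ =>
    ⋃ h : mob (g τ) ∞ ∈ (CuspSet.all (imagQuad m)).carrier, siegel (g τ) h (5 * (1 + m))
  refine ⟨⋃ τ ∈ T, A τ, hT.isCompact_biUnion fun τ _ => isCompact_iUnion fun h =>
    isCompact_siegel _ h _, fun x => ?_⟩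
  obtain ⟨k, hk, w, hkn, hw, rfl⟩ := exists_isNormalized_chart_eq hm x
  obtain ⟨v, hv, hmin⟩ := id hkn
  have hv0 : v ≠ 0 := by
    rintro rfl
    apply col_ne_zero k
    rw [hv]; ext i; simp [embVec]
  obtain ⟨τ, hτ, γ, a, b, ha, hb, hab⟩ := hrep v hv0
  set G := toSLC (imagQuad m) γ * k with hG
  have hGn : IsNormalized m G := hkn.smul γ
  have hgτ := hgn τ (hT0 τ hτ)
  have hmob : mob (g τ) ∞ = mob G ∞ := by
    -- From a · γv = b · τ, and because τ is `c τ` times the first column of `g τ`, the first column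
    -- of G is this multiple of that of `g τ`.
    apply mob_eq_of_col_eq_smul (c := (emb m a)⁻¹ * emb m b * c τ)
    have h1 := congrArg embVec hab
    rw [embVec_smul, embVec_smul, ← toSLC_mulVec, ← hv, ← col_mul, hc τ (hT0 τ hτ)] at h1
    have ha' : emb m a ≠ 0 := by rwa [Ne, emb_eq_zero]
    rw [mul_assoc, ← smul_smul, ← smul_smul, ← h1, smul_smul, inv_mul_cancel₀ ha', one_smul]
  have hGm := mob_mul_mem (CuspSet.all (imagQuad m)) γ hk
  have hgm : mob (g τ) ∞ ∈ (CuspSet.all (imagQuad m)).carrier := by rw [hmob]; exact hGm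
  set w' := upperAct ((g τ)⁻¹ * G) w with hw'
  have h1 : γ • chart _ k hk w = chart _ (g τ) hgm w' := by
    rw [smul_chart _ γ hk hGm, ← chart_mul _ hgm (mob_infty_eq_iff.1 hmob)
      (by rwa [mul_inv_cancel_left])]
    simp only [mul_inv_cancel_left, hG]
  have h2 : (w'.2 : ℝ) = w.2 := by
    rw [hw', snd_upperAct_of_isNormalized hgτ hGn hmob]
  -- It remains to move the horizontal coordinate into the box by an integral unipotent element
  -- fixing the cusp; the inverse height stays the same.
  obtain ⟨s, hs⟩ := exists_add_mem_latticeBox hm w'.1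
  obtain ⟨uτ, huτ, -⟩ := id hgτ
  obtain ⟨δ, hδ⟩ := exists_toSLC_mul_eq_mul_unip huτ s
  have hun : unip (emb m s) 1 0 = 0 := rfl
  have h3 : δ • chart _ (g τ) hgm w' = chart _ (g τ) hgm (w'.1 + emb m s, w'.2) := by
    rw [smul_chart _ δ hgm (mob_mul_mem _ δ hgm)]
    simp only [hδ]
    rw [chart_mul _ hgm hun]
    congr 1
    have e0 : unip (emb m s) 0 0 = 1 := rfl
    have e1 : unip (emb m s) 0 1 = emb m s := rfl
    refine Prod.ext ?_ (Subtype.ext ?_)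
    · simp [upperAct, e0, e1]
    · simp [upperAct, e0]
  refine ⟨(QuotientGroup.mk (δ * γ) : Bianchi m)⁻¹, chart _ (g τ) hgm (w'.1 + emb m s, w'.2),
    Set.mem_biUnion hτ (Set.mem_iUnion.2 ⟨hgm, _, ⟨hs, by rw [h2]; exact hw⟩, rfl⟩), ?_⟩
  rw [inv_smul_eq_iff, mk_smul, mul_smul, h1, h3]

end BorelSerre

lemma IsGCompact.compactSpace_quotient {Γ X : Type*} [Group Γ] [TopologicalSpace X] [MulAction Γ X]
    (h : IsGCompact Γ X) : CompactSpace (Quotient (MulAction.orbitRel Γ X)) := by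
  obtain ⟨C, hC, hcov⟩ := h
  refine ⟨(hC.image (continuous_quotient_mk' (s := MulAction.orbitRel Γ X))).of_isClosed_subset
    isClosed_univ fun q _ => ?_⟩
  induction q using Quotient.inductionOn with
  | h y =>
    obtain ⟨γ, c, hc, rfl⟩ := hcov y
    exact ⟨c, hc, Quotient.sound ⟨γ⁻¹, inv_smul_smul γ c⟩⟩

end Reduction


/-! ### Pushing a partial Borel–Serre space into hyperbolic space -/

section Push

variable {m : ℕ}

namespace BorelSerre

variable (S : CuspSet (imagQuad m))

/-- The inverse height in a chart is raised to a given bound. -/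
def raise (s : unitInterval) (w : ℂ × Set.Ici (0 : ℝ)) : ℂ × Set.Ici (0 : ℝ) :=
  (w.1, ⟨max (w.2 : ℝ) ((s : ℝ) / 8), Set.mem_Ici.2 (le_max_of_le_left w.2.2)⟩)

lemma continuous_raise : Continuous fun p : unitInterval × (ℂ × Set.Ici (0 : ℝ)) =>
    raise p.1 p.2 := by
  unfold raise
  exact Continuous.prodMk (by fun_prop) (Continuous.subtype_mk (by fun_prop) _)

/-- The point lies in the open horoball of a normalized chart. -/
def IsDeep (x : BorelSerre S) : Prop :=
  ∃ (g : SL(2, ℂ)) (hg : mob g ∞ ∈ S.carrier) (w : ℂ × Set.Ici (0 : ℝ)),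
    IsNormalized m g ∧ (w.2 : ℝ) < 1 ∧ chart S g hg w = x

open scoped Classical in
/-- Points in a horoball are pushed along geodesics away from the cusp. -/
def push (s : unitInterval) (x : BorelSerre S) : BorelSerre S :=
  if h : IsDeep S x then chart S h.choose h.choose_spec.choose
    (raise s h.choose_spec.choose_spec.choose) else x

/-- The chosen normalized chart is irrelevant: since horoballs are disjoint the cusp is the same,
and the transition map preserves the inverse height and hence commutes with `raise`. -/
lemma push_chart {g : SL(2, ℂ)} (hg : mob g ∞ ∈ S.carrier) (hgn : IsNormalized m g)
    {w : ℂ × Set.Ici (0 : ℝ)} (hw : (w.2 : ℝ) < 1) (s : unitInterval) :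
    push S s (chart S g hg w) = chart S g hg (raise s w) := by
  have h : IsDeep S (chart S g hg w) := ⟨g, hg, w, hgn, hw, rfl⟩
  rw [push, dif_pos h]
  obtain ⟨hkn, hw', e⟩ := h.choose_spec.choose_spec.choose_spec
  set w' := h.choose_spec.choose_spec.choose
  have hmob := mob_eq_of_chart_eq S hgn hkn hg _ e.symm hw hw'
  have hup := eq_upperAct_of_chart_eq S hg _ e.symm hmob
  have e2 : raise s w = upperAct (g⁻¹ * h.choose) (raise s w') := by
    refine Prod.ext ?_ ?_
    · have h1 : w.1 = (upperAct (g⁻¹ * h.choose) w').1 := congrArg Prod.fst hup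
      exact h1
    · rw [snd_upperAct_of_isNormalized hgn hkn hmob]
      have : w.2 = w'.2 := by
        rw [hup, snd_upperAct_of_isNormalized hgn hkn hmob]
      simp only [raise, this]
  rw [e2, ← chart_mul S hg (mob_infty_eq_iff.1 hmob) (by
    rw [mul_inv_cancel_left]; exact h.choose_spec.choose)]
  simp only [mul_inv_cancel_left]

lemma push_of_not_isDeep {x : BorelSerre S} (h : ¬ IsDeep S x) (s : unitInterval) :
    push S s x = x := by rw [push, dif_neg h]

lemma IsDeep.smul {x : BorelSerre S} (h : IsDeep S x) (γ : SL(2, QInt m)) : IsDeep S (γ • x) := by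
  obtain ⟨g, hg, w, hgn, hw, rfl⟩ := h
  exact ⟨_, mob_mul_mem S γ hg, w, hgn.smul γ, hw, (smul_chart S γ hg _ w).symm⟩

lemma push_smul (s : unitInterval) (γ : SL(2, QInt m)) (x : BorelSerre S) :
    push S s (γ • x) = γ • push S s x := by
  by_cases h : IsDeep S x
  · obtain ⟨g, hg, w, hgn, hw, rfl⟩ := h
    rw [smul_chart S γ hg (mob_mul_mem S γ hg), push_chart S _ (hgn.smul γ) hw,
      push_chart S hg hgn hw, smul_chart S γ hg (mob_mul_mem S γ hg)]
  · have h' : ¬ IsDeep S (γ • x) := by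
      intro h'
      apply h
      have := h'.smul S γ⁻¹
      rwa [inv_smul_smul] at this
    rw [push_of_not_isDeep S h, push_of_not_isDeep S h']

lemma push_zero (x : BorelSerre S) : push S 0 x = x := by
  by_cases h : IsDeep S x
  · obtain ⟨g, hg, w, hgn, hw, rfl⟩ := h
    rw [push_chart S hg hgn hw]
    congr 1
    refine Prod.ext rfl (Subtype.ext ?_)
    have : (0 : ℝ) ≤ w.2 := w.2.2
    simp [raise, this]
  · exact push_of_not_isDeep S h 0

lemma isDeep_bdry (b : BoundaryPoint S) : IsDeep S (bdry S b) := by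
  obtain ⟨g, hg, z, hgn, -, hz⟩ := exists_normalized_chart S b
  exact ⟨g, hg, _, hgn, one_pos, hz⟩

lemma push_one_mem_range (x : BorelSerre S) : push S 1 x ∈ Set.range (incl S) := by
  by_cases h : IsDeep S x
  · obtain ⟨g, hg, w, hgn, hw, rfl⟩ := h
    rw [push_chart S hg hgn hw, chart_of_pos S hg (by simp [raise])]
    exact Set.mem_range_self _
  · rw [push_of_not_isDeep S h]
    rcases eq_incl_or_eq_bdry S x with ⟨p, rfl⟩ | ⟨b, rfl⟩
    · exact Set.mem_range_self _
    · exact absurd (isDeep_bdry S b) h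

/-- At a deep point the push is `raise` in an open chart. A point outside all horoballs has a
neighbourhood on which every push is the identity; the factor 4 in `qf_le_four_mul` is uniform in
the cusp, so infinitely many horoballs cause no difficulty. -/
lemma continuous_push : Continuous fun p : unitInterval × BorelSerre S => push S p.1 p.2 := by
  rw [continuous_iff_continuousAt]
  rintro ⟨s, x⟩
  by_cases h : IsDeep S x
  · obtain ⟨g, hg, w, hgn, hw, rfl⟩ := h
    have he : IsOpenEmbedding (Prod.map (id : unitInterval → unitInterval) (chart S g hg)) :=
      IsOpenEmbedding.id.prodMap (isOpenEmbedding_chart S hg)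
    refine (he.continuousAt_iff (x := (s, w))).1 ?_
    have hc : ContinuousAt (fun p : unitInterval × (ℂ × Set.Ici (0 : ℝ)) =>
        chart S g hg (raise p.1 p.2)) (s, w) :=
      ((continuous_chart S hg).comp continuous_raise).continuousAt
    refine hc.congr ?_
    have ho : IsOpen {p : unitInterval × (ℂ × Set.Ici (0 : ℝ)) | (p.2.2 : ℝ) < 1} :=
      isOpen_lt (by fun_prop) continuous_const
    filter_upwards [ho.mem_nhds hw] with p hp
    exact (push_chart S hg hgn hp p.1).symm
  · obtain ⟨p, rfl⟩ : ∃ p, x = incl S p := by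
      rcases eq_incl_or_eq_bdry S x with h' | ⟨b, rfl⟩
      · exact h'
      · exact absurd (isDeep_bdry S b) h
    let N : Set H3 := {q | Complex.normSq (q.z - p.z) < p.r ^ 2 / 4 ∧ 9 / 10 * p.r < q.r ∧
      q.r < 2 * p.r}
    have hN : IsOpen N :=
      (isOpen_lt (Complex.continuous_normSq.comp (H3.continuous_z.sub continuous_const))
        continuous_const).inter ((isOpen_lt continuous_const H3.continuous_r).inter
        (isOpen_lt H3.continuous_r continuous_const))
    have hp : p ∈ N := by
      have := p.r_pos
      refine ⟨?_, by linarith, by linarith⟩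
      rw [sub_self, map_zero]; positivity
    have hfix : ∀ q ∈ N, ∀ t, push S t (incl S q) = incl S q := by
      intro q hq t
      by_cases hd : IsDeep S (incl S q)
      · obtain ⟨g, hg, w, hgn, hw, hwq⟩ := hd
        rw [← hwq, push_chart S hg hgn hw]
        congr 1
        refine Prod.ext rfl (Subtype.ext (max_eq_left ?_))
        -- The form of the column is at least 1 at p, hence at least 1/4 at q, which exceeds every
        -- s/8.
        have h1 := qf_le_four_mul hq.1.le hq.2.1.le hq.2.2.le (col g)
        rw [← snd_eq_qf S hg hwq] at h1
        have h2 : 1 ≤ qf p (col g) := by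
          by_contra! hlt
          refine h ⟨g, hg, toInvHeight (g⁻¹ • p), hgn, ?_, (chart_eq_incl_iff S hg).2 rfl⟩
          rwa [toInvHeight_snd]
        have h3 := t.2.2
        linarith
      · exact push_of_not_isDeep S hd t
    have hsnd : ContinuousAt (fun q : unitInterval × BorelSerre S => q.2) (s, incl S p) :=
      continuous_snd.continuousAt
    refine hsnd.congr ?_
    have ho : IsOpen (incl S '' N) := (isOpenEmbedding_incl S).isOpenMap _ hN
    filter_upwards [(ho.preimage continuous_snd).mem_nhds ⟨p, hp, rfl⟩]
    rintro ⟨t, y⟩ ⟨q, hq, rfl⟩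
    exact (hfix q hq t).symm

lemma push_smul_psl (s : unitInterval) (γ : Bianchi m) (x : BorelSerre S) :
    push S s (γ • x) = γ • push S s x := by
  induction γ using QuotientGroup.induction_on with
  | H γ => exact push_smul S s γ x

/-- An equivariant map to a partial Borel–Serre space is homotopic to a map to hyperbolic space. -/
lemma exists_homotopic_incl {X : Type*} [TopologicalSpace X] [MulAction (Bianchi m) X]
    (f : C(X, BorelSerre S)) (hf : IsEquivariant (Bianchi m) f) :
    ∃ (f' : C(X, BorelSerre S)) (p : C(X, H3)), (∀ x, f' x = incl S (p x)) ∧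
      IsEquivariant (Bianchi m) f' ∧
      ContinuousMap.HomotopicWith f f' (fun h => IsEquivariant (Bianchi m) h) := by
  have hF : Continuous fun y : unitInterval × X => push S y.1 (f y.2) :=
    (continuous_push S).comp (continuous_fst.prodMk (f.continuous.comp continuous_snd))
  have hequiv : ∀ s : unitInterval, IsEquivariant (Bianchi m) fun x => push S s (f x) := by
    intro s γ x
    change push S s (f (γ • x)) = _
    rw [hf, push_smul_psl]
  let f' : C(X, BorelSerre S) :=
    ⟨fun x => push S 1 (f x), hF.comp (continuous_const.prodMk continuous_id)⟩
  choose p hp using fun x => push_one_mem_range S (f x)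
  have hpc : Continuous p := by
    rw [(isOpenEmbedding_incl S).isInducing.continuous_iff]
    have : incl S ∘ p = f' := funext hp
    rw [this]
    exact f'.continuous
  exact ⟨f', ⟨p, hpc⟩, fun x => (hp x).symm, hequiv 1,
    ⟨{ toFun := fun y => push S y.1 (f y.2)
       continuous_toFun := hF
       map_zero_left := fun x => push_zero S (f x)
       map_one_left := fun x => rfl
       prop' := fun t => hequiv t }⟩⟩

end BorelSerre

end Push


/-! ### Hyperbolic space as the space of positive definite Hermitian forms up to scaling -/

section Hermitian

open Matrix

/-- The positive definite Hermitian matrix of determinant one attached to a point. -/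
def herm (p : H3) : Matrix (Fin 2) (Fin 2) ℂ :=
  !![((Complex.normSq p.z + p.r ^ 2) / p.r : ℝ), p.z / p.r; star p.z / p.r, (p.r⁻¹ : ℝ)]

lemma continuous_herm : Continuous herm := by
  have hz := H3.continuous_z
  have hr := H3.continuous_r
  have hn := Complex.continuous_normSq.comp hz
  have h0 : ∀ p : H3, (p.r : ℂ) ≠ 0 := fun p => by exact_mod_cast p.r_pos.ne'
  have hrc : Continuous fun p : H3 => (p.r : ℂ) := Complex.continuous_ofReal.comp hr
  refine continuous_matrix fun i j => ?_
  fin_cases i <;> fin_cases j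
  · exact Complex.continuous_ofReal.comp ((hn.add (hr.pow 2)).div hr fun p => p.r_pos.ne')
  · exact hz.div hrc h0
  · exact (continuous_star.comp hz).div hrc h0
  · exact Complex.continuous_ofReal.comp (hr.inv₀ fun p => p.r_pos.ne')

lemma det_herm (p : H3) : (herm p).det = 1 := by
  have h0 : (p.r : ℂ) ≠ 0 := by exact_mod_cast p.r_pos.ne'
  rw [herm, Matrix.det_fin_two_of]
  push_cast
  rw [Complex.normSq_eq_conj_mul_self]
  field_simp
  simp
  ring

lemma posDef_self_mul_conjTranspose (g : SL(2, ℂ)) : (g.1 * g.1ᴴ).PosDef := by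
  refine PosDef.mul_conjTranspose_self _ ?_
  rw [Matrix.vecMul_injective_iff_isUnit, Matrix.isUnit_iff_isUnit_det]
  simp

lemma posDef_herm (p : H3) : (herm p).PosDef := by
  have hr := p.r_pos
  have hs : 0 < Real.sqrt p.r := Real.sqrt_pos.2 hr
  have hs0 : (Real.sqrt p.r : ℂ) ≠ 0 := by exact_mod_cast hs.ne'
  have hss : (Real.sqrt p.r : ℂ) * (Real.sqrt p.r : ℂ) = p.r := by
    exact_mod_cast Real.mul_self_sqrt hr.le
  -- The upper triangular matrix that carries the base point (0, 1) to p.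
  let k : SL(2, ℂ) := ⟨!![(Real.sqrt p.r : ℂ), p.z / (Real.sqrt p.r : ℂ);
    0, (Real.sqrt p.r : ℂ)⁻¹], by rw [Matrix.det_fin_two_of, mul_inv_cancel₀ hs0]; simp⟩
  have hk : herm p = k.1 * k.1ᴴ := by
    change _ = !![(Real.sqrt p.r : ℂ), p.z / (Real.sqrt p.r : ℂ); 0, (Real.sqrt p.r : ℂ)⁻¹] *
      !![(Real.sqrt p.r : ℂ), p.z / (Real.sqrt p.r : ℂ); 0, (Real.sqrt p.r : ℂ)⁻¹]ᴴ
    ext i j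
    fin_cases i <;> fin_cases j <;>
      simp [herm, Matrix.mul_apply, Fin.sum_univ_two, ← hss, Complex.normSq_eq_conj_mul_self]
    all_goals field_simp
    ring
  rw [hk]
  exact posDef_self_mul_conjTranspose k

lemma herm_smul (g : SL(2, ℂ)) (p : H3) : herm (g • p) = g.1 * herm p * g.1ᴴ := by
  have hr : (p.r : ℂ) ≠ 0 := by exact_mod_cast p.r_pos.ne'
  have hN : (H3.denom g p : ℂ) ≠ 0 := by exact_mod_cast (H3.denom_pos g p).ne'
  have h01 : herm (g • p) 0 1 = (g.1 * herm p * g.1ᴴ) 0 1 := by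
    change (g • p).z / (g • p).r = _
    rw [H3.smul_z, H3.smul_r]
    simp only [herm, Matrix.mul_apply, Fin.sum_univ_two, Matrix.conjTranspose_apply,
      Complex.normSq_eq_conj_mul_self, Complex.ofReal_div, Complex.ofReal_add, Complex.ofReal_inv,
      Complex.ofReal_pow, star_add, star_mul']
    simp
    field_simp
    ring
  have h11 : herm (g • p) 1 1 = (g.1 * herm p * g.1ᴴ) 1 1 := by
    change ((((g • p).r)⁻¹ : ℝ) : ℂ) = _
    rw [H3.smul_r, Complex.ofReal_inv, Complex.ofReal_div, H3.denom_coe]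
    simp only [herm, Matrix.mul_apply, Fin.sum_univ_two, Matrix.conjTranspose_apply,
      Complex.normSq_eq_conj_mul_self, Complex.ofReal_div, Complex.ofReal_add, Complex.ofReal_inv,
      Complex.ofReal_pow]
    simp
    field_simp
    ring
  have hH : (g.1 * herm p * g.1ᴴ).IsHermitian :=
    Matrix.isHermitian_mul_mul_conjTranspose _ (posDef_herm p).1
  have h10 : herm (g • p) 1 0 = (g.1 * herm p * g.1ᴴ) 1 0 := by
    rw [← (posDef_herm (g • p)).1.apply, ← hH.apply, h01]
  have hne : herm (g • p) 1 1 ≠ 0 := by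
    change (((g • p).r⁻¹ : ℝ) : ℂ) ≠ 0
    exact_mod_cast inv_ne_zero (g • p).r_pos.ne'
  -- Both sides have determinant one, and their other entries agree; a nonzero lower right entry
  -- leaves no choice for the last one.
  have h00 : herm (g • p) 0 0 = (g.1 * herm p * g.1ᴴ) 0 0 := by
    have h1 := det_herm (g • p)
    have h2 : (g.1 * herm p * g.1ᴴ).det = 1 := by simp [det_herm]
    rw [Matrix.det_fin_two] at h1 h2
    rw [← h01, ← h10, ← h11] at h2
    apply mul_right_cancel₀ hne
    linear_combination h1 - h2
  ext i j
  fin_cases i <;> fin_cases j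
  · exact h00
  · exact h01
  · exact h10
  · exact h11

/-- The point of hyperbolic space attached to a positive definite Hermitian matrix. -/
def ofHerm (A : Matrix (Fin 2) (Fin 2) ℂ) : H3 :=
  H3.mk (A 0 1 / A 1 1)
    -- The default 1 only makes the definition total; it is never taken at a positive definite
    -- matrix.
    (if 0 < Real.sqrt A.det.re / (A 1 1).re then Real.sqrt A.det.re / (A 1 1).re else 1) (by
      split_ifs with h
      · exact h
      · exact one_pos)

lemma sqrt_det_div_pos {A : Matrix (Fin 2) (Fin 2) ℂ} (hA : A.PosDef) :
    0 < Real.sqrt A.det.re / (A 1 1).re :=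
  div_pos (Real.sqrt_pos.2 (Complex.pos_iff.1 hA.det_pos).1) (Complex.pos_iff.1 hA.diag_pos).1

lemma ofHerm_r {A : Matrix (Fin 2) (Fin 2) ℂ} (hA : A.PosDef) :
    (ofHerm A).r = Real.sqrt A.det.re / (A 1 1).re := if_pos (sqrt_det_div_pos hA)

lemma continuous_ofHerm {X : Type*} [TopologicalSpace X] {A : X → Matrix (Fin 2) (Fin 2) ℂ}
    (hc : Continuous A) (hA : ∀ x, (A x).PosDef) : Continuous fun x => ofHerm (A x) := by
  have h11 : Continuous fun x => A x 1 1 := hc.matrix_elem 1 1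
  refine H3.continuous_of_z_r ?_ ?_
  · exact (hc.matrix_elem 0 1).div h11 fun x => (hA x).diag_pos.ne'
  · simp only [ofHerm_r (hA _)]
    refine Continuous.div ?_ (Complex.continuous_re.comp h11) fun x =>
      (Complex.pos_iff.1 (hA x).diag_pos).1.ne'
    exact Real.continuous_sqrt.comp (Complex.continuous_re.comp hc.matrix_det)

lemma ofHerm_smul_herm {c : ℝ} (hc : 0 < c) (p : H3) : ofHerm (c • herm p) = p := by
  have hr := p.r_pos
  have hr0 : (p.r : ℂ) ≠ 0 := by exact_mod_cast hr.ne'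
  have hc0 : (c : ℂ) ≠ 0 := by exact_mod_cast hc.ne'
  have hpd : (c • herm p).PosDef := (posDef_herm p).smul hc
  ext
  · change (c • herm p) 0 1 / (c • herm p) 1 1 = p.z
    simp [herm]
    field_simp
  · rw [ofHerm_r hpd]
    have h1 : (c • herm p).det = ((c ^ 2 : ℝ) : ℂ) := by
      have : c • herm p = (c : ℂ) • herm p := by ext; simp
      rw [this, Matrix.det_smul, det_herm]; simp
    have h2 : ((c • herm p) 1 1).re = c * p.r⁻¹ := by
      simp [herm]
    rw [h1, h2, Complex.ofReal_re, Real.sqrt_sq hc.le]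
    field_simp

lemma ofHerm_herm (p : H3) : ofHerm (herm p) = p := by
  have := ofHerm_smul_herm one_pos p
  rwa [one_smul] at this

/-- The scalar is the square root of the determinant. With `ofHerm_smul_herm` this identifies
hyperbolic space with positive definite matrices up to positive scaling. -/
lemma exists_eq_smul_herm {A : Matrix (Fin 2) (Fin 2) ℂ} (hA : A.PosDef) :
    ∃ c : ℝ, 0 < c ∧ A = c • herm (ofHerm A) := by
  have hd := Complex.pos_iff.1 hA.det_pos
  have h1 := Complex.pos_iff.1 (hA.diag_pos (i := 1))
  set s := Real.sqrt A.det.re with hs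
  have hs0 : 0 < s := Real.sqrt_pos.2 hd.1
  have hss : (s : ℂ) * s = A.det := by
    rw [← Complex.ofReal_mul, Real.mul_self_sqrt hd.1.le]
    exact Complex.ext rfl hd.2
  have hsne : (s : ℂ) ≠ 0 := by exact_mod_cast hs0.ne'
  set d := (A 1 1).re with hdd
  have e11 : A 1 1 = d := (Complex.ext rfl h1.2.symm)
  have hdne : (d : ℂ) ≠ 0 := by exact_mod_cast h1.1.ne'
  have hr : (ofHerm A).r = s / d := ofHerm_r hA
  have hz : (ofHerm A).z = A 0 1 / d := by
    change A 0 1 / A 1 1 = _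
    rw [e11]
  have h10 : A 1 0 = star (A 0 1) := (hA.1.apply 1 0).symm
  have hdet : (s : ℂ) * s = A 0 0 * d - A 0 1 * star (A 0 1) := by
    rw [hss, Matrix.det_fin_two, h10, e11]
  refine ⟨s, hs0, ?_⟩
  ext i j
  fin_cases i <;> fin_cases j
  · simp [herm, hr, hz, Complex.normSq_eq_conj_mul_self]
    field_simp
    simp only [Complex.star_def] at hdet
    linear_combination -hdet
  · simp [herm, hr, hz]
    field_simp
  · simp [herm, hr, hz, h10]
    field_simp
  · simp [herm, hr, e11]
    field_simp

lemma ofHerm_conj (g : SL(2, ℂ)) {A : Matrix (Fin 2) (Fin 2) ℂ} (hA : A.PosDef) :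
    ofHerm (g.1 * A * g.1ᴴ) = g • ofHerm A := by
  obtain ⟨c, hc, h⟩ := exists_eq_smul_herm hA
  conv_lhs => rw [h]
  rw [Matrix.mul_smul, Matrix.smul_mul, ← herm_smul, ofHerm_smul_herm hc]

/-- The geodesic segment between two points. -/
def segment (t : unitInterval) (p q : H3) : H3 :=
  ofHerm ((1 - t : ℝ) • herm p + (t : ℝ) • herm q)

lemma posDef_segment (t : unitInterval) (p q : H3) :
    ((1 - t : ℝ) • herm p + (t : ℝ) • herm q).PosDef := by
  rcases t.2.1.lt_or_eq with h | h
  · exact PosDef.posSemidef_add ((posDef_herm p).posSemidef.smul (sub_nonneg.2 t.2.2))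
      ((posDef_herm q).smul h)
  · rw [← h]; simpa using posDef_herm p

lemma continuous_segment {Y : Type*} [TopologicalSpace Y] {a : Y → unitInterval} {p q : Y → H3}
    (ha : Continuous a) (hp : Continuous p) (hq : Continuous q) :
    Continuous fun y => segment (a y) (p y) (q y) :=
  continuous_ofHerm (((continuous_const.sub (continuous_subtype_val.comp ha)).smul
    (continuous_herm.comp hp)).add ((continuous_subtype_val.comp ha).smul
    (continuous_herm.comp hq))) fun x => posDef_segment (a x) (p x) (q x)

lemma segment_zero (p q : H3) : segment 0 p q = p := by simp [segment, ofHerm_herm]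

lemma segment_one (p q : H3) : segment 1 p q = q := by simp [segment, ofHerm_herm]

/-- Equivariance holds because A ↦ gAg* is linear and so respects convex combinations. -/
lemma segment_smul (t : unitInterval) (g : SL(2, ℂ)) (p q : H3) :
    segment t (g • p) (g • q) = g • segment t p q := by
  rw [segment, segment, ← ofHerm_conj g (posDef_segment t p q), herm_smul, herm_smul]
  simp only [Matrix.mul_add, Matrix.add_mul, Matrix.mul_smul, Matrix.smul_mul]

end Hermitian


/-! ### Cut-off functions on proper spaces -/

section Cutoff

variable {Γ : Type*} [Group Γ] {X : Type*} [TopologicalSpace X] [MulAction Γ X]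

/-- The stabiliser of x is finite. The pairs (γy, y) with γ outside it form a closed set missing (x,
x), so some U × U avoids that set. -/
lemma IsProperSpace.exists_nhds_finite (h : IsProperSpace Γ X) (x : X) :
    ∃ U ∈ 𝓝 x, {γ : Γ | ∃ y ∈ U, γ • y ∈ U}.Finite := by
  have := h.metrizable
  have hfin : {γ : Γ | γ • x = x}.Finite :=
    (h.finite_return (isCompact_singleton (x := x)) (isCompact_singleton (x := x))).subset
      fun γ hγ => ⟨x, rfl, hγ⟩
  let _ : TopologicalSpace Γ := ⊥
  have : DiscreteTopology Γ := ⟨rfl⟩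
  have := h.proper
  have hcl := (ProperSMul.isProperMap_smul_pair (G := Γ) (X := X)).isClosedMap
    ({γ : Γ | γ • x = x}ᶜ ×ˢ Set.univ) ((isClosed_discrete _).prod isClosed_univ)
  have hx : (x, x) ∉ (fun gx : Γ × X => (gx.1 • gx.2, gx.2)) ''
      ({γ : Γ | γ • x = x}ᶜ ×ˢ Set.univ) := by
    rintro ⟨⟨γ, y⟩, ⟨hγ, -⟩, hy⟩
    obtain ⟨h1, rfl⟩ := Prod.mk.inj hy
    exact hγ h1
  have hN := hcl.isOpen_compl.mem_nhds hx
  rw [nhds_prod_eq] at hN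
  obtain ⟨U, hU, hUN⟩ := Filter.mem_prod_self_iff.1 hN
  refine ⟨U, hU, hfin.subset ?_⟩
  rintro γ ⟨y, hy, hγy⟩
  by_contra hγ
  exact hUN (Set.mk_mem_prod hγy hy) ⟨(γ, y), ⟨hγ, trivial⟩, rfl⟩

/-- A proper space carries a cut-off function: a nonnegative function whose translates are locally
finite and have no common zero. -/
lemma IsProperSpace.exists_cutoff (h : IsProperSpace Γ X) :
    ∃ ψ : X → ℝ, Continuous ψ ∧ (∀ x, 0 ≤ ψ x) ∧ (∀ x, ∃ γ : Γ, 0 < ψ (γ⁻¹ • x)) ∧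
      ∀ x, ∃ V ∈ 𝓝 x, {γ : Γ | ∃ y ∈ V, ψ (γ⁻¹ • y) ≠ 0}.Finite := by
  have := h.metrizable
  have := h.quotient_metrizable
  let _ : MetricSpace X := TopologicalSpace.metrizableSpaceMetric X
  let Q := Quotient (MulAction.orbitRel Γ X)
  let _ : MetricSpace Q := TopologicalSpace.metrizableSpaceMetric Q
  have hcs : ContinuousConstSMul Γ X := ⟨h.continuous_smul⟩
  let π : X → Q := Quotient.mk _
  have hπo : IsOpenMap π := isOpenMap_quotient_mk'_mul
  have hπc : Continuous π := continuous_quotient_mk'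
  have hπ : ∀ (γ : Γ) (x : X), π (γ • x) = π x := fun γ x => Quotient.sound ⟨γ, rfl⟩
  have hex : ∀ x : X, ∃ ε > 0,
      {γ : Γ | ∃ y ∈ Metric.ball x ε, γ • y ∈ Metric.ball x ε}.Finite := by
    intro x
    obtain ⟨U, hU, hfin⟩ := h.exists_nhds_finite x
    obtain ⟨ε, hε, hεU⟩ := Metric.mem_nhds_iff.1 hU
    exact ⟨ε, hε, hfin.subset fun γ ⟨y, hy, hγ⟩ => ⟨y, hεU hy, hεU hγ⟩⟩
  choose ε hε hfin using hex
  -- The metrizable orbit space is paracompact. A partition of unity there provides local finiteness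
  -- across orbits; the bumps u below cut each orbit down to the small balls.
  obtain ⟨ρ, hρ⟩ := PartitionOfUnity.exists_isSubordinate (X := Q) isClosed_univ
    (fun x : X => π '' Metric.ball x (ε x)) (fun x => hπo _ Metric.isOpen_ball) (by
      intro q _
      obtain ⟨x, rfl⟩ := Quotient.exists_rep q
      exact Set.mem_iUnion.2 ⟨x, x, Metric.mem_ball_self (hε x), rfl⟩)
  let u : X → X → ℝ := fun x y => max 0 (ε x - dist y x)
  have hu0 : ∀ x y, 0 ≤ u x y := fun x y => le_max_left _ _
  have hu : ∀ x y, u x y ≠ 0 → y ∈ Metric.ball x (ε x) := by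
    intro x y hxy
    by_contra hy
    exact hxy (max_eq_left (by simpa using hy))
  have hlf : LocallyFinite fun x : X => Function.support fun y => ρ x (π y) * u x y :=
    (ρ.locallyFinite.preimage_continuous hπc).subset fun x y hy => left_ne_zero_of_mul hy
  have hnn : ∀ x y, 0 ≤ ρ x (π y) * u x y := fun x y => mul_nonneg (ρ.nonneg x _) (hu0 x y)
  have hpf : ∀ y, (Function.support fun x => ρ x (π y) * u x y).Finite := fun y =>
    hlf.point_finite y
  refine ⟨fun y => ∑ᶠ x, ρ x (π y) * u x y, continuous_finsum (fun x => ?_) hlf,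
    fun y => finsum_nonneg fun x => hnn x y, fun y => ?_, fun y => ?_⟩
  · exact ((ρ x).continuous.comp hπc).mul (by fun_prop)
  -- If ρ x is positive at the orbit of y, that orbit meets the ball about x, where the bump is
  -- positive.
  · obtain ⟨x, hx⟩ := ρ.exists_pos (Set.mem_univ (π y))
    obtain ⟨y', hy', hyy⟩ := hρ x (subset_closure (by exact hx.ne' : π y ∈ Function.support (ρ x)))
    obtain ⟨γ, hγ⟩ : y' ∈ MulAction.orbit Γ y := Quotient.exact hyy
    refine ⟨γ⁻¹, ?_⟩
    have hγ' : γ • y = y' := hγ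
    rw [inv_inv, hγ']
    refine finsum_pos (fun x => hnn x y') ⟨x, ?_⟩ (hpf y')
    rw [hyy]
    exact mul_pos hx (lt_max_of_lt_right (sub_pos.2 hy'))
  -- Each summand is treated separately; near y only finitely many contribute, since the ρ x are
  -- locally finite on the orbit space.
  · have hV : ∀ x, ∃ V ∈ 𝓝 y, {γ : Γ | ∃ z ∈ V, ρ x (π z) * u x (γ⁻¹ • z) ≠ 0}.Finite := by
      intro x
      by_cases hyx : π y ∈ π '' Metric.ball x (ε x)
      · obtain ⟨y', hy', hyy⟩ := hyx
        obtain ⟨δ, hδ⟩ : y' ∈ MulAction.orbit Γ y := Quotient.exact hyy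
        have hδ' : δ • y = y' := hδ
        refine ⟨(fun z => δ • z) ⁻¹' Metric.ball x (ε x), ?_, ?_⟩
        · refine (Metric.isOpen_ball.preimage (h.continuous_smul δ)).mem_nhds ?_
          change δ • y ∈ Metric.ball x (ε x)
          rwa [hδ']
        · refine ((hfin x).image fun γ => δ⁻¹ * γ⁻¹).subset ?_
          rintro γ ⟨z, hz, hne⟩
          -- This element moves δz to γ⁻¹z, and both lie in the ball about x, so it is one of
          -- finitely many.
          refine ⟨γ⁻¹ * δ⁻¹, ⟨δ • z, hz, ?_⟩, by group⟩
          rw [mul_smul, inv_smul_smul]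
          exact hu _ _ (right_ne_zero_of_mul hne)
      · refine ⟨π ⁻¹' (tsupport (ρ x))ᶜ,
          ((isClosed_tsupport _).isOpen_compl.preimage hπc).mem_nhds fun hy => hyx (hρ x hy), ?_⟩
        convert Set.finite_empty
        ext γ
        simp only [Set.mem_ofPred_eq, Set.mem_empty_iff_false, iff_false]
        rintro ⟨z, hz, hne⟩
        exact hz (subset_closure (left_ne_zero_of_mul hne))
    choose V hV hVfin using hV
    obtain ⟨N, hN, hNfin⟩ := ρ.locallyFinite (π y)
    refine ⟨π ⁻¹' N ∩ ⋂ x ∈ {x | (Function.support (ρ x) ∩ N).Nonempty}, V x,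
      inter_mem (hπc.continuousAt hN) ((biInter_mem hNfin).2 fun x _ => hV x),
      (hNfin.biUnion fun x _ => hVfin x).subset ?_⟩
    rintro γ ⟨z, ⟨hzN, hzV⟩, hne⟩
    obtain ⟨x, hx⟩ : ∃ x, ρ x (π (γ⁻¹ • z)) * u x (γ⁻¹ • z) ≠ 0 := by
      by_contra! h0
      exact hne (finsum_eq_zero_of_forall_eq_zero h0)
    simp only [hπ] at hx
    have hxN : (Function.support (ρ x) ∩ N).Nonempty := ⟨π z, left_ne_zero_of_mul hx, hzN⟩
    exact Set.mem_biUnion hxN ⟨z, Set.mem_iInter₂.1 hzV x hxN, hx⟩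

end Cutoff

/-! ### Universality -/

section Universal

open Matrix

variable {m : ℕ} {X : Type*} [TopologicalSpace X] [MulAction (Bianchi m) X]

/-- The fibres are cosets of the centre, a group of roots of unity in a domain and hence finite. -/
lemma finite_preimage_mk {s : Set (Bianchi m)} (hs : s.Finite) :
    ((QuotientGroup.mk : SL(2, QInt m) → Bianchi m) ⁻¹' s).Finite := by
  have : NeZero (max (Fintype.card (Fin 2)) 1) := ⟨by simp⟩
  have hfin : Finite (Subgroup.center SL(2, QInt m)) :=
    Finite.of_equiv _ (Matrix.SpecialLinearGroup.center_equiv_rootsOfUnity).symm.toEquiv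
  refine hs.preimage' fun b _ => ?_
  obtain ⟨γ, rfl⟩ := QuotientGroup.mk_surjective b
  refine ((Set.toFinite (Subgroup.center SL(2, QInt m) : Set SL(2, QInt m))).image
    fun c => γ * c).subset ?_
  intro δ hδ
  exact ⟨γ⁻¹ * δ, QuotientGroup.eq.1 (Eq.symm hδ), mul_inv_cancel_left γ δ⟩

/-- Every proper space of the Bianchi group maps equivariantly to hyperbolic space. -/
lemma exists_equivariant_H3 (hX : IsProperSpace (Bianchi m) X) :
    ∃ p : C(X, H3), ∀ (γ : SL(2, QInt m)) (x : X),
      p ((QuotientGroup.mk γ : Bianchi m) • x) = toSLC _ γ • p x := by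
  classical
  obtain ⟨ψ, hψc, hψ0, hψpos, hψfin⟩ := hX.exists_cutoff
  -- The matrix γγ* represents the translate by γ of the base point (0, 1), so the sum over γ is a
  -- weighted barycentre of its orbit.
  let T : SL(2, QInt m) → X → Matrix (Fin 2) (Fin 2) ℂ := fun γ x =>
    ψ ((QuotientGroup.mk γ : Bianchi m)⁻¹ • x) • ((toSLC _ γ).1 * (toSLC _ γ).1ᴴ)
  have hT0 : ∀ γ x, T γ x ≠ 0 → ψ ((QuotientGroup.mk γ : Bianchi m)⁻¹ • x) ≠ 0 :=
    fun γ x h h0 => h (by simp [T, h0])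
  have hlf : LocallyFinite fun γ => Function.support (T γ) := by
    intro x
    obtain ⟨V, hV, hfin⟩ := hψfin x
    refine ⟨V, hV, (finite_preimage_mk hfin).subset ?_⟩
    rintro γ ⟨y, hy, hyV⟩
    exact ⟨y, hyV, hT0 γ y hy⟩
  have hpf : ∀ x, (Function.support fun γ => T γ x).Finite := fun x => hlf.point_finite x
  let A : X → Matrix (Fin 2) (Fin 2) ℂ := fun x => ∑ᶠ γ, T γ x
  have hAc : Continuous A := by
    refine continuous_finsum (fun γ => ?_) hlf
    exact (hψc.comp (hX.continuous_smul _)).smul continuous_const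
  have hApos : ∀ x, (A x).PosDef := by
    intro x
    obtain ⟨b, hb⟩ := hψpos x
    obtain ⟨γ, rfl⟩ := QuotientGroup.mk_surjective b
    have hpd : (T γ x).PosDef := (posDef_self_mul_conjTranspose (toSLC _ γ)).smul hb
    have hγ : γ ∈ (hpf x).toFinset := by
      rw [Set.Finite.mem_toFinset, Function.mem_support]
      intro h0
      have := hpd.det_pos
      rw [h0] at this
      simp at this
    change (∑ᶠ γ, T γ x).PosDef
    rw [finsum_eq_sum _ (hpf x), ← Finset.add_sum_erase _ _ hγ]
    exact hpd.add_posSemidef (posSemidef_sum _ fun δ _ =>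
      (posDef_self_mul_conjTranspose (toSLC _ δ)).posSemidef.smul (hψ0 _))
  have hAeq : ∀ (δ : SL(2, QInt m)) (x : X), A ((QuotientGroup.mk δ : Bianchi m) • x) =
      (toSLC _ δ).1 * A x * (toSLC _ δ).1ᴴ := by
    intro δ x
    let L : Matrix (Fin 2) (Fin 2) ℂ →+ Matrix (Fin 2) (Fin 2) ℂ :=
      (AddMonoidHom.mulRight (toSLC _ δ).1ᴴ).comp (AddMonoidHom.mulLeft (toSLC _ δ).1)
    change (∑ᶠ γ, T γ _) = L (∑ᶠ γ, T γ x)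
    -- Equivariance is the substitution γ ↦ δγ in the sum.
    rw [L.map_finsum (hpf x), ← finsum_comp_equiv (Equiv.mulLeft δ)]
    refine finsum_congr fun γ => ?_
    change ψ ((QuotientGroup.mk (δ * γ) : Bianchi m)⁻¹ • (QuotientGroup.mk δ : Bianchi m) • x) •
      ((toSLC _ (δ * γ)).1 * (toSLC _ (δ * γ)).1ᴴ) = (toSLC _ δ).1 * T γ x * (toSLC _ δ).1ᴴ
    rw [QuotientGroup.mk_mul, _root_.mul_inv_rev, mul_smul, inv_smul_smul, map_mul]
    simp only [T, Matrix.mul_smul, Matrix.smul_mul, Matrix.SpecialLinearGroup.coe_mul,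
      Matrix.conjTranspose_mul, Matrix.mul_assoc]
  refine ⟨⟨fun x => ofHerm (A x), continuous_ofHerm hAc hApos⟩, fun γ x => ?_⟩
  change ofHerm (A _) = _ • ofHerm (A x)
  rw [hAeq, ofHerm_conj _ (hApos x)]

namespace BorelSerre

variable (S : CuspSet (imagQuad m))

lemma exists_equivariant (hX : IsProperSpace (Bianchi m) X) :
    ∃ f : C(X, BorelSerre S), IsEquivariant (Bianchi m) f := by
  obtain ⟨p, hp⟩ := exists_equivariant_H3 hX
  refine ⟨⟨fun x => incl S (p x), (continuous_incl S).comp p.continuous⟩, fun γ x => ?_⟩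
  induction γ using QuotientGroup.induction_on with
  | H γ => exact congrArg (incl S) (hp γ x)

lemma homotopicWith_of_incl {f₀ f₁ : C(X, BorelSerre S)} (p₀ p₁ : C(X, H3))
    (h₀ : ∀ x, f₀ x = incl S (p₀ x)) (h₁ : ∀ x, f₁ x = incl S (p₁ x))
    (hf₀ : IsEquivariant (Bianchi m) f₀) (hf₁ : IsEquivariant (Bianchi m) f₁) :
    ContinuousMap.HomotopicWith f₀ f₁ (fun h => IsEquivariant (Bianchi m) h) := by
  have key : ∀ (p : C(X, H3)) (f : C(X, BorelSerre S)), (∀ x, f x = incl S (p x)) →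
      IsEquivariant (Bianchi m) f → ∀ (γ : SL(2, QInt m)) (x : X),
      p ((QuotientGroup.mk γ : Bianchi m) • x) = toSLC _ γ • p x := by
    intro p f h hf γ x
    apply incl_injective S
    rw [← h, hf, h]
    rfl
  have hequiv : ∀ t : unitInterval,
      IsEquivariant (Bianchi m) fun x => incl S (segment t (p₀ x) (p₁ x)) := by
    intro t b x
    obtain ⟨γ, rfl⟩ := QuotientGroup.mk_surjective b
    refine (congrArg (incl S) ?_ : _ = incl S (toSLC _ γ • segment t (p₀ x) (p₁ x)))
    rw [key p₀ f₀ h₀ hf₀, key p₁ f₁ h₁ hf₁, segment_smul]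
  have hc : Continuous fun y : unitInterval × X => incl S (segment y.1 (p₀ y.2) (p₁ y.2)) :=
    (continuous_incl S).comp (continuous_segment continuous_fst
      (p₀.continuous.comp continuous_snd) (p₁.continuous.comp continuous_snd))
  exact ⟨{
    toFun := fun y => incl S (segment y.1 (p₀ y.2) (p₁ y.2))
    continuous_toFun := hc
    map_zero_left := fun x => (congrArg (incl S) (segment_zero _ _)).trans (h₀ x).symm
    map_one_left := fun x => (congrArg (incl S) (segment_one _ _)).trans (h₁ x).symm
    prop' := fun t => hequiv t }⟩

/-- The partial Borel–Serre spaces are universal proper spaces. -/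
lemma isUniversalProper (hm : Squarefree m) : IsUniversalProper.{u} (Bianchi m) (BorelSerre S) where
  isProper := isProperSpace S hm
  exists_map _ _ _ hX := exists_equivariant S hX
  unique_map _ _ _ _ f₀ f₁ hf₀ hf₁ := by
    obtain ⟨g₀, p₀, hp₀, hg₀, H₀⟩ := exists_homotopic_incl S f₀ hf₀
    obtain ⟨g₁, p₁, hp₁, hg₁, H₁⟩ := exists_homotopic_incl S f₁ hf₁
    exact (H₀.trans (homotopicWith_of_incl S p₀ p₁ hp₀ hp₁ hg₀ hg₁)).trans H₁.symm

end BorelSerre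

end Universal

/-! ### Homotopy invariance of the Kasparov groups -/

section FibrewiseOperators

variable {E : Type*} [NormedAddCommGroup E] [NormedSpace ℂ E]

/-- The operator on `C([0,1], E)` given by a continuous family of operators. -/
def fibrewise : C(unitInterval, E →L[ℂ] E) →L[ℂ] (C(unitInterval, E) →L[ℂ] C(unitInterval, E)) :=
  LinearMap.mkContinuous₂
    (LinearMap.mk₂ ℂ (fun (T : C(unitInterval, E →L[ℂ] E)) (ξ : C(unitInterval, E)) =>
        (⟨fun t => T t (ξ t), T.continuous.clm_apply ξ.continuous⟩ : C(unitInterval, E)))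
      (fun _ _ _ => rfl) (fun _ _ _ => rfl)
      (fun T ξ η => ContinuousMap.ext fun t => (T t).map_add (ξ t) (η t))
      (fun c T ξ => ContinuousMap.ext fun t => (T t).map_smul c (ξ t))) 1
    (fun T ξ => by
      rw [one_mul, ContinuousMap.norm_le _ (by positivity)]
      intro t
      exact (T t).le_of_opNorm_le_of_le (T.norm_coe_le_norm t) (ξ.norm_coe_le_norm t))

lemma fibrewise_mul (S T : C(unitInterval, E →L[ℂ] E)) :
    fibrewise (S * T) = fibrewise S * fibrewise T := rfl

lemma fibrewise_sub (S T : C(unitInterval, E →L[ℂ] E)) :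
    fibrewise (S - T) = fibrewise S - fibrewise T := rfl

lemma fibrewise_one : fibrewise (1 : C(unitInterval, E →L[ℂ] E)) = 1 := rfl

variable [CStarModule ℂ E]

/-- The Hilbert module of continuous families of vectors of a Hilbert space. -/
instance : CStarModule C(unitInterval, ℂ) C(unitInterval, E) where
  inner ξ η := ⟨fun t => inner ℂ (ξ t) (η t),
    CStarModule.continuous_inner.comp (ξ.continuous.prodMk η.continuous)⟩
  inner_add_right := ContinuousMap.ext fun _ => CStarModule.inner_add_right
  inner_self_nonneg := ContinuousMap.le_def.2 fun _ => CStarModule.inner_self_nonneg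
  inner_self {ξ} := by
    simp only [ContinuousMap.ext_iff]
    exact forall_congr' fun t => CStarModule.inner_self
  inner_op_smul_right := ContinuousMap.ext fun _ => CStarModule.inner_op_smul_right
  inner_smul_right_complex := ContinuousMap.ext fun _ => CStarModule.inner_smul_right_complex
  star_inner _ _ := ContinuousMap.ext fun _ => CStarModule.star_inner _ _
  norm_eq_sqrt_norm_inner_self ξ := by
    refine le_antisymm ((ContinuousMap.norm_le _ (Real.sqrt_nonneg _)).2 fun t => ?_)
      (Real.sqrt_le_iff.2 ⟨norm_nonneg _, (ContinuousMap.norm_le _ (by positivity)).2 fun t => ?_⟩)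
    · rw [CStarModule.norm_eq_sqrt_norm_inner_self (A := ℂ)]
      exact Real.sqrt_le_sqrt (ContinuousMap.norm_coe_le_norm
        (⟨fun t => inner ℂ (ξ t) (ξ t), CStarModule.continuous_inner.comp
          (ξ.continuous.prodMk ξ.continuous)⟩ : C(unitInterval, ℂ)) t)
    · change ‖inner ℂ (ξ t) (ξ t)‖ ≤ _
      rw [← CStarModule.norm_sq_eq ℂ]
      gcongr
      exact ξ.norm_coe_le_norm t

lemma isAdj_fibrewise {S T : C(unitInterval, E →L[ℂ] E)} (h : ∀ t, IsAdj ℂ (S t) (T t)) :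
    IsAdj C(unitInterval, ℂ) (fibrewise S) (fibrewise T) :=
  fun ξ η => ContinuousMap.ext fun t => h t (ξ t) (η t)

/-- A norm continuous family of compact operators is a compact operator. -/
lemma fibrewise_mem_compactOps {T : C(unitInterval, E →L[ℂ] E)} (h : ∀ t, T t ∈ compactOps ℂ E) :
    fibrewise T ∈ compactOps C(unitInterval, ℂ) C(unitInterval, E) := by
  let M := (Submodule.span ℂ {T : C(unitInterval, E) →L[ℂ] C(unitInterval, E) |
    ∃ x y : C(unitInterval, E), ∀ v, T v = inner C(unitInterval, ℂ) y v • x}).topologicalClosure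
  have hM : IsClosed (M : Set (C(unitInterval, E) →L[ℂ] C(unitInterval, E))) :=
    Submodule.isClosed_topologicalClosure _
  change fibrewise T ∈ M
  -- A function times a constant rank-one operator is rank one over C([0,1]), with the function
  -- absorbed in the vector; linearity and continuity extend this to all compact A.
  have key : ∀ (f : C(unitInterval, ℝ)), ∀ A ∈ compactOps ℂ E,
      fibrewise (f • ContinuousMap.const _ A) ∈ M := by
    intro f A hA
    let L : (E →L[ℂ] E) →ₗ[ℂ] (C(unitInterval, E) →L[ℂ] C(unitInterval, E)) :=
      { toFun := fun A => fibrewise (f • ContinuousMap.const _ A)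
        map_add' := fun A B => by
          exact ContinuousLinearMap.ext fun ξ => ContinuousMap.ext fun t =>
            smul_add (f t) (A (ξ t)) (B (ξ t))
        map_smul' := fun c A => by
          exact ContinuousLinearMap.ext fun ξ => ContinuousMap.ext fun t =>
            smul_comm (f t) c (A (ξ t)) }
    have hL : Continuous L := by
      refine fibrewise.continuous.comp (ContinuousMap.continuous_of_continuous_uncurry _ ?_)
      exact (f.continuous.comp continuous_snd).smul continuous_fst
    have hspan : Submodule.span ℂ {T : E →L[ℂ] E | ∃ x y : E, ∀ v, T v = inner ℂ y v • x} ≤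
        M.comap L := by
      rw [Submodule.span_le]
      rintro B ⟨x, y, hB⟩
      refine Submodule.le_topologicalClosure _ (Submodule.subset_span
        ⟨f • ContinuousMap.const _ x, ContinuousMap.const _ y, fun ξ => ?_⟩)
      refine ContinuousMap.ext fun t => ?_
      change f t • B (ξ t) = inner ℂ y (ξ t) • (f t • x)
      rw [hB, smul_comm]
    exact (hM.preimage hL).closure_subset_iff.2 hspan hA
  -- The Bernstein approximations of T converge uniformly and are finite sums of functions times the
  -- compact operators T(k/n).
  refine hM.mem_of_tendsto ((fibrewise.continuous.tendsto T).comp (bernsteinApproximation_uniform T))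
    (Filter.Eventually.of_forall fun n => ?_)
  change bernsteinApproximation n T ∈ M.comap fibrewise.toLinearMap
  exact Submodule.sum_mem _ fun k _ => key _ _ (h _)

end FibrewiseOperators

/-! ### Proper homotopies induce Kasparov homotopies -/

section Homotopy

/-- A cycle over ℂ carries a module action of its own besides that of the normed space. Both act in
the same way inside the definite inner product, so they coincide. -/
lemma smul_eq_of_cstarModule {E : Type*} [NormedAddCommGroup E] [NormedSpace ℂ E] (s : SMul ℂ E)
    [CStarModule ℂ E] : s = NormedSpace.toModule.toSMul := by
  ext a v
  let w : E := s.smul a v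
  let w' : E := (NormedSpace.toModule : Module ℂ E).toSMul.smul a v
  have h : ∀ u : E, inner ℂ u w = a * inner ℂ u v := fun u => CStarModule.inner_op_smul_right
  have h' : ∀ u : E, inner ℂ u w' = a * inner ℂ u v :=
    fun u => CStarModule.inner_smul_right_complex
  change w = w'
  rw [← sub_eq_zero, ← CStarModule.inner_self (A := ℂ), CStarModule.inner_sub_right, h, h',
    sub_self]

/-- With the inner product E is a Hilbert space and φ a ⋆-homomorphism of C⋆-algebras, hence
contractive. Continuity of the representation thus need not be part of a cycle. -/
lemma norm_apply_le_of_isAdj {Y : Type*} [TopologicalSpace Y] {E : Type*} [NormedAddCommGroup E]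
    [NormedSpace ℂ E] [CStarModule ℂ E] [CompleteSpace E] (φ : C₀(Y, ℂ) →ₙₐ[ℂ] (E →L[ℂ] E))
    (hφ : ∀ a, IsAdj ℂ (φ a) (φ (star a))) (a : C₀(Y, ℂ)) : ‖φ a‖ ≤ ‖a‖ := by
  let _ : InnerProductSpace ℂ E :=
    { norm_sq_eq_re_inner := fun x => by
        have h := Complex.eq_coe_norm_of_nonneg (CStarModule.inner_self_nonneg (A := ℂ) (x := x))
        rw [CStarModule.norm_sq_eq ℂ, h]
        simp
      conj_inner_symm := fun x y => CStarModule.star_inner y x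
      add_left := fun x y z => CStarModule.inner_add_left
      smul_left := fun x y r => CStarModule.inner_smul_left_complex }
  let ψ : C₀(Y, ℂ) →⋆ₙₐ[ℂ] (E →L[ℂ] E) :=
    { φ with
      map_star' := fun b => by
        refine (ContinuousLinearMap.eq_adjoint_iff _ _).2 fun x y => ?_
        have := hφ (star b) x y
        rwa [star_star] at this }
  exact NonUnitalStarAlgHom.norm_apply_le ψ a

variable {Γ : Type*} [Group Γ] {j : ZMod 2} {Y W : Type*} [TopologicalSpace Y] [MulAction Γ Y]
  [TopologicalSpace W] [MulAction Γ W]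

/-- Outside a compact set independent of t all values of a ∘ p t are small; on it, compactness turns
joint continuity into uniform closeness. -/
lemma continuous_comp_family (p : unitInterval → CocompactMap Y W)
    (hc : Continuous fun q : unitInterval × Y => p q.1 q.2)
    (hK : ∀ L : Set W, IsCompact L → ∃ K : Set Y, IsCompact K ∧ ∀ t, ∀ y ∉ K, p t y ∉ L)
    (a : C₀(W, ℂ)) : Continuous fun t => a.comp (p t) := by
  rw [continuous_iff_continuousAt]
  intro t₀
  rw [ContinuousAt, Metric.tendsto_nhds]
  intro ε hε
  have ha : ∀ᶠ w in cocompact W, ‖a w‖ < ε / 4 := by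
    have := (zero_at_infty a).norm
    rw [norm_zero] at this
    exact this.eventually (gt_mem_nhds (by positivity))
  obtain ⟨L, hL, hLa⟩ := mem_cocompact.1 ha
  obtain ⟨K, hKc, hKL⟩ := hK L hL
  have hloc : ∀ᶠ t in 𝓝 t₀, ∀ y ∈ K, dist (a (p t y)) (a (p t₀ y)) < ε / 2 := by
    refine hKc.eventually_forall_of_forall_eventually fun y _ => ?_
    have h1 : Continuous fun q : unitInterval × Y =>
        dist (a (p q.1 q.2)) (a (p t₀ q.2)) := by
      refine (a.continuous.comp hc).dist (a.continuous.comp ((p t₀).continuous.comp continuous_snd))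
    have h2 := h1.continuousAt (x := (t₀, y))
    refine h2.eventually (gt_mem_nhds ?_)
    simpa using hε
  filter_upwards [hloc] with t ht
  have hle : dist (a.comp (p t)) (a.comp (p t₀)) ≤ ε / 2 := by
    rw [← ZeroAtInftyContinuousMap.dist_toBCF_eq_dist,
      BoundedContinuousFunction.dist_le (by positivity)]
    intro y
    change dist (a (p t y)) (a (p t₀ y)) ≤ ε / 2
    by_cases hy : y ∈ K
    · exact (ht y hy).le
    · have h1 : ‖a (p t y)‖ < ε / 4 := hLa (hKL t y hy)
      have h2 : ‖a (p t₀ y)‖ < ε / 4 := hLa (hKL t₀ y hy)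
      rw [dist_eq_norm]
      linarith [norm_sub_le (a (p t y)) (a (p t₀ y))]
  linarith

/-- The push-forwards of a cycle along properly homotopic maps are homotopic. -/
lemma isHomotopic_map (p : unitInterval → CocompactMap Y W) (hp : ∀ t, IsEquivariant Γ (p t))
    (hc : Continuous fun q : unitInterval × Y => p q.1 q.2)
    (hK : ∀ L : Set W, IsCompact L → ∃ K : Set Y, IsCompact K ∧ ∀ t, ∀ y ∉ K, p t y ∉ L)
    (x : Cycle Γ j Y ℂ) : IsHomotopic (x.map (p 0) (hp 0)) (x.map (p 1) (hp 1)) := by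
  rcases x with @⟨E, _, _, s, _, _, _, ε, φ, φ_star, U, U_inner, covariant, F, Fadj, F_adj, F_comm,
    F_sq, F_selfadj, F_equivariant, grading_even, grading_odd⟩
  obtain rfl := smul_eq_of_cstarModule s
  have hφ : Continuous φ := AddMonoidHomClass.continuous_of_bound φ 1 fun a => by
    rw [one_mul]; exact norm_apply_le_of_isAdj φ φ_star a
  -- The module of the homotopy is C([0,1], E) and only the representation varies with t; its norm
  -- continuity is what `fibrewise` requires.
  let Φ : C₀(W, ℂ) → C(unitInterval, E →L[ℂ] E) := fun a =>
    ⟨fun t => φ (a.comp (p t)), hφ.comp (continuous_comp_family p hc hK a)⟩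
  have : SecondCountableTopology E := UniformSpace.secondCountable_of_separable E
  let c : (E →L[ℂ] E) → C(unitInterval, E →L[ℂ] E) := ContinuousMap.const _
  let h : Cycle Γ j W C(unitInterval, ℂ) :=
    { E := C(unitInterval, E)
      grading := fibrewise (c ε)
      φ :=
        { toFun := fun a => fibrewise (Φ a)
          map_smul' := fun z a => by
            refine ContinuousLinearMap.ext fun ξ => ContinuousMap.ext fun t => ?_
            exact congrArg (fun T : E →L[ℂ] E => T (ξ t)) (map_smul φ z (a.comp (p t)))
          map_zero' := by
            refine ContinuousLinearMap.ext fun ξ => ContinuousMap.ext fun t => ?_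
            exact congrArg (fun T : E →L[ℂ] E => T (ξ t)) (map_zero φ)
          map_add' := fun a b => by
            refine ContinuousLinearMap.ext fun ξ => ContinuousMap.ext fun t => ?_
            exact congrArg (fun T : E →L[ℂ] E => T (ξ t)) (map_add φ (a.comp (p t)) (b.comp (p t)))
          map_mul' := fun a b => by
            refine ContinuousLinearMap.ext fun ξ => ContinuousMap.ext fun t => ?_
            exact congrArg (fun T : E →L[ℂ] E => T (ξ t))
              (map_mul φ (a.comp (p t)) (b.comp (p t))) }
      φ_star := fun a => isAdj_fibrewise fun t => φ_star (a.comp (p t))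
      U :=
        { toFun := fun γ => fibrewise (c (U γ))
          map_one' := by
            rw [map_one]; exact fibrewise_one
          map_mul' := fun γ δ => by
            rw [map_mul, ← fibrewise_mul]; rfl }
      U_inner := fun γ ξ η => ContinuousMap.ext fun t => U_inner γ (ξ t) (η t)
      covariant := fun γ a b hab => by
        change fibrewise (c (U γ)) * fibrewise (Φ a) = fibrewise (Φ b) * fibrewise (c (U γ))
        rw [← fibrewise_mul, ← fibrewise_mul]
        refine congrArg fibrewise (ContinuousMap.ext fun t => covariant γ _ _ fun y => ?_)
        change b (p t (γ • y)) = a (p t y)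
        rw [hp, hab]
      F := fibrewise (c F)
      Fadj := fibrewise (c Fadj)
      F_adj := isAdj_fibrewise fun _ => F_adj
      F_comm := fun a => by
        change fibrewise (c F) * fibrewise (Φ a) - fibrewise (Φ a) * fibrewise (c F) ∈ _
        rw [← fibrewise_mul, ← fibrewise_mul, ← fibrewise_sub]
        exact fibrewise_mem_compactOps fun t => F_comm _
      F_sq := fun a => by
        change fibrewise (Φ a) * (fibrewise (c F) * fibrewise (c F) - 1) ∈ _
        rw [← fibrewise_one, ← fibrewise_mul, ← fibrewise_sub, ← fibrewise_mul]
        exact fibrewise_mem_compactOps fun t => F_sq _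
      F_selfadj := fun a => by
        change fibrewise (Φ a) * (fibrewise (c F) - fibrewise (c Fadj)) ∈ _
        rw [← fibrewise_sub, ← fibrewise_mul]
        exact fibrewise_mem_compactOps fun t => F_selfadj _
      F_equivariant := fun γ a => by
        change fibrewise (Φ a) * (fibrewise (c (U γ)) * fibrewise (c F) * fibrewise (c (U γ⁻¹)) -
          fibrewise (c F)) ∈ _
        rw [← fibrewise_mul, ← fibrewise_mul, ← fibrewise_sub, ← fibrewise_mul]
        exact fibrewise_mem_compactOps fun t => F_equivariant γ _
      grading_even := fun hj => by
        obtain ⟨h1, h2, h3, h4, h5⟩ := grading_even hj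
        refine ⟨?_, isAdj_fibrewise fun _ => h2, fun a => ?_, fun γ => ?_, ?_⟩
        · rw [← fibrewise_mul, ← fibrewise_one]
          exact congrArg fibrewise (ContinuousMap.ext fun t => h1)
        · change fibrewise (c ε) * fibrewise (Φ a) = fibrewise (Φ a) * fibrewise (c ε)
          rw [← fibrewise_mul, ← fibrewise_mul]
          exact congrArg fibrewise (ContinuousMap.ext fun t => h3 _)
        · change fibrewise (c ε) * fibrewise (c (U γ)) = fibrewise (c (U γ)) * fibrewise (c ε)
          rw [← fibrewise_mul, ← fibrewise_mul]
          exact congrArg fibrewise (ContinuousMap.ext fun t => h4 γ)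
        · refine ContinuousLinearMap.ext fun ξ => ContinuousMap.ext fun t => ?_
          exact congrArg (fun T : E →L[ℂ] E => T (ξ t)) h5
      grading_odd := fun hj => by
        rw [grading_odd hj]; exact fibrewise_one }
  have hev : ∀ t, IsEvalAt t h (Cycle.map (p t) (hp t)
      (@Cycle.mk Γ _ j Y _ _ ℂ _ _ E _ _ _ _ _ _ ε φ φ_star U U_inner
        covariant F Fadj F_adj F_comm F_sq F_selfadj F_equivariant grading_even grading_odd)) := by
    intro t
    let q : C(unitInterval, E) →L[ℂ] E := ContinuousMap.evalCLM ℂ t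
    refine ⟨q, fun ξ => ⟨rfl, fun a => rfl, fun γ => rfl, rfl⟩, ?_, fun ξ η => rfl⟩
    exact Function.Surjective.denseRange fun v => ⟨ContinuousMap.const _ v, rfl⟩
  exact ⟨h, hev 0, hev 1⟩

end Homotopy

/-! ### Functoriality and homotopy invariance of the push-forward -/

section Functoriality

variable {Γ : Type*} [Group Γ] {j : ZMod 2} {Y W V : Type*} [TopologicalSpace Y] [MulAction Γ Y]
  [TopologicalSpace W] [MulAction Γ W] [TopologicalSpace V] [MulAction Γ V]

lemma KK.hom_ext {A : Type*} [AddCommGroup A] {φ ψ : KK Γ j Y →+ A}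
    (h : ∀ x : Cycle Γ j Y ℂ, φ x.cls = ψ x.cls) : φ = ψ := by
  refine QuotientAddGroup.addMonoidHom_ext _ ?_
  exact FreeAbelianGroup.lift_ext _ _ h

lemma KK.map_map {p : CocompactMap Y W} {q : CocompactMap W V} {r : CocompactMap Y V}
    (hp : IsEquivariant Γ p) (hq : IsEquivariant Γ q) (hr : IsEquivariant Γ r)
    (h : ∀ y, r y = q (p y)) (z : KK Γ j Y) : KK.map q hq (KK.map p hp z) = KK.map r hr z := by
  obtain rfl : r = q.comp p := DFunLike.ext _ _ h
  refine DFunLike.congr_fun (f := (KK.map q hq).comp (KK.map p hp)) (KK.hom_ext fun x => ?_) z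
  rw [AddMonoidHom.comp_apply, KK.map_cls, KK.map_cls, KK.map_cls]
  rfl

lemma KK.map_id {p : CocompactMap Y Y} (hp : IsEquivariant Γ p) (h : ∀ y, p y = y)
    (z : KK Γ j Y) : KK.map p hp z = z := by
  obtain rfl : p = CocompactMap.id Y := DFunLike.ext _ _ h
  refine DFunLike.congr_fun (g := AddMonoidHom.id _) (KK.hom_ext fun x => ?_) z
  rw [KK.map_cls]
  rfl

/-- Homotopy invariance of the Kasparov groups on `Γ`-compact spaces. -/
lemma KK.map_eq_of_homotopy (hY : IsGCompact Γ Y) (hc : ∀ γ : Γ, Continuous fun y : Y => γ • y)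
    (hW : ∀ C L : Set W, IsCompact C → IsCompact L → {γ : Γ | ∃ c ∈ C, γ • c ∈ L}.Finite)
    (H : C(unitInterval × Y, W)) (hH : ∀ t, IsEquivariant Γ fun y => H (t, y))
    {p₀ p₁ : CocompactMap Y W} (hp₀ : IsEquivariant Γ p₀) (hp₁ : IsEquivariant Γ p₁)
    (h₀ : ∀ y, p₀ y = H (0, y)) (h₁ : ∀ y, p₁ y = H (1, y)) (z : KK Γ j Y) :
    KK.map p₀ hp₀ z = KK.map p₁ hp₁ z := by
  let p : unitInterval → CocompactMap Y W := fun t =>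
    { toFun := fun y => H (t, y)
      cocompact_tendsto' := tendsto_cocompact_of_equivariant hY hc hW
        ⟨fun y => H (t, y), by fun_prop⟩ (hH t) }
  obtain rfl : p₀ = p 0 := DFunLike.ext _ _ h₀
  obtain rfl : p₁ = p 1 := DFunLike.ext _ _ h₁
  refine DFunLike.congr_fun (KK.hom_ext fun x => ?_) z
  rw [KK.map_cls, KK.map_cls]
  refine (QuotientAddGroup.eq_iff_sub_mem).2 (AddSubgroup.subset_closure (Or.inr
    ⟨_, _, isHomotopic_map p hH H.continuous (fun L hL => ?_) x, rfl⟩))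
  obtain ⟨C, hC, hcov⟩ := hY
  -- Uniform properness: the whole homotopy maps C into one compact set, of which only finitely many
  -- translates meet L.
  have hfin := hW (H '' (Set.univ ×ˢ C)) L ((isCompact_univ.prod hC).image H.continuous) hL
  refine ⟨_, hfin.isCompact_biUnion fun γ _ => hC.image (hc γ), fun t y hy hyL => hy ?_⟩
  obtain ⟨γ, c, hcC, rfl⟩ := hcov y
  refine Set.mem_biUnion (x := γ) ⟨H (t, c), ⟨(t, c), ⟨trivial, hcC⟩, rfl⟩, ?_⟩ ⟨c, hcC, rfl⟩
  rw [← hH t γ c]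
  exact hyL

end Functoriality

/-! ### Homotopy equivalences and the direct limit -/

section DirectLimit

variable {Γ : Type*} [Group Γ] {j : ZMod 2} {Z : Type*} [TopologicalSpace Z] [MulAction Γ Z]

open scoped Classical in
lemma RKK.of_map (hZ : IsProperSpace Γ Z) {Y Y' : GCompactSub Γ Z} (h : Y ≤ Y') (x : KK Γ j Y.1) :
    RKK.of j hZ Y' (KK.map (inclProper hZ h) (inclProper_equivariant hZ h) x) = RKK.of j hZ Y x :=
  AddCommGroup.DirectLimit.of_f (G := fun Y : GCompactSub Γ Z => KK Γ j Y.1)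
    (f := fun _ _ h => KK.map (inclProper hZ h) (inclProper_equivariant hZ h)) h x

open scoped Classical in
lemma RKK.hom_ext {A : Type*} [AddCommGroup A] {hZ : IsProperSpace Γ Z} {φ ψ : RKK j hZ →+ A}
    (h : ∀ Y x, φ (RKK.of j hZ Y x) = ψ (RKK.of j hZ Y x)) : φ = ψ :=
  AddCommGroup.DirectLimit.hom_ext (G := fun Y : GCompactSub Γ Z => KK Γ j Y.1)
    (f := fun _ _ h => KK.map (inclProper hZ h) (inclProper_equivariant hZ h))
    (P := A) (g₁ := φ) (g₂ := ψ) fun Y => AddMonoidHom.ext (h Y)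

open scoped Classical in
/-- The homomorphism from the direct limit induced by an equivariant map. -/
def RKK.lift {W : Type*} [TopologicalSpace W] [MulAction Γ W] (hZ : IsProperSpace Γ Z)
    (hW : IsProperSpace Γ W) (f : C(Z, W)) (hf : IsEquivariant Γ f) : RKK j hZ →+ KK Γ j W :=
  AddCommGroup.DirectLimit.lift _ _ _
    (fun Y => KK.map (restrictProper hZ hW f hf Y) (restrictProper_equivariant hZ hW f hf Y))
    fun _ _ _ x => KK.map_map _ _ _ (fun _ => rfl) x

open scoped Classical in
lemma RKK.lift_of {W : Type*} [TopologicalSpace W] [MulAction Γ W] (hZ : IsProperSpace Γ Z)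
    (hW : IsProperSpace Γ W) (f : C(Z, W)) (hf : IsEquivariant Γ f) (Y : GCompactSub Γ Z)
    (x : KK Γ j Y.1) : RKK.lift hZ hW f hf (RKK.of j hZ Y x) =
      KK.map (restrictProper hZ hW f hf Y) (restrictProper_equivariant hZ hW f hf Y) x :=
  AddCommGroup.DirectLimit.lift_of _ _ _ _ _

/-- The `Γ`-compact subspace generated by a compact set. -/
def saturation {C : Set Z} (hC : IsCompact C) : GCompactSub Γ Z :=
  ⟨{ carrier := {z | ∃ γ : Γ, ∃ c ∈ C, γ • c = z}
     smul_mem' := by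
      rintro δ _ ⟨γ, c, hc, rfl⟩
      exact ⟨δ * γ, c, hc, mul_smul _ _ _⟩ },
    (↑) ⁻¹' C, by
      rw [Subtype.isCompact_iff, Set.image_preimage_eq_of_subset]
      · exact hC
      · exact fun c hc => ⟨⟨c, 1, c, hc, one_smul _ _⟩, rfl⟩, by
      rintro ⟨_, γ, c, hc, rfl⟩
      exact ⟨γ, ⟨c, 1, c, hc, one_smul _ _⟩, hc, rfl⟩⟩

lemma finite_return_sub (hZ : IsProperSpace Γ Z) (Y : SubMulAction Γ Z) (C L : Set Y)
    (hC : IsCompact C) (hL : IsCompact L) : {γ : Γ | ∃ c ∈ C, γ • c ∈ L}.Finite :=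
  (hZ.finite_return (hC.image continuous_subtype_val) (hL.image continuous_subtype_val)).subset
    fun _ ⟨c, hc, hcL⟩ => ⟨c, ⟨c, hc, rfl⟩, _, hcL, rfl⟩

lemma continuous_smul_sub (hZ : IsProperSpace Γ Z) (Y : SubMulAction Γ Z) (γ : Γ) :
    Continuous fun y : Y => γ • y :=
  Continuous.subtype_mk ((hZ.continuous_smul γ).comp continuous_subtype_val) _

/-- The homomorphism induced by a map to a `Γ`-compact proper space is an isomorphism from the
direct limit if the map is a homotopy equivalence. -/
lemma RKK.exists_equiv {W : Type*} [TopologicalSpace W] [MulAction Γ W] (hZ : IsProperSpace Γ Z)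
    (hW : IsProperSpace Γ W) (hWc : IsGCompact Γ W) (f : C(Z, W)) (hf : IsEquivariant Γ f)
    (g : C(W, Z)) (hg : IsEquivariant Γ g)
    (hfg : ContinuousMap.HomotopicWith (f.comp g) (ContinuousMap.id W)
      (fun h => IsEquivariant Γ h))
    (hgf : ContinuousMap.HomotopicWith (ContinuousMap.id Z) (g.comp f)
      (fun h => IsEquivariant Γ h)) :
    ∃ Φ : RKK j hZ ≃+ KK Γ j W, ∀ z, Φ z = RKK.lift hZ hW f hf z := by
  obtain ⟨H⟩ := hfg
  obtain ⟨G⟩ := hgf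
  have hH : ∀ t, IsEquivariant Γ fun w => H (t, w) := H.prop
  have hG : ∀ t, IsEquivariant Γ fun z => G (t, z) := G.prop
  obtain ⟨C, hC, hcov⟩ := id hWc
  have hgC : IsCompact (g '' C) := hC.image g.continuous
  -- Since W = Γ · C, the image of g lies in the Γ-compact set Γ · g(C), so g induces a map into the
  -- limit.
  let Y₀ := saturation (Γ := Γ) hgC
  have hgY : ∀ w, g w ∈ Y₀.1 := by
    intro w
    obtain ⟨γ, c, hc, rfl⟩ := hcov w
    exact ⟨γ, g c, ⟨c, hc, rfl⟩, (hg γ c).symm⟩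
  let g₀ : CocompactMap W Y₀.1 :=
    { toFun := fun w => ⟨g w, hgY w⟩
      cocompact_tendsto' := tendsto_cocompact_of_equivariant hWc hW.continuous_smul
        (finite_return_sub hZ Y₀.1) ⟨fun w => (⟨g w, hgY w⟩ : Y₀.1), by fun_prop⟩
        fun γ w => Subtype.ext (hg γ w) }
  have hg₀ : IsEquivariant Γ g₀ := fun γ w => Subtype.ext (hg γ w)
  let Ψ : KK Γ j W →+ RKK j hZ := (RKK.of j hZ Y₀).comp (KK.map g₀ hg₀)
  have right : ∀ z, RKK.lift hZ hW f hf (Ψ z) = z := by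
    intro z
    change RKK.lift hZ hW f hf (RKK.of j hZ Y₀ (KK.map g₀ hg₀ z)) = z
    have hfg₀ : IsEquivariant Γ ((restrictProper hZ hW f hf Y₀).comp g₀) := fun γ w => by
      change f (g (γ • w)) = γ • f (g w)
      rw [hg, hf]
    rw [RKK.lift_of, KK.map_map (r := (restrictProper hZ hW f hf Y₀).comp g₀) _ _ hfg₀
      (fun _ => rfl)]
    have hid : IsEquivariant Γ (CocompactMap.id W) := fun _ _ => rfl
    rw [KK.map_eq_of_homotopy hWc hW.continuous_smul (fun _ _ => hW.finite_return)
      H.toContinuousMap hH hfg₀ hid (fun w => (H.apply_zero w).symm) (fun w => (H.apply_one w).symm),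
      KK.map_id _ fun _ => rfl]
  have left : ∀ z, Ψ (RKK.lift hZ hW f hf z) = z := by
    refine DFunLike.congr_fun (f := Ψ.comp (RKK.lift hZ hW f hf)) (g := AddMonoidHom.id _)
      (RKK.hom_ext fun Y x => ?_)
    change Ψ (RKK.lift hZ hW f hf (RKK.of j hZ Y x)) = RKK.of j hZ Y x
    rw [RKK.lift_of]
    change RKK.of j hZ Y₀ (KK.map g₀ hg₀ _) = _
    have hgf₀ : IsEquivariant Γ (g₀.comp (restrictProper hZ hW f hf Y)) := fun γ y => by
      refine Subtype.ext ?_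
      change g (f (γ • (y : Z))) = γ • g (f y)
      rw [hf, hg]
    rw [KK.map_map (r := g₀.comp (restrictProper hZ hW f hf Y)) _ _ hgf₀ (fun _ => rfl)]
    obtain ⟨K, hK, hKcov⟩ := id Y.2
    -- The homotopy from the identity to g ∘ f may leave Y and Y₀. It stays in this larger Γ-compact
    -- subspace, where the two push-forwards agree, and hence they agree in the limit.
    have hK₂ : IsCompact (G '' (Set.univ ×ˢ ((↑) '' K)) ∪ g '' C) :=
      ((isCompact_univ.prod (hK.image continuous_subtype_val)).image G.continuous).union hgC
    let Y₂ := saturation (Γ := Γ) hK₂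
    have hGY : ∀ (t : unitInterval) (y : Y.1), G (t, (y : Z)) ∈ Y₂.1 := by
      intro t y
      obtain ⟨γ, c, hc, rfl⟩ := hKcov y
      exact ⟨γ, G (t, c), Or.inl ⟨(t, c), ⟨trivial, c, hc, rfl⟩, rfl⟩, (hG t γ c).symm⟩
    have hle : Y ≤ Y₂ := by
      intro y hy
      have := hGY 0 ⟨y, hy⟩
      rwa [G.apply_zero] at this
    have hle₀ : Y₀ ≤ Y₂ := fun z ⟨γ, c, hc, hz⟩ => ⟨γ, c, Or.inr hc, hz⟩
    have he : IsEquivariant Γ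
        ((inclProper hZ hle₀).comp (g₀.comp (restrictProper hZ hW f hf Y))) :=
      fun γ y => by
        have h := congrArg Subtype.val (hgf₀ γ y)
        exact Subtype.ext h
    rw [← RKK.of_map hZ hle, ← RKK.of_map hZ hle₀,
      KK.map_map (r := (inclProper hZ hle₀).comp (g₀.comp (restrictProper hZ hW f hf Y))) _ _ he
        (fun _ => rfl)]
    congr 1
    symm
    refine KK.map_eq_of_homotopy Y.2 (continuous_smul_sub hZ Y.1) (finite_return_sub hZ Y₂.1)
      ⟨fun q => ⟨G (q.1, (q.2 : Z)), hGY q.1 q.2⟩, by fun_prop⟩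
      (fun t γ y => Subtype.ext (hG t γ y)) _ _ (fun y => Subtype.ext (G.apply_zero (y : Z)).symm)
      (fun y => Subtype.ext (G.apply_one (y : Z)).symm) x
  exact ⟨{ RKK.lift hZ hW f hf with
    invFun := Ψ
    left_inv := left
    right_inv := right }, fun _ => rfl⟩

end DirectLimit

/-- Z is only tested against spaces in its own universe, so H(P) is lifted there first. -/
lemma exists_equivariant_inverse {m : ℕ} (hm : Squarefree m) {Z : Type u} [TopologicalSpace Z]
    [MulAction (Bianchi m) Z] (hZ : IsUniversalProper.{u} (Bianchi m) Z) :
    ∃ g : C(HP m, Z), IsEquivariant (Bianchi m) g := by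
  obtain ⟨g, hg⟩ := hZ.exists_map (ULift.{u} (HP m)) (BorelSerre.isProperSpace_ulift _ hm)
  exact ⟨g.comp ⟨ULift.up, continuous_uliftUp⟩, fun γ x => hg γ (ULift.up x)⟩

end BS

end

theorem mainTheorem4 (m : ℕ) (hm : Squarefree m) :
    ∃ h : ∀ S : BS.CuspSet (BS.imagQuad m), BS.IsUniversalProper.{u} (BS.Bianchi m) (BS.HS S),
      CompactSpace (Quotient (MulAction.orbitRel (BS.Bianchi m) (BS.HP m))) ∧
      ∀ (Z : Type u) [TopologicalSpace Z] [MulAction (BS.Bianchi m) Z]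
        (hZ : BS.IsUniversalProper.{u} (BS.Bianchi m) Z) (j : ZMod 2)
        (f : C(Z, BS.HP m)) (hf : BS.IsEquivariant (BS.Bianchi m) f),
        ∃ Φ : BS.RKK j hZ.isProper ≃+ BS.KK (BS.Bianchi m) j (BS.HP m),
          ∀ (Y : BS.GCompactSub (BS.Bianchi m) Z) (x : BS.KK (BS.Bianchi m) j Y.1),
            Φ (BS.RKK.of j hZ.isProper Y x) =
              BS.KK.map
                (BS.restrictProper hZ.isProper (h (BS.CuspSet.all (BS.imagQuad m))).isProper f hf Y)
                (BS.restrictProper_equivariant hZ.isProper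
                  (h (BS.CuspSet.all (BS.imagQuad m))).isProper f hf Y) x := by
  refine ⟨fun S => BS.BorelSerre.isUniversalProper S hm,
    (BS.BorelSerre.isGCompact hm).compactSpace_quotient, ?_⟩
  intro Z _ _ hZ j f hf
  have hP := BS.BorelSerre.isProperSpace (BS.CuspSet.all (BS.imagQuad m)) hm
  obtain ⟨g, hg⟩ := BS.exists_equivariant_inverse hm hZ
  obtain ⟨Φ, hΦ⟩ := BS.RKK.exists_equiv (j := j) hZ.isProper hP (BS.BorelSerre.isGCompact hm)
    f hf g hg
    -- Both composites are homotopic to identities by uniqueness: f ∘ g because H(P) is universal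
    -- among spaces in its own universe 0, and g ∘ f because Z is universal.
    ((BS.BorelSerre.isUniversalProper.{0} _ hm).unique_map _ hP _ _
      (fun γ x => (congrArg f (hg γ x)).trans (hf γ (g x))) fun _ _ => rfl)
    (hZ.unique_map Z hZ.isProper _ _ (fun _ _ => rfl)
      fun γ z => (congrArg g (hf γ z)).trans (hg γ (f z)))
  exact ⟨Φ, fun Y x => (hΦ _).trans (BS.RKK.lift_of hZ.isProper hP f hf Y x)⟩
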